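/- Let $Q$ be a smooth (Hausdorff) manifold without boundary, of finite dimension $r$, let $\theta=p_a\,du^a$ be the Liouville one-form on $T^*Q$ and $\omega=d\theta$, and let $H\colon T^*Q\times[0,1]\to\mathbb R$ be a smooth, possibly time-dependent, Hamiltonian. Regard Hamiltonian dynamics as a field theory of dimension $1+0$ over $M=[0,1]$: the fields are the smooth curves $\chi=(u,p)\colon[0,1]\to T^*Q$; on $T^*Q\times[0,1]$ one has the form $\Theta_H=p_a\,du^a-H\,dt$; and the Euler–Lagrange one-form on the space of fields is $$\mathrm{EL}_\chi(U)=\int_0^1\chi^*\bigl(i_U\,d\Theta_H\bigr),$$ where $\chi$ is identified with the section $t\mapsto(\chi(t),t)$ and $U$ is any smooth vector field along $\chi$ with values in $T(T^*Q)$ (with free values at the end points). Let $\mathcal{EL}$ be the set of fields $\chi$ with $\mathrm{EL}_\chi=0$, and let $\Pi(\chi)=(\chi(0),\chi(1))\in T^*Q\times T^*Q$ be the restriction to the boundary. Suppose that the flow $\varphi_t\colon T^*Q\to T^*Q$ of Hamilton's equations $\dot u^a=\partial H/\partial p_a$, $\dot p_a=-\partial H/\partial u^a$ exists for all $t\in[0,1]$,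 that is, for every $z\in T^*Q$ the curve $t\mapsto\varphi_t(z)$ satisfies Hamilton's equations on $[0,1]$ and $\varphi_0(z)=z$. Then: 1. $\Pi(\mathcal{EL})=\operatorname{graph}(\varphi_1)=\{(z,w)\in T^*Q\times T^*Q : w=\varphi_1(z)\}$. 2. $\varphi_1$ is a symplectomorphism of $T^*Q$ onto its image, which is an open subset of $T^*Q$. If moreover every point of $T^*Q$ is the value at $t=1$ of some solution of Hamilton's equations on $[0,1]$, then $\varphi_1$ is a symplectomorphism of $T^*Q$ onto itself. 3. $\Pi(\mathcal{EL})$ is a Lagrangian submanifold of $T^*Q\times T^*Q$ with the difference symplectic form $\mathrm{pr}_2^*\omega-\mathrm{pr}_1^*\omega$, that is, an embedded submanifold each of whose tangent spaces equals its own symplectic orthogonal. -/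

import Mathlib

open Set Bundle
open scoped Manifold ContDiff Topology

noncomputable section

namespace HamiltonianField

/-! ### One-forms, exterior derivative and embedded submanifolds of a smooth manifold -/

section Manifolds

variable {V : Type*} [NormedAddCommGroup V] [NormedSpace ℝ V]
  {G : Type*} [TopologicalSpace G] (J : ModelWithCorners ℝ V G)
  {N : Type*} [TopologicalSpace N] [ChartedSpace G N]

/-- The expression of a one-form `η` on `N` in the preferred chart `ψ` at `x₀`, that is, the
pull-back of `η` under `ψ⁻¹`, a one-form on (an open part of) the model vector space. -/
def oneFormInChart (η : ∀ x : N, TangentSpace J x →L[ℝ] ℝ) (x₀ : N) (y : V) : V →L[ℝ] ℝ :=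
  (η ((extChartAt J x₀).symm y)).comp
    (mfderivWithin 𝓘(ℝ, V) J (extChartAt J x₀).symm (range J) y)

/-- The exterior derivative at `x` of a one-form `η` on the subset `s` of `N`, computed in the
preferred chart at `x` by `dη (X, Y) = D_X η (Y) - D_Y η (X)`. A tangent vector at `x` is, in
Mathlib, the vector of its components in the preferred chart at `x`, so that `X` and `Y` need no
conversion. Derivatives are taken within `s`, which is the whole manifold or a domain with
boundary in it. -/
def extDerivOneForm (η : ∀ x : N, TangentSpace J x →L[ℝ] ℝ) (s : Set N) (x : N)
    (X Y : TangentSpace J x) : ℝ :=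
  let D : V →L[ℝ] V →L[ℝ] ℝ := fderivWithin ℝ (oneFormInChart J η x)
    ((extChartAt J x).symm ⁻¹' s ∩ range J) (extChartAt J x x)
  D X Y - D Y X

/-- `e` is a slice chart around `x` for the subset `L` of `N`, with linear slice `F`: a chart of
the smooth structure of `N` in which `L` is the affine subspace `ψ x + F`. -/
structure IsSliceChart (L : Set N) (x : N) (e : OpenPartialHomeomorph N G)
    (F : Submodule ℝ V) : Prop where
  mem_atlas : e ∈ IsManifold.maximalAtlas J ∞ N
  mem_source : x ∈ e.source
  slice : ∀ y ∈ e.source, y ∈ L ↔ e.extend J y - e.extend J x ∈ F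

/-- The tangent space at `x` of a subset which is the slice `F` in the chart `e`. -/
def sliceTangentSpace (x : N) (e : OpenPartialHomeomorph N G) (F : Submodule ℝ V) :
    Set (TangentSpace J x) :=
  {X | (mfderiv J 𝓘(ℝ, V) (e.extend J) x X : V) ∈ F}

/-- `L` is a Lagrangian submanifold of `N` for the two-form `Ω`: it is an embedded submanifold
(there are slice charts around all its points), and each of its tangent spaces is equal to its own
`Ω`-orthogonal. -/
def IsLagrangianSubmanifold (Ω : ∀ x : N, TangentSpace J x → TangentSpace J x → ℝ)
    (L : Set N) : Prop :=
  ∀ x ∈ L, ∃ (e : OpenPartialHomeomorph N G) (F : Submodule ℝ V), IsSliceChart J L x e F ∧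
    ∀ X : TangentSpace J x, X ∈ sliceTangentSpace J x e F ↔
      ∀ Y ∈ sliceTangentSpace J x e F, Ω x X Y = 0

end Manifolds

/-! ### The cotangent bundle and its symplectic form

The configuration space `Q` is a smooth manifold without boundary modelled on the
finite-dimensional space `E`. -/

section Cotangent

variable (E : Type*) [NormedAddCommGroup E] [NormedSpace ℝ E]

/-- The cotangent bundle `T*Q`. -/
abbrev Cotangent (Q : Type*) [TopologicalSpace Q] [ChartedSpace E Q] : Type _ :=
  TotalSpace (E →L[ℝ] ℝ) (fun q : Q => TangentSpace 𝓘(ℝ, E) q →L[ℝ] Trivial Q ℝ q)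

/-- The model with corners of `T*Q`; its model vector space is `E × E*`, and the preferred charts of
`T*Q` are the canonical coordinates `(u, p)` induced by the charts of `Q`. -/
abbrev cotModel : ModelWithCorners ℝ (E × (E →L[ℝ] ℝ)) (ModelProd E (E →L[ℝ] ℝ)) :=
  𝓘(ℝ, E).prod 𝓘(ℝ, E →L[ℝ] ℝ)

variable {E} {Q : Type*} [TopologicalSpace Q] [ChartedSpace E Q] [IsManifold 𝓘(ℝ, E) ∞ Q]

/-- The canonical Liouville one-form `θ = p du` on `T*Q`: `θ_z (X) = z (Tπ X)`. -/
def liouville (z : Cotangent E Q) : TangentSpace (cotModel E) z →L[ℝ] ℝ :=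
  ContinuousLinearMap.comp (show TangentSpace 𝓘(ℝ, E) z.proj →L[ℝ] ℝ from z.snd)
    (mfderiv (cotModel E) 𝓘(ℝ, E) (fun y : Cotangent E Q => y.proj) z)

/-- The canonical symplectic form `ω = dθ` of `T*Q`. -/
def symplecticForm (z : Cotangent E Q) (X Y : TangentSpace (cotModel E) z) : ℝ :=
  extDerivOneForm (cotModel E) (liouville (E := E) (Q := Q)) univ z X Y

/-- The difference symplectic form `pr₂* ω - pr₁* ω` on `T*Q × T*Q`. -/
def diffSymplecticForm (x : Cotangent E Q × Cotangent E Q)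
    (X Y : TangentSpace ((cotModel E).prod (cotModel E)) x) : ℝ :=
  symplecticForm x.2
      (mfderiv ((cotModel E).prod (cotModel E)) (cotModel E) Prod.snd x X)
      (mfderiv ((cotModel E).prod (cotModel E)) (cotModel E) Prod.snd x Y) -
    symplecticForm x.1
      (mfderiv ((cotModel E).prod (cotModel E)) (cotModel E) Prod.fst x X)
      (mfderiv ((cotModel E).prod (cotModel E)) (cotModel E) Prod.fst x Y)

/-- `f` is a symplectomorphism of `T*Q` onto the open subset `W` of `T*Q`: a diffeomorphism onto
`W` with `f* ω = ω`. -/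
structure IsSymplectomorphismOnto (f : Cotangent E Q → Cotangent E Q)
    (W : Set (Cotangent E Q)) : Prop where
  isOpen : IsOpen W
  bijOn : BijOn f univ W
  smooth : ContMDiff (cotModel E) (cotModel E) ∞ f
  smooth_inverse : ∃ g : Cotangent E Q → Cotangent E Q,
    ContMDiffOn (cotModel E) (cotModel E) ∞ g W ∧ InvOn g f univ W
  pullback_eq : ∀ (z : Cotangent E Q) (X Y : TangentSpace (cotModel E) z),
    symplecticForm (f z) (mfderiv (cotModel E) (cotModel E) f z X)
      (mfderiv (cotModel E) (cotModel E) f z Y) = symplecticForm z X Y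

/-! ### Hamiltonian dynamics as a field theory on `[0, 1]`

The covariant phase space is `T*Q × [0, 1]`, as a domain with boundary in `T*Q × ℝ`. Functions of
`t ∈ [0, 1]` are written as functions on `ℝ` whose values outside `[0, 1]` are never used. -/

variable (E Q) in
/-- The covariant phase space `T*Q × [0, 1]`. -/
def phaseDomain : Set (Cotangent E Q × ℝ) := univ ×ˢ Icc (0 : ℝ) 1

/-- The form `Θ_H = p du - H dt`. -/
def thetaH (H : Cotangent E Q × ℝ → ℝ) (x : Cotangent E Q × ℝ) :
    TangentSpace ((cotModel E).prod 𝓘(ℝ, ℝ)) x →L[ℝ] ℝ :=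
  ContinuousLinearMap.comp (liouville x.1)
      (mfderiv ((cotModel E).prod 𝓘(ℝ, ℝ)) (cotModel E) Prod.fst x) -
    H x • (show TangentSpace ((cotModel E).prod 𝓘(ℝ, ℝ)) x →L[ℝ] ℝ from
      mfderiv ((cotModel E).prod 𝓘(ℝ, ℝ)) 𝓘(ℝ, ℝ) Prod.snd x)

/-- The two-form `dΘ_H` on `T*Q × [0, 1]`. -/
def dThetaH (H : Cotangent E Q × ℝ → ℝ) (x : Cotangent E Q × ℝ)
    (X Y : TangentSpace ((cotModel E).prod 𝓘(ℝ, ℝ)) x) : ℝ :=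
  extDerivOneForm ((cotModel E).prod 𝓘(ℝ, ℝ)) (thetaH H) (phaseDomain E Q) x X Y

variable (E Q) in
/-- The fields of the theory: the smooth curves `χ : [0, 1] → T*Q`. -/
def fields : Set (ℝ → Cotangent E Q) :=
  {χ | ContMDiffOn 𝓘(ℝ, ℝ) (cotModel E) ∞ χ (Icc 0 1)}

/-- `U` is a smooth vector field along the curve `χ : [0, 1] → T*Q`, that is, a tangent vector
`(δu, δp)` at `χ` to the space of fields. Its values at the end points are free. -/
def IsVariation (χ : ℝ → Cotangent E Q) (U : ∀ t : ℝ, TangentSpace (cotModel E) (χ t)) : Prop :=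
  ContMDiffOn 𝓘(ℝ, ℝ) (cotModel E).tangent ∞
    (fun t => (⟨χ t, U t⟩ : TangentBundle (cotModel E) (Cotangent E Q))) (Icc 0 1)

/-- The Euler-Lagrange one-form `EL_χ (U) = ∫₀¹ χ* (i_U dΘ_H)`, where `χ` is regarded as the section
`t ↦ (χ t, t)` of `T*Q × [0, 1] → [0, 1]` and `U` as a vertical vector field along it. -/
def eulerLagrangeForm (H : Cotangent E Q × ℝ → ℝ) (χ : ℝ → Cotangent E Q)
    (U : ∀ t : ℝ, TangentSpace (cotModel E) (χ t)) : ℝ :=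
  ∫ t in (0 : ℝ)..1, dThetaH H (χ t, t)
    (mfderiv (cotModel E) ((cotModel E).prod 𝓘(ℝ, ℝ)) (fun z => (z, t)) (χ t) (U t))
    (mfderivWithin 𝓘(ℝ, ℝ) ((cotModel E).prod 𝓘(ℝ, ℝ)) (fun s => (χ s, s)) (Icc 0 1) t (1 : ℝ))

/-- The set `𝓔𝓛` of solutions of the Euler-Lagrange equations: the zeros of the Euler-Lagrange
one-form on the space of fields. -/
def eulerLagrangeSolutions (H : Cotangent E Q × ℝ → ℝ) : Set (ℝ → Cotangent E Q) :=
  {χ | χ ∈ fields E Q ∧ ∀ U : ∀ t : ℝ, TangentSpace (cotModel E) (χ t), IsVariation χ U →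
    eulerLagrangeForm H χ U = 0}

/-- The restriction `Π` to the boundary `{0, 1}` of `[0, 1]`, written as `(χ 0, χ 1)`. -/
def boundaryMap (χ : ℝ → Cotangent E Q) : Cotangent E Q × Cotangent E Q := (χ 0, χ 1)

/-- The curve `χ` satisfies Hamilton's equations `du/dt = ∂H/∂p`, `dp/dt = - ∂H/∂u` on `[0, 1]`.
At each time `t` they are written in the canonical coordinates `κ = (u, p)` of `T*Q` at `χ t`. As
`p` is a covector, the first equation is tested against all covectors `β`, and the second one on
all vectors `w`. At the end points derivatives are one-sided. -/
def SatisfiesHamilton (H : Cotangent E Q × ℝ → ℝ) (χ : ℝ → Cotangent E Q) : Prop :=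
  ∀ t ∈ Icc (0 : ℝ) 1, ContinuousWithinAt χ (Icc 0 1) t ∧
    let κ : PartialEquiv (Cotangent E Q) (E × (E →L[ℝ] ℝ)) := extChartAt (cotModel E) (χ t)
    let u : ℝ → E := fun s => (κ (χ s)).1
    let p : ℝ → (E →L[ℝ] ℝ) := fun s => (κ (χ s)).2
    ∃ (u' : E) (p' : E →L[ℝ] ℝ),
      HasDerivWithinAt u u' (Icc 0 1) t ∧ HasDerivWithinAt p p' (Icc 0 1) t ∧
      (∀ β : E →L[ℝ] ℝ, β u' = fderiv ℝ (fun b => H (κ.symm (u t, b), t)) (p t) β) ∧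
      (∀ w : E, p' w = -fderiv ℝ (fun a => H (κ.symm (a, p t), t)) (u t) w)

/-- `φ` is the flow, for the times `t ∈ [0, 1]`, of Hamilton's equations: for every `z` in `T*Q`,
the curve `t ↦ φ t z` is a solution on `[0, 1]` with initial value `z`. -/
structure IsHamiltonianFlow (H : Cotangent E Q × ℝ → ℝ)
    (φ : ℝ → Cotangent E Q → Cotangent E Q) : Prop where
  initial : ∀ z, φ 0 z = z
  hamilton : ∀ z, SatisfiesHamilton H (fun t => φ t z)

end Cotangent

end HamiltonianField

end

/-! In canonical coordinates `θ = p du` has coefficients that are linear in the point. Coordinate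
changes between preferred charts preserve it, so `ω` has the same constant coefficients `dp ∧ du` in
every preferred chart (`isDarboux_symplecticForm`). Most of the argument uses only this, and is
carried out on a manifold all of whose preferred charts are Darboux charts.

On a vertical vector `(U, 0)` and the velocity `(χ', 1)` the form `dΘ_H` takes the value `ω(U, χ') -
dH(U)` (`extDerivOneForm_extendedForm`). The Euler-Lagrange form is the integral of this density,
and no integration by parts is involved. Testing with a bump function times a constant vector in a
chart shows that it vanishes exactly when `ω(Y, χ') = dH(Y)` for all `Y`, which are Hamilton's
equations (`isHamiltonCurve_of_eulerLagrange`, `satisfiesHamilton_iff`). Uniqueness of solutions,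
which needs `T*Q` to be Hausdorff, identifies these curves with the flow lines
(`IsHamiltonCurve.eqOn`), so their boundary values form the graph of `φ 1`.

The flow is given pointwise, so its regularity in the initial point has to be proved. Along one flow
line `[0, 1]` is cut into finitely many pieces, each spent in a single chart by all nearby flow
lines. There the derivative of the flow solves the variational equation, which gives smoothness
(`contDiffOn_of_hasDerivWithinAt`), and the linearized field is infinitesimally symplectic because
second derivatives of `H` are symmetric, so the form is preserved
(`symplectic_of_hasDerivWithinAt`). `isSymplecticNear_flow` assembles the pieces.

A map preserving a nondegenerate form is an immersion; `φ 1` is injective by uniqueness backwards in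
time; the inverse function theorem makes it a diffeomorphism onto an open set
(`isOpen_range_and_exists_inverse`). A shear in product charts straightens its graph, whose tangent
spaces are the graphs of the symplectic isomorphisms `dφ 1`, and these are Lagrangian
(`isLagrangianSubmanifold_graph`). -/

noncomputable section

namespace HamiltonianField

open Filter
open scoped NNReal

/-! ### Linear equations and smooth dependence on parameters -/

section LinearODE

variable {F : Type*} [NormedAddCommGroup F] [NormedSpace ℝ F]

/-- The radial retraction of a normed space onto the closed ball of radius `R`. -/
def radialRetraction (R : ℝ) (x : F) : F := (R / max R ‖x‖) • x

lemma radialRetraction_of_norm_le {R : ℝ} (hR : 0 < R) {x : F} (hx : ‖x‖ ≤ R) :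
    radialRetraction R x = x := by
  rw [radialRetraction, max_eq_left hx, div_self hR.ne', one_smul]

lemma norm_radialRetraction {R : ℝ} (hR : 0 < R) (x : F) :
    ‖radialRetraction R x‖ = R / max R ‖x‖ * ‖x‖ := by
  rw [radialRetraction, norm_smul, Real.norm_of_nonneg]
  exact div_nonneg hR.le (hR.le.trans (le_max_left _ _))

lemma norm_radialRetraction_le_norm {R : ℝ} (hR : 0 < R) (x : F) :
    ‖radialRetraction R x‖ ≤ ‖x‖ := by
  rw [norm_radialRetraction hR]
  exact mul_le_of_le_one_left (norm_nonneg x)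
    (div_le_one_of_le₀ (le_max_left _ _) (hR.le.trans (le_max_left _ _)))

lemma norm_radialRetraction_le {R : ℝ} (hR : 0 < R) (x : F) : ‖radialRetraction R x‖ ≤ R := by
  have hm : 0 < max R ‖x‖ := hR.trans_le (le_max_left _ _)
  rw [norm_radialRetraction hR, div_mul_eq_mul_div, div_le_iff₀ hm]
  exact mul_le_mul_of_nonneg_left (le_max_right _ _) hR.le

/-- Moving the point with the scaling factor fixed costs at most `‖x - y‖`, since the factor is at
most 1; changing the factor costs at most `‖x - y‖` again. This works in any norm. -/
lemma lipschitzWith_radialRetraction {R : ℝ} (hR : 0 < R) :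
    LipschitzWith 2 (radialRetraction R : F → F) := by
  refine LipschitzWith.of_dist_le_mul fun x y => ?_
  rw [dist_eq_norm, dist_eq_norm]
  have hx : 0 < max R ‖x‖ := hR.trans_le (le_max_left _ _)
  have hy : 0 < max R ‖y‖ := hR.trans_le (le_max_left _ _)
  have e : radialRetraction R x - radialRetraction R y =
      (R / max R ‖x‖) • (x - y) + (R / max R ‖x‖ - R / max R ‖y‖) • y := by
    simp only [radialRetraction]; module
  have h1 : R / max R ‖x‖ ≤ 1 := div_le_one_of_le₀ (le_max_left _ _) hx.le
  have h1' : 0 ≤ R / max R ‖x‖ := by positivity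
  have h2 : |max R ‖y‖ - max R ‖x‖| ≤ ‖x - y‖ := by
    refine (abs_max_sub_max_le_max R ‖y‖ R ‖x‖).trans ?_
    rw [sub_self, abs_zero, max_eq_right (abs_nonneg _), norm_sub_rev]
    exact abs_norm_sub_norm_le y x
  have h3 : |R / max R ‖x‖ - R / max R ‖y‖| * ‖y‖ ≤ ‖x - y‖ := by
    have : R / max R ‖x‖ - R / max R ‖y‖ =
        R / max R ‖x‖ * ((max R ‖y‖ - max R ‖x‖) / max R ‖y‖) := by
      field_simp
    rw [this, abs_mul, abs_of_nonneg h1', abs_div, abs_of_pos hy]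
    calc R / max R ‖x‖ * (|max R ‖y‖ - max R ‖x‖| / max R ‖y‖) * ‖y‖
        = R / max R ‖x‖ * (|max R ‖y‖ - max R ‖x‖| * (‖y‖ / max R ‖y‖)) := by ring
      _ ≤ 1 * (‖x - y‖ * 1) := by
        gcongr
        exact div_le_one_of_le₀ (le_max_right _ _) hy.le
      _ = ‖x - y‖ := by ring
  rw [e]
  refine (norm_add_le _ _).trans ?_
  rw [norm_smul, norm_smul, Real.norm_of_nonneg h1', Real.norm_eq_abs]
  have := mul_le_of_le_one_left (norm_nonneg (x - y)) h1
  push_cast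
  linarith

/-- A linear differential equation with continuous coefficients on a compact interval has a
solution with prescribed initial value. -/
theorem exists_hasDerivWithinAt_linear [CompleteSpace F] {a b : ℝ} (hab : a ≤ b)
    {B : ℝ → F →L[ℝ] F} (hB : ContinuousOn B (Icc a b)) (y₀ : F) :
    ∃ y : ℝ → F, y a = y₀ ∧
      ∀ t ∈ Icc a b, HasDerivWithinAt y (B t (y t)) (Icc a b) t := by
  obtain ⟨K, hK⟩ := isCompact_Icc.exists_bound_of_continuousOn hB
  have hK0 : 0 ≤ K := (norm_nonneg _).trans (hK a (left_mem_Icc.2 hab))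
  -- The Gronwall bound for the solution sought, plus 1 to make it positive.
  set R : ℝ := ‖y₀‖ * Real.exp (K * (b - a)) + 1 with hRdef
  have hR : 0 < R := by positivity
  -- The truncated field is globally bounded and Lipschitz, so Picard-Lindelöf applies on all of
  -- `[a, b]` at once. The truncation does not increase norms, so the Gronwall bound for the linear
  -- equation holds for the truncated solution, which therefore never reaches the region where the
  -- truncation acts.
  set f : ℝ → F → F := fun t x => B t (radialRetraction R x) with hf
  have hfn : ∀ t ∈ Icc a b, ∀ x, ‖f t x‖ ≤ K * R := fun t ht x =>
    (ContinuousLinearMap.le_opNorm _ _).trans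
      (mul_le_mul (hK t ht) (norm_radialRetraction_le hR x) (norm_nonneg _) hK0)
  have hPL : IsPicardLindelof f (⟨a, left_mem_Icc.2 hab⟩ : Icc a b) y₀
      ⟨K * R * (b - a), by have := sub_nonneg.2 hab; positivity⟩ 0 ⟨K * R, by positivity⟩
      (⟨K, hK0⟩ * 2) := by
    refine ⟨fun t ht => ?_, fun x _ => ?_, fun t ht x _ => hfn t ht x, ?_⟩
    · refine (LipschitzWith.comp (LipschitzWith.of_dist_le_mul fun u v => ?_)
        (lipschitzWith_radialRetraction hR)).lipschitzOnWith
      rw [dist_eq_norm, dist_eq_norm, ← map_sub]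
      exact (ContinuousLinearMap.le_opNorm _ _).trans
        (mul_le_mul_of_nonneg_right (hK t ht) (norm_nonneg _))
    · exact hB.clm_apply continuousOn_const
    · simp only [sub_self, NNReal.coe_zero, sub_zero, max_eq_left (sub_nonneg.2 hab)]
      exact le_rfl
  obtain ⟨y, hy0, hy⟩ := hPL.exists_eq_forall_mem_Icc_hasDerivWithinAt₀
  refine ⟨y, hy0, fun t ht => ?_⟩
  have hbound : ‖y t‖ ≤ R := by
    have h := norm_le_gronwallBound_of_norm_deriv_right_le (f := y) (f' := fun t => f t (y t))
      (δ := ‖y₀‖) (K := K) (ε := 0) (a := a) (b := b)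
      (fun s hs => (hy s hs).continuousWithinAt)
      (fun s hs => (hy s (Ico_subset_Icc_self hs)).mono_of_mem_nhdsWithin
        (Icc_mem_nhdsGE_of_mem hs)) (congrArg norm hy0).le ?_ t ht
    · rw [gronwallBound_ε0] at h
      refine h.trans ((mul_le_mul_of_nonneg_left (Real.exp_le_exp.2 ?_) (norm_nonneg _)).trans
        (le_add_of_nonneg_right zero_le_one))
      exact mul_le_mul_of_nonneg_left (by linarith [ht.2]) hK0
    · intro s hs
      rw [add_zero]
      exact (ContinuousLinearMap.le_opNorm _ _).trans
        (mul_le_mul (hK s (Ico_subset_Icc_self hs)) (norm_radialRetraction_le_norm hR _)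
          (norm_nonneg _) hK0)
  have := hy t ht
  simpa only [hf, radialRetraction_of_norm_le hR hbound] using this

end LinearODE

/-! ### Space derivatives of functions on `I × U`, end times included -/

section PartialDerivative

variable {V : Type*} [NormedAddCommGroup V] [NormedSpace ℝ V]
  {G : Type*} [NormedAddCommGroup G] [NormedSpace ℝ G]

/-- The partial derivative in the second variable of a function on `I × U`. -/
def spaceDeriv (f : ℝ × V → G) (I : Set ℝ) (U : Set V) (p : ℝ × V) : V →L[ℝ] G :=
  (fderivWithin ℝ f (I ×ˢ U) p).comp (ContinuousLinearMap.inr ℝ ℝ V)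

variable {f : ℝ × V → G} {I : Set ℝ} {U : Set V}

lemma hasFDerivAt_spaceDeriv (hU : IsOpen U) (hf : ContDiffOn ℝ ∞ f (I ×ˢ U)) {t : ℝ} {x : V}
    (ht : t ∈ I) (hx : x ∈ U) :
    HasFDerivAt (fun y => f (t, y)) (spaceDeriv f I U (t, x)) x := by
  have h1 : HasFDerivWithinAt f (fderivWithin ℝ f (I ×ˢ U) (t, x)) (I ×ˢ U) (t, x) :=
    ((hf.differentiableOn (by simp)) _ ⟨ht, hx⟩).hasFDerivWithinAt
  have h2 : HasFDerivWithinAt (fun y : V => (t, y)) (ContinuousLinearMap.inr ℝ ℝ V) U x :=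
    (hasFDerivAt_prodMk_right t x).hasFDerivWithinAt
  exact (h1.comp x h2 fun y hy => ⟨ht, hy⟩).hasFDerivAt (hU.mem_nhds hx)

lemma contDiffOn_spaceDeriv (hI : UniqueDiffOn ℝ I) (hU : IsOpen U)
    (hf : ContDiffOn ℝ ∞ f (I ×ˢ U)) : ContDiffOn ℝ ∞ (spaceDeriv f I U) (I ×ˢ U) :=
  (hf.fderivWithin (hI.prod hU.uniqueDiffOn) (by simp)).clm_comp contDiffOn_const

end PartialDerivative

/-! ### Differentiable and smooth dependence on parameters -/

section Dependence

universe u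

variable {V Z : Type u} [NormedAddCommGroup V] [NormedSpace ℝ V] [FiniteDimensional ℝ V]
  [NormedAddCommGroup Z] [NormedSpace ℝ Z]

/-- The bound is homogeneous in the initial error and the inhomogeneity taken together, so a small
common factor carries over to the final error. -/
lemma gronwallBound_mul (η K ε x : ℝ) :
    gronwallBound η K (η * ε) x = η * gronwallBound 1 K ε x := by
  unfold gronwallBound
  split_ifs <;> ring

/-- Solutions of a differential equation that depend differentiably on a parameter at the initial
time do so at all later times, and the derivative solves the variational equation. -/
theorem hasFDerivAt_of_variational {a b : ℝ} (hab : a < b) {U : Set V} (hU : IsOpen U)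
    {f : ℝ × V → V} (hf : ContDiffOn ℝ ∞ f (Icc a b ×ˢ U)) {c : ℝ → Z → V} {W : Set Z} {z₀ : Z}
    (hW : W ∈ 𝓝 z₀) (hcU : ∀ z ∈ W, ∀ t ∈ Icc a b, c t z ∈ U)
    (hc : ∀ z ∈ W, ∀ t ∈ Icc a b,
      HasDerivWithinAt (fun τ => c τ z) (f (t, c t z)) (Icc a b) t)
    {A : ℝ → Z →L[ℝ] V} (hA0 : HasFDerivAt (c a) (A a) z₀)
    (hA : ∀ t ∈ Icc a b,
      HasDerivWithinAt A ((spaceDeriv f (Icc a b) U (t, c t z₀)).comp (A t)) (Icc a b) t)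
    {t : ℝ} (ht : t ∈ Icc a b) : HasFDerivAt (c t) (A t) z₀ := by
  have hz₀ : z₀ ∈ W := mem_of_mem_nhds hW
  have hD := (contDiffOn_spaceDeriv (uniqueDiffOn_Icc hab) hU hf).continuousOn
  have hγ : ContinuousOn (fun τ => c τ z₀) (Icc a b) :=
    fun s hs => (hc z₀ hz₀ s hs).continuousWithinAt
  have hcomp : IsCompact ((fun τ => c τ z₀) '' Icc a b) := isCompact_Icc.image_of_continuousOn hγ
  -- A compact tube around the reference solution inside `U`: on it the space derivative is bounded
  -- by `K` and uniformly continuous.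
  obtain ⟨δ, hδ, hδU⟩ := hcomp.exists_cthickening_subset_open hU
    (by rintro _ ⟨s, hs, rfl⟩; exact hcU z₀ hz₀ s hs)
  set T := Metric.cthickening δ ((fun τ => c τ z₀) '' Icc a b) with hT
  have hTc : IsCompact (Icc a b ×ˢ T) := isCompact_Icc.prod hcomp.cthickening
  have hDT : ContinuousOn (spaceDeriv f (Icc a b) U) (Icc a b ×ˢ T) :=
    hD.mono (prod_mono le_rfl hδU)
  obtain ⟨K, hK⟩ := hTc.exists_bound_of_continuousOn hDT
  have hball : ∀ s ∈ Icc a b, Metric.closedBall (c s z₀) δ ⊆ T := fun s hs =>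
    Metric.closedBall_subset_cthickening (mem_image_of_mem (fun τ => c τ z₀) hs) δ
  have hself : ∀ s ∈ Icc a b, c s z₀ ∈ T := fun s hs =>
    hball s hs (Metric.mem_closedBall_self hδ.le)
  have hK0 : 0 ≤ K := (norm_nonneg _).trans
    (hK (a, c a z₀) ⟨left_mem_Icc.2 hab.le, hself a (left_mem_Icc.2 hab.le)⟩)
  have hder : ∀ s ∈ Icc a b, ∀ r ≤ δ, ∀ x ∈ Metric.closedBall (c s z₀) r,
      HasFDerivWithinAt (fun y => f (s, y)) (spaceDeriv f (Icc a b) U (s, x))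
        (Metric.closedBall (c s z₀) r) x := fun s hs r hr x hx =>
    (hasFDerivAt_spaceDeriv hU hf hs
      (hδU (hball s hs (Metric.closedBall_subset_closedBall hr hx)))).hasFDerivWithinAt
  have hright : ∀ {g : ℝ → V} {g' : V} {s : ℝ}, s ∈ Ico a b →
      HasDerivWithinAt g g' (Icc a b) s → HasDerivWithinAt g g' (Ici s) s := fun hs h =>
    h.mono_of_mem_nhdsWithin (Icc_mem_nhdsGE_of_mem hs)
  -- the distance to the reference solution
  set C : ℝ := (‖A a‖ + 2) * Real.exp ((K + 1) * (b - a)) with hC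
  have hC0 : 0 < C := by positivity
  have close : ∀ z ∈ W, 0 < ‖z - z₀‖ → ‖c a z - c a z₀‖ ≤ (‖A a‖ + 1) * ‖z - z₀‖ →
      C * ‖z - z₀‖ ≤ δ → ∀ s ∈ Icc a b, ‖c s z - c s z₀‖ ≤ C * ‖z - z₀‖ := by
    intro z hz hpos h0 hzδ
    have hBC : ∀ s ∈ Icc a b, (‖A a‖ + 2) * ‖z - z₀‖ * Real.exp ((K + 1) * (s - a)) ≤
        C * ‖z - z₀‖ := fun s hs => by
      have : Real.exp ((K + 1) * (s - a)) ≤ Real.exp ((K + 1) * (b - a)) :=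
        Real.exp_le_exp.2 (mul_le_mul_of_nonneg_left (by linarith [hs.2]) (by linarith))
      calc _ ≤ (‖A a‖ + 2) * ‖z - z₀‖ * Real.exp ((K + 1) * (b - a)) := by gcongr
        _ = _ := by rw [hC]; ring
    -- The Lipschitz estimate is known only inside the tube, so Gronwall's inequality is not
    -- directly available. The comparison with a barrier needs the estimate only at times when the
    -- distance equals the barrier, and there the distance is at most `δ`. The exponent `K + 1`
    -- instead of `K` gives the strict inequality required.
    have := image_norm_le_of_norm_deriv_right_lt_deriv_boundary
      (f := fun s => c s z - c s z₀) (f' := fun s => f (s, c s z) - f (s, c s z₀))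
      (a := a) (b := b)
      (B := fun s => (‖A a‖ + 2) * ‖z - z₀‖ * Real.exp ((K + 1) * (s - a)))
      (B' := fun s => (‖A a‖ + 2) * ‖z - z₀‖ * (Real.exp ((K + 1) * (s - a)) * (K + 1)))
      (fun s hs => ((hc z hz s hs).sub (hc z₀ hz₀ s hs)).continuousWithinAt)
      (fun s hs => hright hs ((hc z hz s (Ico_subset_Icc_self hs)).sub
        (hc z₀ hz₀ s (Ico_subset_Icc_self hs)))) ?_ ?_ ?_
    · exact fun s hs => (this hs).trans (hBC s hs)
    · simp only [sub_self, mul_zero, Real.exp_zero, mul_one]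
      nlinarith
    · intro s
      have := (((hasDerivAt_id s).sub_const a).const_mul (K + 1)).exp.const_mul
        ((‖A a‖ + 2) * ‖z - z₀‖)
      simpa using this
    · intro s hs heq
      have hs' := Ico_subset_Icc_self hs
      have hle : ‖c s z - c s z₀‖ ≤ δ := (heq.le.trans (hBC s hs')).trans hzδ
      have h1 : ‖f (s, c s z) - f (s, c s z₀)‖ ≤ K * ‖c s z - c s z₀‖ :=
        (convex_closedBall _ _).norm_image_sub_le_of_norm_hasFDerivWithin_le (hder s hs' δ le_rfl)
          (fun x hx => hK _ ⟨hs', hball s hs' hx⟩) (Metric.mem_closedBall_self hδ.le)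
          (by rwa [Metric.mem_closedBall, dist_eq_norm])
      refine h1.trans_lt ?_
      rw [heq]
      have : 0 < (‖A a‖ + 2) * ‖z - z₀‖ * Real.exp ((K + 1) * (s - a)) := by positivity
      nlinarith
  rw [hasFDerivAt_iff_isLittleO, Asymptotics.isLittleO_iff]
  intro ε hε
  set g : ℝ := gronwallBound 1 K C (t - a)
  -- Tolerance chosen so that the final Gronwall factor `g` leaves an error of at most `ε`.
  set η : ℝ := ε / (|g| + 1) with hη
  have hη0 : 0 < η := by positivity
  have hηg : η * g ≤ ε := by
    rw [hη, div_mul_eq_mul_div, div_le_iff₀ (by positivity)]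
    exact mul_le_mul_of_nonneg_left ((le_abs_self g).trans (le_add_of_nonneg_right zero_le_one))
      hε.le
  obtain ⟨δ', hδ', hunif⟩ := Metric.uniformContinuousOn_iff_le.1
    (hTc.uniformContinuousOn_of_continuous hDT) η hη0
  have hrem : ∀ s ∈ Icc a b, ∀ x, ‖x - c s z₀‖ ≤ min δ δ' →
      ‖f (s, x) - f (s, c s z₀) - spaceDeriv f (Icc a b) U (s, c s z₀) (x - c s z₀)‖ ≤
        η * ‖x - c s z₀‖ := by
    intro s hs x hx
    refine (convex_closedBall _ _).norm_image_sub_le_of_norm_hasFDerivWithin_le'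
      (hder s hs (min δ δ') (min_le_left _ _)) (fun y hy => ?_)
      (Metric.mem_closedBall_self (by positivity)) (by rwa [Metric.mem_closedBall, dist_eq_norm])
    rw [← dist_eq_norm]
    refine hunif _ ⟨hs, hball s hs
      (Metric.closedBall_subset_closedBall (min_le_left _ _) hy)⟩ _ ⟨hs, hself s hs⟩ ?_
    rw [Prod.dist_eq, dist_self, max_eq_right dist_nonneg]
    exact (Metric.mem_closedBall.1 hy).trans (min_le_right _ _)
  have hev := (hasFDerivAt_iff_isLittleO.1 hA0)
  rw [Asymptotics.isLittleO_iff] at hev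
  have hsmall : ∀ᶠ z in 𝓝 z₀, C * ‖z - z₀‖ < min δ δ' := by
    have : Tendsto (fun z => C * ‖z - z₀‖) (𝓝 z₀) (𝓝 (C * ‖z₀ - z₀‖)) :=
      (Continuous.tendsto (by fun_prop) z₀)
    rw [sub_self, norm_zero, mul_zero] at this
    exact this.eventually_lt_const (by positivity)
  filter_upwards [hW, hev hη0, hev one_pos, hsmall] with z hz h1 h2 h3
  rcases (norm_nonneg (z - z₀)).eq_or_lt with h0 | hpos
  · have : z = z₀ := by rw [← sub_eq_zero, ← norm_eq_zero, ← h0]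
    simp [this]
  have hca : ‖c a z - c a z₀‖ ≤ (‖A a‖ + 1) * ‖z - z₀‖ := by
    have e : c a z - c a z₀ = (c a z - c a z₀ - A a (z - z₀)) + A a (z - z₀) := by abel
    rw [e]
    refine (norm_add_le _ _).trans ?_
    have := (A a).le_opNorm (z - z₀)
    linarith
  have hcl := close z hz hpos hca (h3.le.trans (min_le_left _ _))
  -- Gronwall for the defect `c s z - c s z₀ - A s (z - z₀)`: its derivative is `D` applied to the
  -- defect plus the Taylor remainder of `f`, which is at most `η C ‖z - z₀‖`.
  have hgr := norm_le_gronwallBound_of_norm_deriv_right_le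
    (f := fun s => c s z - c s z₀ - A s (z - z₀))
    (f' := fun s => f (s, c s z) - f (s, c s z₀) -
      spaceDeriv f (Icc a b) U (s, c s z₀) (A s (z - z₀)))
    (δ := η * ‖z - z₀‖) (K := K) (ε := η * ‖z - z₀‖ * C) (a := a) (b := b) ?_ ?_ h1 ?_ t ht
  · rw [gronwallBound_mul] at hgr
    refine hgr.trans ?_
    calc η * ‖z - z₀‖ * g = η * g * ‖z - z₀‖ := by ring
      _ ≤ ε * ‖z - z₀‖ := by gcongr
  · intro s hs
    exact (((hc z hz s hs).sub (hc z₀ hz₀ s hs)).continuousWithinAt).sub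
      ((hA s hs).continuousWithinAt.clm_apply continuousWithinAt_const)
  · intro s hs
    have hs' := Ico_subset_Icc_self hs
    refine hright hs (((hc z hz s hs').sub (hc z₀ hz₀ s hs')).sub ?_)
    have := (hA s hs').clm_apply (hasDerivWithinAt_const s (Icc a b) (z - z₀))
    simpa using this
  · intro s hs
    have hs' := Ico_subset_Icc_self hs
    set D := spaceDeriv f (Icc a b) U (s, c s z₀)
    have e : f (s, c s z) - f (s, c s z₀) - D (A s (z - z₀)) =
        D (c s z - c s z₀ - A s (z - z₀)) +
          (f (s, c s z) - f (s, c s z₀) - D (c s z - c s z₀)) := by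
      rw [map_sub D (c s z - c s z₀)]; abel
    rw [e]
    refine (norm_add_le _ _).trans (add_le_add ?_ ?_)
    · exact (D.le_opNorm _).trans
        (mul_le_mul_of_nonneg_right (hK _ ⟨hs', hself s hs'⟩) (norm_nonneg _))
    · refine (hrem s hs' _ ((hcl s hs').trans h3.le)).trans ?_
      rw [mul_assoc η, mul_comm ‖z - z₀‖]
      exact mul_le_mul_of_nonneg_left (hcl s hs') hη0.le

/-- Under smooth dependence on a parameter at the initial time, solutions of a smooth differential
equation are differentiable in the parameter, and the derivative solves the variational equation. -/
theorem hasDerivWithinAt_fderiv [FiniteDimensional ℝ Z] {a b : ℝ} (hab : a < b) {U : Set V}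
    (hU : IsOpen U) {f : ℝ × V → V} (hf : ContDiffOn ℝ ∞ f (Icc a b ×ˢ U)) {c : ℝ → Z → V}
    {W : Set Z} (hW : IsOpen W) (hcU : ∀ z ∈ W, ∀ t ∈ Icc a b, c t z ∈ U)
    (hc : ∀ z ∈ W, ∀ t ∈ Icc a b,
      HasDerivWithinAt (fun τ => c τ z) (f (t, c t z)) (Icc a b) t)
    (hca : DifferentiableOn ℝ (c a) W) {z : Z} (hz : z ∈ W) {t : ℝ} (ht : t ∈ Icc a b) :
    DifferentiableAt ℝ (c t) z ∧
      HasDerivWithinAt (fun τ => fderiv ℝ (c τ) z)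
        ((spaceDeriv f (Icc a b) U (t, c t z)).comp (fderiv ℝ (c t) z)) (Icc a b) t := by
  have hD := (contDiffOn_spaceDeriv (uniqueDiffOn_Icc hab) hU hf).continuousOn
  have hγ : ContinuousOn (fun τ => c τ z) (Icc a b) :=
    fun s hs => (hc z hz s hs).continuousWithinAt
  have hB : ContinuousOn (fun τ => ContinuousLinearMap.compL ℝ Z V V
      (spaceDeriv f (Icc a b) U (τ, c τ z))) (Icc a b) :=
    (ContinuousLinearMap.continuous _).comp_continuousOn
      (hD.comp (continuousOn_id.prodMk hγ) fun s hs => ⟨hs, hcU z hz s hs⟩)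
  -- The variational equation is linear in the operator `A`, so it is solvable on the whole
  -- interval; the solution is then recognized as the derivative of the flow.
  obtain ⟨A, hA0, hA⟩ := exists_hasDerivWithinAt_linear hab.le hB (fderiv ℝ (c a) z)
  have key : ∀ s ∈ Icc a b, HasFDerivAt (c s) (A s) z := fun s hs =>
    hasFDerivAt_of_variational hab hU hf (hW.mem_nhds hz) hcU hc
      (hA0 ▸ (hca.differentiableAt (hW.mem_nhds hz)).hasFDerivAt) hA hs
  refine ⟨(key t ht).differentiableAt, ?_⟩
  have := hA t ht
  rw [← (key t ht).fderiv] at this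
  exact this.congr (fun s hs => (key s hs).fderiv) (key t ht).fderiv

/-- Smooth dependence of the solutions of a smooth differential equation on parameters. -/
theorem contDiffOn_of_hasDerivWithinAt [FiniteDimensional ℝ Z] {a b : ℝ} (hab : a < b) {U : Set V}
    (hU : IsOpen U) {f : ℝ × V → V} (hf : ContDiffOn ℝ ∞ f (Icc a b ×ˢ U)) {c : ℝ → Z → V}
    {W : Set Z} (hW : IsOpen W) (hcU : ∀ z ∈ W, ∀ t ∈ Icc a b, c t z ∈ U)
    (hc : ∀ z ∈ W, ∀ t ∈ Icc a b,
      HasDerivWithinAt (fun τ => c τ z) (f (t, c t z)) (Icc a b) t)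
    (hca : ContDiffOn ℝ ∞ (c a) W) {t : ℝ} (ht : t ∈ Icc a b) : ContDiffOn ℝ ∞ (c t) W := by
  rw [contDiffOn_infty]
  intro k
  -- The pair formed by `c` and its derivative solves an equation of the same kind on `V × (Z →L[ℝ]
  -- V)`, so regularity of order `k` of the pair is regularity of order `k + 1` of `c`. This
  -- enlarged space lies in the universe shared by `V` and `Z`.
  induction k generalizing V with
  | zero =>
    rw [Nat.cast_zero, contDiffOn_zero]
    exact fun z hz => (hasDerivWithinAt_fderiv hab hU hf hW hcU hc
      (hca.differentiableOn (by simp)) hz ht).1.continuousAt.continuousWithinAt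
  | succ k ih =>
    have hdiff : ∀ z ∈ W, ∀ s ∈ Icc a b, _ := fun z hz s hs =>
      hasDerivWithinAt_fderiv hab hU hf hW hcU hc (hca.differentiableOn (by simp)) hz hs
    have hF : ContDiffOn ℝ ∞
        (fun q : ℝ × (V × (Z →L[ℝ] V)) => ((f (q.1, q.2.1),
          (spaceDeriv f (Icc a b) U (q.1, q.2.1)).comp q.2.2) : V × (Z →L[ℝ] V)))
        (Icc a b ×ˢ (U ×ˢ univ)) := by
      have hmaps : MapsTo (fun q : ℝ × (V × (Z →L[ℝ] V)) => (q.1, q.2.1))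
          (Icc a b ×ˢ (U ×ˢ univ)) (Icc a b ×ˢ U) := fun q hq => ⟨hq.1, hq.2.1⟩
      have hpr : ContDiff ℝ ∞ (fun q : ℝ × (V × (Z →L[ℝ] V)) => (q.1, q.2.1)) := by fun_prop
      refine (hf.comp hpr.contDiffOn hmaps).prodMk (ContDiffOn.clm_comp
        ((contDiffOn_spaceDeriv (uniqueDiffOn_Icc hab) hU hf).comp hpr.contDiffOn hmaps) ?_)
      fun_prop
    have hpair := ih (hU.prod isOpen_univ) hF
      (c := fun s z => (c s z, fderiv ℝ (c s) z))
      (fun z hz s hs => ⟨hcU z hz s hs, mem_univ _⟩)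
      (fun z hz s hs => (hc z hz s hs).prodMk (hdiff z hz s hs).2)
      (hca.prodMk (hca.fderiv_of_isOpen hW (by simp)))
    rw [Nat.cast_succ, contDiffOn_succ_iff_fderiv_of_isOpen hW]
    exact ⟨fun z hz => (hdiff z hz t ht).1.differentiableWithinAt, by simp,
      contDiff_snd.comp_contDiffOn hpair⟩

end Dependence

/-! ### Canonical coordinates of the cotangent bundle -/

/-- The total space of a fibre bundle with Hausdorff base and fibre is Hausdorff. -/
lemma t2Space_totalSpace {B F : Type*} [TopologicalSpace B] [TopologicalSpace F] {X : B → Type*}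
    [TopologicalSpace (TotalSpace F X)] [∀ b, TopologicalSpace (X b)] [FiberBundle F X]
    [T2Space B] [T2Space F] : T2Space (TotalSpace F X) := by
  refine ⟨fun x y hxy => ?_⟩
  by_cases h : x.proj = y.proj
  · let e := trivializationAt F X x.proj
    have hx : x ∈ e.source := e.mem_source.2 (FiberBundle.mem_baseSet_trivializationAt' x.proj)
    have hy : y ∈ e.source := e.mem_source.2 (h ▸ FiberBundle.mem_baseSet_trivializationAt' x.proj)
    obtain ⟨u, v, hu, hv, hxu, hyv, huv⟩ := t2_separation (e.injOn.ne hx hy hxy)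
    exact ⟨_, _, e.toOpenPartialHomeomorph.isOpen_inter_preimage hu,
      e.toOpenPartialHomeomorph.isOpen_inter_preimage hv, ⟨hx, hxu⟩, ⟨hy, hyv⟩,
      (huv.preimage e).mono inter_subset_right inter_subset_right⟩
  · exact separated_by_continuous (FiberBundle.continuous_proj F X) h

section Antisymmetrization

variable {V : Type*} [NormedAddCommGroup V] [NormedSpace ℝ V]

/-- The exterior derivative `θ X Y - θ Y X` of a one-form `y ↦ θ y` with linear coefficients. -/
def antisymmetrization (θ : V →L[ℝ] V →L[ℝ] ℝ) : V →L[ℝ] V →L[ℝ] ℝ := θ - θ.flip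

lemma antisymmetrization_apply (θ : V →L[ℝ] V →L[ℝ] ℝ) (X Y : V) :
    antisymmetrization θ X Y = θ X Y - θ Y X := rfl

/-- A smooth map that preserves a one-form with linear coefficients preserves its exterior
derivative. -/
lemma antisymmetrization_fderiv (θ : V →L[ℝ] V →L[ℝ] ℝ) {T : V → V} {y : V}
    (hT : ContDiffAt ℝ 2 T y)
    (h : ∀ᶠ x in 𝓝 y, (θ (T x)).comp (fderiv ℝ T x) = θ x) (X Y : V) :
    antisymmetrization θ (fderiv ℝ T y X) (fderiv ℝ T y Y) = antisymmetrization θ X Y := by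
  have h1 : HasFDerivAt T (fderiv ℝ T y) y :=
    (hT.differentiableAt (by norm_num)).hasFDerivAt
  have h2 : HasFDerivAt (fderiv ℝ T) (fderiv ℝ (fderiv ℝ T) y) y :=
    ((hT.fderiv_right (m := 1) (by norm_num)).differentiableAt (by norm_num)).hasFDerivAt
  -- Differentiating the invariance of `θ` produces `θ (T' X) (T' Y)` and a term in `T'' X Y`; the
  -- latter is symmetric and disappears on antisymmetrizing.
  have h3 := (θ.hasFDerivAt.comp y h1).clm_comp h2
  have h4 := h3.unique (θ.hasFDerivAt.congr_of_eventuallyEq h)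
  have hsymm : fderiv ℝ (fderiv ℝ T) y X Y = fderiv ℝ (fderiv ℝ T) y Y X :=
    (hT.isSymmSndFDerivAt (by simp)) X Y
  have e1 := DFunLike.congr_fun (DFunLike.congr_fun h4 X) Y
  have e2 := DFunLike.congr_fun (DFunLike.congr_fun h4 Y) X
  simp at e1 e2
  rw [hsymm] at e1
  simp only [antisymmetrization_apply]
  linarith

end Antisymmetrization

section Canonical

variable (E : Type*) [NormedAddCommGroup E] [NormedSpace ℝ E]

/-- The one-form `p du` of `E × E*`, as a linear function of the base point. -/
def canonicalOneForm : (E × (E →L[ℝ] ℝ)) →L[ℝ] (E × (E →L[ℝ] ℝ)) →L[ℝ] ℝ :=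
  ((ContinuousLinearMap.compL ℝ (E × (E →L[ℝ] ℝ)) E ℝ).flip
    (ContinuousLinearMap.fst ℝ E (E →L[ℝ] ℝ))).comp (ContinuousLinearMap.snd ℝ E (E →L[ℝ] ℝ))

/-- The two-form `dp ∧ du` of `E × E*`. -/
def canonicalForm : (E × (E →L[ℝ] ℝ)) →L[ℝ] (E × (E →L[ℝ] ℝ)) →L[ℝ] ℝ :=
  antisymmetrization (canonicalOneForm E)

variable {E}

lemma canonicalOneForm_apply (y X : E × (E →L[ℝ] ℝ)) : canonicalOneForm E y X = y.2 X.1 := rfl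

lemma canonicalForm_apply (X Y : E × (E →L[ℝ] ℝ)) :
    canonicalForm E X Y = X.2 Y.1 - Y.2 X.1 := rfl

lemma canonicalForm_swap (X Y : E × (E →L[ℝ] ℝ)) :
    canonicalForm E X Y = -canonicalForm E Y X := by
  simp only [canonicalForm_apply]; ring

/-- Covectors `(0, b)` detect the first component, since continuous functionals separate points;
vectors `(a, 0)` detect the second. -/
lemma eq_zero_of_canonicalForm {X : E × (E →L[ℝ] ℝ)} (h : ∀ Y, canonicalForm E Y X = 0) :
    X = 0 := by
  have h1 : X.1 = 0 := by
    by_contra hne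
    obtain ⟨b, hb⟩ := SeparatingDual.exists_ne_zero (R := ℝ) hne
    exact hb (by simpa [canonicalForm_apply] using h (0, b))
  have h2 : X.2 = 0 := by
    ext a
    simpa [canonicalForm_apply] using h (a, 0)
  exact Prod.ext h1 h2

end Canonical

/-! ### Preferred charts and their transition maps -/

section Charts

variable {V : Type*} [NormedAddCommGroup V] [NormedSpace ℝ V]
  {G : Type*} [TopologicalSpace G] {J : ModelWithCorners ℝ V G} [J.Boundaryless]
  {N : Type*} [TopologicalSpace N] [ChartedSpace G N] [IsManifold J ∞ N]

lemma contMDiffAt_symm_extChartAt {x : N} {y : V} (hy : y ∈ (extChartAt J x).target) :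
    ContMDiffAt 𝓘(ℝ, V) J ∞ (extChartAt J x).symm y :=
  (contMDiffOn_extChartAt_symm x).contMDiffAt ((isOpen_extChartAt_target x).mem_nhds hy)

omit [J.Boundaryless] in
lemma contMDiffAt_extChartAt_of_mem {x z : N} (hz : z ∈ (extChartAt J x).source) :
    ContMDiffAt J 𝓘(ℝ, V) ∞ (extChartAt J x) z :=
  contMDiffAt_extChartAt' (by rwa [extChartAt_source] at hz)

lemma mdifferentiableAt_symm_extChartAt {x : N} {y : V} (hy : y ∈ (extChartAt J x).target) :
    MDifferentiableAt 𝓘(ℝ, V) J (extChartAt J x).symm y :=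
  (contMDiffAt_symm_extChartAt hy).mdifferentiableAt (by simp)

omit [J.Boundaryless] in
lemma mdifferentiableAt_extChartAt_of_mem {x z : N} (hz : z ∈ (extChartAt J x).source) :
    MDifferentiableAt J 𝓘(ℝ, V) (extChartAt J x) z :=
  (contMDiffAt_extChartAt_of_mem hz).mdifferentiableAt (by simp)

lemma mfderiv_extChartAt_mfderiv_symm {x : N} {y : V} (hy : y ∈ (extChartAt J x).target)
    (X : V) :
    mfderiv J 𝓘(ℝ, V) (extChartAt J x) ((extChartAt J x).symm y)
      (mfderiv 𝓘(ℝ, V) J (extChartAt J x).symm y X) = X := by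
  have := DFunLike.congr_fun (mfderiv_extChartAt_comp_mfderivWithin_extChartAt_symm (I := J) hy) X
  rw [J.range_eq_univ, mfderivWithin_univ] at this
  exact this

lemma mfderiv_symm_mfderiv_extChartAt {x z : N} (hz : z ∈ (extChartAt J x).source)
    (X : TangentSpace J z) :
    mfderiv 𝓘(ℝ, V) J (extChartAt J x).symm (extChartAt J x z)
      (mfderiv J 𝓘(ℝ, V) (extChartAt J x) z X) = X := by
  have := DFunLike.congr_fun
    (mfderivWithin_extChartAt_symm_comp_mfderiv_extChartAt' (I := J) hz) X
  rw [J.range_eq_univ, mfderivWithin_univ] at this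
  exact this

lemma mfderiv_symm_extChartAt_self (x : N) :
    mfderiv 𝓘(ℝ, V) J (extChartAt J x).symm (extChartAt J x x) = ContinuousLinearMap.id ℝ V := by
  have := mfderivWithin_range_extChartAt_symm (I := J) (x := x)
  rw [J.range_eq_univ, mfderivWithin_univ] at this
  exact this

/-- The change of coordinates between two preferred charts. -/
def transition (J : ModelWithCorners ℝ V G) (x₀ x₁ : N) : V → V :=
  extChartAt J x₁ ∘ (extChartAt J x₀).symm

lemma contDiffAt_transition {x₀ x₁ : N} {y : V} (hy : y ∈ (extChartAt J x₀).target)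
    (hy' : (extChartAt J x₀).symm y ∈ (extChartAt J x₁).source) :
    ContDiffAt ℝ ∞ (transition J x₀ x₁) y :=
  contMDiffAt_iff_contDiffAt.1
    ((contMDiffAt_extChartAt_of_mem hy').comp y (contMDiffAt_symm_extChartAt hy))

lemma fderiv_transition {x₀ x₁ : N} {y : V} (hy : y ∈ (extChartAt J x₀).target)
    (hy' : (extChartAt J x₀).symm y ∈ (extChartAt J x₁).source) (X : V) :
    fderiv ℝ (transition J x₀ x₁) y X =
      mfderiv J 𝓘(ℝ, V) (extChartAt J x₁) ((extChartAt J x₀).symm y)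
        (mfderiv 𝓘(ℝ, V) J (extChartAt J x₀).symm y X) := by
  rw [← mfderiv_eq_fderiv, transition, mfderiv_comp (I' := J) y
    (mdifferentiableAt_extChartAt_of_mem hy') (mdifferentiableAt_symm_extChartAt hy)]
  rfl

lemma eventually_symm_mem_source {x₀ x₁ : N} {y : V} (hy : y ∈ (extChartAt J x₀).target)
    (hy' : (extChartAt J x₀).symm y ∈ (extChartAt J x₁).source) :
    ∀ᶠ x in 𝓝 y, x ∈ (extChartAt J x₀).target ∧
      (extChartAt J x₀).symm x ∈ (extChartAt J x₁).source :=
  ((isOpen_extChartAt_target x₀).eventually_mem hy).and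
    ((contMDiffAt_symm_extChartAt hy).continuousAt.eventually_mem
      ((isOpen_extChartAt_source x₁).mem_nhds hy'))

end Charts

/-! ### The Liouville form in canonical coordinates -/

section CotangentCharts

variable {E : Type*} [NormedAddCommGroup E] [NormedSpace ℝ E]
  {Q : Type*} [TopologicalSpace Q] [ChartedSpace E Q] [IsManifold 𝓘(ℝ, E) ∞ Q]

instance [T2Space Q] : T2Space (Cotangent E Q) := t2Space_totalSpace

lemma extChartAt_cotangent_fst (z w : Cotangent E Q) :
    (extChartAt (cotModel E) z w).1 = extChartAt 𝓘(ℝ, E) z.proj w.proj := by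
  rw [FiberBundle.extChartAt]; rfl

lemma mem_extChartAt_cotangent_source {z w : Cotangent E Q} :
    w ∈ (extChartAt (cotModel E) z).source ↔ w.proj ∈ (extChartAt 𝓘(ℝ, E) z.proj).source := by
  rw [FiberBundle.extChartAt]
  simp only [PartialEquiv.trans_source, PartialEquiv.prod_source, PartialEquiv.refl_source]
  refine ⟨fun h => h.2.1, fun h => ⟨?_, h, mem_univ _⟩⟩
  rw [extChartAt_source] at h
  simpa using h

/-- The fibre coordinate comes from the trivialization of the bundle of homomorphisms from `TQ` to
the trivial line bundle, which pulls a covector back along the inverse of the base chart. -/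
lemma extChartAt_cotangent_snd {z w : Cotangent E Q}
    (hw : w ∈ (extChartAt (cotModel E) z).source) (X : E) :
    (extChartAt (cotModel E) z w).2 X =
      (show TangentSpace 𝓘(ℝ, E) w.proj →L[ℝ] ℝ from w.snd)
        (mfderiv 𝓘(ℝ, E) 𝓘(ℝ, E) (extChartAt 𝓘(ℝ, E) z.proj).symm
          (extChartAt 𝓘(ℝ, E) z.proj w.proj) X) := by
  have h := TangentBundle.symmL_trivializationAt (I := 𝓘(ℝ, E)) (x₀ := z.proj) (x := w.proj)
    (by rw [mem_extChartAt_cotangent_source, extChartAt_source] at hw; exact hw)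
  rw [modelWithCornersSelf_coe, range_id, mfderivWithin_univ] at h
  rw [FiberBundle.extChartAt, ← h]
  change ContinuousLinearMap.inCoordinates E (TangentSpace 𝓘(ℝ, E)) ℝ (Trivial Q ℝ)
    z.proj w.proj z.proj w.proj w.snd X = _
  simp [ContinuousLinearMap.inCoordinates]
  rfl

lemma symm_extChartAt_cotangent_proj {z : Cotangent E Q} {y : E × (E →L[ℝ] ℝ)}
    (hy : y ∈ (extChartAt (cotModel E) z).target) :
    ((extChartAt (cotModel E) z).symm y).proj = (extChartAt 𝓘(ℝ, E) z.proj).symm y.1 := by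
  have h := extChartAt_cotangent_fst z ((extChartAt (cotModel E) z).symm y)
  rw [(extChartAt (cotModel E) z).right_inv hy] at h
  rw [h, (extChartAt 𝓘(ℝ, E) z.proj).left_inv]
  exact mem_extChartAt_cotangent_source.1 ((extChartAt (cotModel E) z).map_target hy)

/-- In canonical coordinates the Liouville form is `p du`. -/
theorem oneFormInChart_liouville {z : Cotangent E Q} {y : E × (E →L[ℝ] ℝ)}
    (hy : y ∈ (extChartAt (cotModel E) z).target) :
    oneFormInChart (cotModel E) (liouville (E := E) (Q := Q)) z y = canonicalOneForm E y := by
  set κ := extChartAt (cotModel E) z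
  set ψ := extChartAt 𝓘(ℝ, E) z.proj
  have hs : κ.symm y ∈ κ.source := κ.map_target hy
  have hψ : (κ.symm y).proj ∈ ψ.source := mem_extChartAt_cotangent_source.1 hs
  have hy1 : y.1 = ψ (κ.symm y).proj := by
    rw [← extChartAt_cotangent_fst, κ.right_inv hy]
  have hy1t : y.1 ∈ ψ.target := hy1 ▸ ψ.map_source hψ
  refine ContinuousLinearMap.ext fun X => ?_
  have hproj : MDifferentiableAt (cotModel E) 𝓘(ℝ, E) (fun w : Cotangent E Q => w.proj)
      (κ.symm y) := (Bundle.contMDiff_proj (n := ∞) _).mdifferentiableAt (by simp)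
  -- In these charts the bundle projection is the first projection, so `Tπ` sees only the `du` part
  -- of `X`; the derivative of the inverse base chart left over is the one contained in the momentum
  -- coordinate.
  have hcomp : mfderiv (cotModel E) 𝓘(ℝ, E) (fun w : Cotangent E Q => w.proj) (κ.symm y)
      (mfderiv 𝓘(ℝ, E × (E →L[ℝ] ℝ)) (cotModel E) κ.symm y X) =
      mfderiv 𝓘(ℝ, E) 𝓘(ℝ, E) ψ.symm y.1 X.1 := by
    have e1 := mfderiv_comp y hproj (mdifferentiableAt_symm_extChartAt (J := cotModel E) hy)
    have e2 : ((fun w : Cotangent E Q => w.proj) ∘ κ.symm) =ᶠ[𝓝 y] ψ.symm ∘ Prod.fst := by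
      filter_upwards [(isOpen_extChartAt_target (I := cotModel E) z).mem_nhds hy] with x hx
      exact symm_extChartAt_cotangent_proj hx
    have e3 : mfderiv 𝓘(ℝ, E × (E →L[ℝ] ℝ)) 𝓘(ℝ, E) (ψ.symm ∘ Prod.fst) y =
        (mfderiv 𝓘(ℝ, E) 𝓘(ℝ, E) ψ.symm y.1).comp
          (mfderiv 𝓘(ℝ, E × (E →L[ℝ] ℝ)) 𝓘(ℝ, E) Prod.fst y) :=
      mfderiv_comp y (mdifferentiableAt_symm_extChartAt (J := 𝓘(ℝ, E)) hy1t)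
        (differentiableAt_fst.mdifferentiableAt)
    rw [e2.mfderiv_eq, e3] at e1
    have e4 := DFunLike.congr_fun e1 X
    rw [mfderiv_eq_fderiv, fderiv_fst] at e4
    exact e4.symm
  rw [canonicalOneForm_apply]
  have h2 := extChartAt_cotangent_snd hs X.1
  rw [κ.right_inv hy] at h2
  refine Eq.trans ?_ h2.symm
  rw [oneFormInChart, ModelWithCorners.range_eq_univ, mfderivWithin_univ]
  change (show TangentSpace 𝓘(ℝ, E) (κ.symm y).proj →L[ℝ] ℝ from (κ.symm y).snd) _ = _
  rw [← hy1]
  exact congrArg _ hcomp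

end CotangentCharts

/-! ### Manifolds with a one-form which has linear coefficients in all preferred charts -/

section LinearForm

variable {V : Type*} [NormedAddCommGroup V] [NormedSpace ℝ V]
  {G : Type*} [TopologicalSpace G] {J : ModelWithCorners ℝ V G} [J.Boundaryless]
  {N : Type*} [TopologicalSpace N] [ChartedSpace G N] [IsManifold J ∞ N]
  {η : ∀ x : N, TangentSpace J x →L[ℝ] ℝ} {θ : V →L[ℝ] V →L[ℝ] ℝ}

/-- In every preferred chart the one-form `η` has the linear coefficients `θ`. -/
def IsLinearInCharts (J : ModelWithCorners ℝ V G) (η : ∀ x : N, TangentSpace J x →L[ℝ] ℝ)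
    (θ : V →L[ℝ] V →L[ℝ] ℝ) : Prop :=
  ∀ z : N, ∀ y ∈ (extChartAt J z).target, oneFormInChart J η z y = θ y

omit [J.Boundaryless] [IsManifold J ∞ N] in
lemma extDerivOneForm_of_fderivWithin_eq {s : Set N} {x : N} {D : V →L[ℝ] V →L[ℝ] ℝ}
    (hD : fderivWithin ℝ (oneFormInChart J η x) ((extChartAt J x).symm ⁻¹' s ∩ range J)
      (extChartAt J x x) = D) (X Y : TangentSpace J x) :
    extDerivOneForm J η s x X Y = D X Y - D Y X := by
  subst hD; rfl

-- Near the centre of the chart the coefficient function is the linear map `θ`, which is its own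
-- derivative.
omit [IsManifold J ∞ N] in
lemma extDerivOneForm_of_isLinearInCharts (h : IsLinearInCharts J η θ) (z : N) (X Y : V) :
    extDerivOneForm J η univ z X Y = antisymmetrization θ X Y := by
  have h : fderivWithin ℝ (oneFormInChart J η z)
      ((extChartAt J z).symm ⁻¹' univ ∩ range J) (extChartAt J z z) = θ := by
    rw [ModelWithCorners.range_eq_univ, preimage_univ, inter_univ, fderivWithin_univ]
    have : oneFormInChart J η z =ᶠ[𝓝 (extChartAt J z z)] θ := by
      filter_upwards [extChartAt_target_mem_nhds (I := J) z] with y hy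
      exact h z y hy
    rw [this.fderiv_eq, θ.fderiv]
  exact extDerivOneForm_of_fderivWithin_eq h X Y

/-- Both sides express the same form `η`, read in two charts. This is the invariance hypothesis of
`antisymmetrization_fderiv`. -/
lemma IsLinearInCharts.transition (h : IsLinearInCharts J η θ) {z₀ z₁ : N} {y : V}
    (hy : y ∈ (extChartAt J z₀).target)
    (hy' : (extChartAt J z₀).symm y ∈ (extChartAt J z₁).source) :
    (θ (transition J z₀ z₁ y)).comp (fderiv ℝ (transition J z₀ z₁) y) = θ y := by
  have ht : HamiltonianField.transition J z₀ z₁ y ∈ (extChartAt J z₁).target :=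
    (extChartAt J z₁).map_source hy'
  rw [← h z₀ y hy, ← h z₁ _ ht]
  refine ContinuousLinearMap.ext fun X => ?_
  rw [ContinuousLinearMap.comp_apply, oneFormInChart, oneFormInChart,
    ModelWithCorners.range_eq_univ, mfderivWithin_univ, mfderivWithin_univ, fderiv_transition hy hy']
  have key := mfderiv_symm_mfderiv_extChartAt hy'
    (mfderiv 𝓘(ℝ, V) J (extChartAt J z₀).symm y X)
  have hinv : (extChartAt J z₁).symm (extChartAt J z₁ ((extChartAt J z₀).symm y)) =
      (extChartAt J z₀).symm y := (extChartAt J z₁).left_inv hy'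
  change η ((extChartAt J z₁).symm (extChartAt J z₁ ((extChartAt J z₀).symm y))) _ = η _ _
  rw [hinv]
  exact congrArg _ key

/-- The exterior derivative has the same constant coefficients in every preferred chart. -/
theorem IsLinearInCharts.extDerivOneForm_eq_mfderiv (h : IsLinearInCharts J η θ) {z₀ z : N}
    (hz : z ∈ (extChartAt J z₀).source) (X Y : TangentSpace J z) :
    extDerivOneForm J η univ z X Y = antisymmetrization θ
      (mfderiv J 𝓘(ℝ, V) (extChartAt J z₀) z X) (mfderiv J 𝓘(ℝ, V) (extChartAt J z₀) z Y) := by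
  have hy : extChartAt J z z ∈ (extChartAt J z).target := mem_extChartAt_target z
  have hinv : (extChartAt J z).symm (extChartAt J z z) = z := extChartAt_to_inv z
  have hy' : (extChartAt J z).symm (extChartAt J z z) ∈ (extChartAt J z₀).source := by rwa [hinv]
  have hD : ∀ X : V, fderiv ℝ (HamiltonianField.transition J z z₀) (extChartAt J z z) X =
      mfderiv J 𝓘(ℝ, V) (extChartAt J z₀) z X := by
    intro X
    rw [fderiv_transition hy hy', mfderiv_symm_extChartAt_self, hinv]
    rfl
  -- The transition map out of the chart centred at `z` preserves `θ`, hence its exterior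
  -- derivative, and its differential at the centre is that of the chart at `z₀`.
  have h2 := antisymmetrization_fderiv θ
    ((contDiffAt_transition hy hy').of_le ENat.LEInfty.out)
    ((eventually_symm_mem_source hy hy').mono fun x hx => h.transition hx.1 hx.2) X Y
  refine (extDerivOneForm_of_isLinearInCharts h z X Y).trans (h2.symm.trans ?_)
  exact congrArg₂ (fun a b => antisymmetrization θ a b) (hD X) (hD Y)

end LinearForm

/-! ### The form `η - H dt` and its exterior derivative -/

section Differential

variable {V : Type*} [NormedAddCommGroup V] [NormedSpace ℝ V]
  {G : Type*} [TopologicalSpace G] {J : ModelWithCorners ℝ V G} [J.Boundaryless]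
  {N : Type*} [TopologicalSpace N] [ChartedSpace G N] [IsManifold J ∞ N]

/-- The Hamiltonian in the preferred chart at `z₀`, as a function of `(t, y)`. -/
def hamiltonianInChart (J : ModelWithCorners ℝ V G) (H : N × ℝ → ℝ) (z₀ : N) (q : ℝ × V) : ℝ :=
  H ((extChartAt J z₀).symm q.2, q.1)

/-- The differential of a time-dependent function in the direction of `N`. -/
def spaceDifferential (J : ModelWithCorners ℝ V G) (H : N × ℝ → ℝ) (t : ℝ) (z : N) :
    TangentSpace J z →L[ℝ] ℝ :=
  mfderiv J 𝓘(ℝ, ℝ) (fun w => H (w, t)) z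

variable {H : N × ℝ → ℝ}

omit [J.Boundaryless] in
lemma contDiffOn_hamiltonianInChart
    (hH : ContMDiffOn (J.prod 𝓘(ℝ, ℝ)) 𝓘(ℝ, ℝ) ∞ H (univ ×ˢ Icc (0 : ℝ) 1)) (z₀ : N) :
    ContDiffOn ℝ ∞ (hamiltonianInChart J H z₀) (Icc (0 : ℝ) 1 ×ˢ (extChartAt J z₀).target) := by
  rw [← contMDiffOn_iff_contDiffOn]
  have h1 : ContMDiffOn 𝓘(ℝ, ℝ × V) J ∞ (fun q : ℝ × V => (extChartAt J z₀).symm q.2)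
      (Icc (0 : ℝ) 1 ×ˢ (extChartAt J z₀).target) :=
    (contMDiffOn_extChartAt_symm z₀).comp (contDiff_snd.contMDiff.contMDiffOn) fun q hq => hq.2
  have h2 : ContMDiffOn 𝓘(ℝ, ℝ × V) 𝓘(ℝ, ℝ) ∞ (fun q : ℝ × V => q.1)
      (Icc (0 : ℝ) 1 ×ˢ (extChartAt J z₀).target) :=
    contDiff_fst.contMDiff.contMDiffOn
  exact hH.comp (h1.prodMk h2) fun q hq => ⟨mem_univ _, hq.1⟩

omit [J.Boundaryless] [IsManifold J ∞ N] in
lemma contMDiff_hamiltonian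
    (hH : ContMDiffOn (J.prod 𝓘(ℝ, ℝ)) 𝓘(ℝ, ℝ) ∞ H (univ ×ˢ Icc (0 : ℝ) 1)) {t : ℝ}
    (ht : t ∈ Icc (0 : ℝ) 1) : ContMDiff J 𝓘(ℝ, ℝ) ∞ (fun w => H (w, t)) := by
  rw [← contMDiffOn_univ]
  exact hH.comp (contMDiff_id.prodMk contMDiff_const).contMDiffOn fun w _ => ⟨mem_univ _, ht⟩

/-- The differential of the Hamiltonian in coordinates. -/
lemma fderiv_hamiltonianInChart
    (hH : ContMDiffOn (J.prod 𝓘(ℝ, ℝ)) 𝓘(ℝ, ℝ) ∞ H (univ ×ˢ Icc (0 : ℝ) 1)) {z₀ : N} {t : ℝ}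
    (ht : t ∈ Icc (0 : ℝ) 1) {y : V} (hy : y ∈ (extChartAt J z₀).target) (X : V) :
    fderiv ℝ (fun x => hamiltonianInChart J H z₀ (t, x)) y X =
      spaceDifferential J H t ((extChartAt J z₀).symm y)
        (mfderiv 𝓘(ℝ, V) J (extChartAt J z₀).symm y X) := by
  have h := mfderiv_comp y
    ((contMDiff_hamiltonian hH ht).mdifferentiableAt (x := (extChartAt J z₀).symm y) (by simp))
    (mdifferentiableAt_symm_extChartAt hy)
  rw [mfderiv_eq_fderiv] at h
  exact DFunLike.congr_fun h X

lemma fderiv_hamiltonianInChart_self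
    (hH : ContMDiffOn (J.prod 𝓘(ℝ, ℝ)) 𝓘(ℝ, ℝ) ∞ H (univ ×ˢ Icc (0 : ℝ) 1)) {z : N} {t : ℝ}
    (ht : t ∈ Icc (0 : ℝ) 1) (X : V) :
    fderiv ℝ (fun x => hamiltonianInChart J H z (t, x)) (extChartAt J z z) X =
      spaceDifferential J H t z X := by
  rw [fderiv_hamiltonianInChart hH ht (mem_extChartAt_target z),
    mfderiv_symm_extChartAt_self, extChartAt_to_inv]
  rfl

/-- The one-form `η - H dt` on `N × ℝ`. -/
def extendedForm (η : ∀ x : N, TangentSpace J x →L[ℝ] ℝ) (H : N × ℝ → ℝ) (x : N × ℝ) :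
    TangentSpace (J.prod 𝓘(ℝ, ℝ)) x →L[ℝ] ℝ :=
  ContinuousLinearMap.comp (η x.1) (mfderiv (J.prod 𝓘(ℝ, ℝ)) J Prod.fst x) -
    H x • (show TangentSpace (J.prod 𝓘(ℝ, ℝ)) x →L[ℝ] ℝ from
      mfderiv (J.prod 𝓘(ℝ, ℝ)) 𝓘(ℝ, ℝ) Prod.snd x)

variable {η : ∀ x : N, TangentSpace J x →L[ℝ] ℝ} {θ : V →L[ℝ] V →L[ℝ] ℝ}

lemma oneFormInChart_extendedForm (h : IsLinearInCharts J η θ) {z : N} {t : ℝ} {q : V × ℝ}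
    (hq : q.1 ∈ (extChartAt J z).target) :
    oneFormInChart (J.prod 𝓘(ℝ, ℝ)) (extendedForm η H) (z, t) q =
      (θ q.1).comp (ContinuousLinearMap.fst ℝ V ℝ) -
        hamiltonianInChart J H z (q.2, q.1) • ContinuousLinearMap.snd ℝ V ℝ := by
  have hs : ⇑(extChartAt (J.prod 𝓘(ℝ, ℝ)) (z, t)).symm =
      fun p : V × ℝ => ((extChartAt J z).symm p.1, p.2) := by
    rw [extChartAt_prod]; rfl
  have hd1 : MDifferentiableAt 𝓘(ℝ, V × ℝ) J (fun p : V × ℝ => (extChartAt J z).symm p.1) q :=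
    (mdifferentiableAt_symm_extChartAt hq).comp q
      (differentiableAt_fst.mdifferentiableAt)
  have hd2 : MDifferentiableAt 𝓘(ℝ, V × ℝ) 𝓘(ℝ, ℝ) (fun p : V × ℝ => p.2) q :=
    differentiableAt_snd.mdifferentiableAt
  have hd : MDifferentiableAt 𝓘(ℝ, V × ℝ) (J.prod 𝓘(ℝ, ℝ))
      (fun p : V × ℝ => ((extChartAt J z).symm p.1, p.2)) q := hd1.prodMk hd2
  refine ContinuousLinearMap.ext fun X => ?_
  rw [oneFormInChart, ModelWithCorners.range_eq_univ, mfderivWithin_univ, hs]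
  have e1 := DFunLike.congr_fun (mfderiv_comp q (I' := J.prod 𝓘(ℝ, ℝ))
    (mdifferentiableAt_fst (I := J) (I' := 𝓘(ℝ, ℝ))) hd) X
  have e2 := DFunLike.congr_fun (mfderiv_comp q (I' := J.prod 𝓘(ℝ, ℝ))
    (mdifferentiableAt_snd (I := J) (I' := 𝓘(ℝ, ℝ))) hd) X
  have e3 := DFunLike.congr_fun (mfderiv_comp q (I' := 𝓘(ℝ, V))
    (mdifferentiableAt_symm_extChartAt (J := J) hq)
    (differentiableAt_fst (𝕜 := ℝ) (p := q)).mdifferentiableAt) X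
  rw [mfderiv_eq_fderiv (f := (Prod.fst : V × ℝ → V)), fderiv_fst] at e3
  have e4 : mfderiv 𝓘(ℝ, V × ℝ) 𝓘(ℝ, ℝ) (fun p : V × ℝ => p.2) q X = X.2 := by
    rw [mfderiv_eq_fderiv, fderiv_snd]; rfl
  rw [← h z q.1 hq, oneFormInChart, ModelWithCorners.range_eq_univ, mfderivWithin_univ]
  refine congrArg₂ (fun a b : ℝ => a - b) ?_ ?_
  · exact congrArg (η ((extChartAt J z).symm q.1)) (e1.symm.trans e3)
  · exact congrArg (fun a : ℝ => H ((extChartAt J z).symm q.1, q.2) • a) (e2.symm.trans e4)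

/-- The value of `d(η - H dt)` on a vertical vector `(U, 0)` and a vector `(W, 1)`. -/
theorem extDerivOneForm_extendedForm (h : IsLinearInCharts J η θ)
    (hH : ContMDiffOn (J.prod 𝓘(ℝ, ℝ)) 𝓘(ℝ, ℝ) ∞ H (univ ×ˢ Icc (0 : ℝ) 1)) (z : N) {t : ℝ}
    (ht : t ∈ Icc (0 : ℝ) 1) (U W : V) :
    extDerivOneForm (J.prod 𝓘(ℝ, ℝ)) (extendedForm η H) (univ ×ˢ Icc (0 : ℝ) 1) (z, t)
      ((U, 0) : V × ℝ) ((W, 1) : V × ℝ) =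
      antisymmetrization θ U W - spaceDifferential J H t z U := by
  -- `H` is smooth only on the slab, so all derivatives are taken within `[0, 1]` in time. They
  -- remain unique, the slab being a set of unique differentiability.
  have hs : (extChartAt (J.prod 𝓘(ℝ, ℝ)) (z, t)).symm ⁻¹' (univ ×ˢ Icc (0 : ℝ) 1) ∩
      range (J.prod 𝓘(ℝ, ℝ)) = univ ×ˢ Icc (0 : ℝ) 1 := by
    rw [ModelWithCorners.range_eq_univ, inter_univ, extChartAt_prod]
    ext p
    exact ⟨fun h => ⟨mem_univ _, h.2⟩, fun h => ⟨mem_univ _, h.2⟩⟩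
  have hx : extChartAt (J.prod 𝓘(ℝ, ℝ)) (z, t) (z, t) = (extChartAt J z z, t) := by
    rw [extChartAt_prod]; rfl
  set x : V × ℝ := (extChartAt J z z, t) with hxdef
  have hxt : x.1 ∈ (extChartAt J z).target := mem_extChartAt_target z
  have hxS : x ∈ (univ : Set V) ×ˢ Icc (0 : ℝ) 1 := ⟨mem_univ _, ht⟩
  have hnhds : ∀ᶠ q in 𝓝[univ ×ˢ Icc (0 : ℝ) 1] x, q.1 ∈ (extChartAt J z).target :=
    mem_nhdsWithin_of_mem_nhds (continuous_fst.continuousAt.preimage_mem_nhds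
      ((isOpen_extChartAt_target z).mem_nhds hxt))
  have hg := contDiffOn_hamiltonianInChart hH z
  have hg1 : DifferentiableWithinAt ℝ (fun q : V × ℝ => hamiltonianInChart J H z (q.2, q.1))
      (univ ×ˢ Icc (0 : ℝ) 1) x := by
    have hsub : DifferentiableWithinAt ℝ (fun q : V × ℝ => hamiltonianInChart J H z (q.2, q.1))
        ((extChartAt J z).target ×ˢ Icc (0 : ℝ) 1) x :=
      ((hg.differentiableOn (by simp)) (t, x.1) ⟨ht, hxt⟩).comp x
        (f := fun q : V × ℝ => (q.2, q.1)) (by fun_prop) fun q hq => ⟨hq.2, hq.1⟩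
    refine hsub.mono_of_mem_nhdsWithin ?_
    filter_upwards [hnhds, self_mem_nhdsWithin] with q h1 h2 using ⟨h1, h2.2⟩
  set g' := fderivWithin ℝ (fun q : V × ℝ => hamiltonianInChart J H z (q.2, q.1))
    (univ ×ˢ Icc (0 : ℝ) 1) x
  have hgd := hg1.hasFDerivWithinAt
  have hU : g' (U, 0) = spaceDifferential J H t z U := by
    rw [← fderiv_hamiltonianInChart_self hH ht]
    have hc : HasFDerivAt (fun y : V => (y, t)) (ContinuousLinearMap.inl ℝ V ℝ)
      (extChartAt J z z) := hasFDerivAt_prodMk_left _ _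
    have := hgd.comp (extChartAt J z z) (hc.hasFDerivWithinAt (s := univ))
      (fun y _ => (⟨mem_univ _, ht⟩ : (y, t) ∈ (univ : Set V) ×ˢ Icc (0 : ℝ) 1))
    rw [hasFDerivWithinAt_univ] at this
    have e : fderiv ℝ (fun y => hamiltonianInChart J H z (t, y)) (extChartAt J z z) =
        g'.comp (ContinuousLinearMap.inl ℝ V ℝ) := this.fderiv
    rw [e]; simp
  have hF : HasFDerivWithinAt (oneFormInChart (J.prod 𝓘(ℝ, ℝ)) (extendedForm η H) (z, t))
      (((ContinuousLinearMap.compL ℝ (V × ℝ) V ℝ).flip (ContinuousLinearMap.fst ℝ V ℝ)).comp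
          (θ.comp (ContinuousLinearMap.fst ℝ V ℝ)) -
        g'.smulRight (ContinuousLinearMap.snd ℝ V ℝ)) (univ ×ˢ Icc (0 : ℝ) 1) x := by
    have hlin : HasFDerivWithinAt (fun q : V × ℝ => (θ q.1).comp (ContinuousLinearMap.fst ℝ V ℝ))
        (((ContinuousLinearMap.compL ℝ (V × ℝ) V ℝ).flip (ContinuousLinearMap.fst ℝ V ℝ)).comp
          (θ.comp (ContinuousLinearMap.fst ℝ V ℝ))) (univ ×ˢ Icc (0 : ℝ) 1) x :=
      (((ContinuousLinearMap.compL ℝ (V × ℝ) V ℝ).flip (ContinuousLinearMap.fst ℝ V ℝ)).comp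
          (θ.comp (ContinuousLinearMap.fst ℝ V ℝ))).hasFDerivWithinAt
    refine (hlin.sub (hgd.smul_const (ContinuousLinearMap.snd ℝ V ℝ))).congr_of_eventuallyEq ?_
      (oneFormInChart_extendedForm h hxt)
    filter_upwards [hnhds] with q hq
    exact oneFormInChart_extendedForm h hq
  have huniq : UniqueDiffWithinAt ℝ ((univ : Set V) ×ˢ Icc (0 : ℝ) 1) x :=
    (uniqueDiffOn_univ.prod (uniqueDiffOn_Icc zero_lt_one)) x hxS
  have hD := hF.fderivWithin huniq
  rw [← hx, ← hs] at hD
  rw [antisymmetrization_apply, ← hU]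
  refine (extDerivOneForm_of_fderivWithin_eq hD _ _).trans ?_
  -- The only term containing the time derivative of `H` is multiplied by `dt (U, 0) = 0`.
  change θ U W - g' (U, 0) * 1 - (θ W U - g' (W, 1) * 0) = _
  ring

end Differential

/-! ### Hamiltonian curves -/

section Interval

/-- A closed condition on `[a, b]` which can be continued to the right holds on `[a, b]`. -/
lemma Icc_subset_of_continuation {a b : ℝ} {C : Set ℝ} (hC : IsClosed (C ∩ Icc a b)) (ha : a ∈ C)
    (h : ∀ x ∈ Ico a b, Icc a x ⊆ C → C ∈ 𝓝[>] x) : Icc a b ⊆ C := by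
  by_contra hne
  obtain ⟨d, hd, hdC⟩ := not_subset.1 hne
  set D := Icc a b \ C
  have hbdd : BddBelow D := ⟨a, fun x hx => hx.1.1⟩
  have hDne : D.Nonempty := ⟨d, hd, hdC⟩
  set x := sInf D
  have hax : a ≤ x := le_csInf hDne fun y hy => hy.1.1
  have hxd : x ≤ d := csInf_le hbdd ⟨hd, hdC⟩
  have hlt : ∀ y ∈ Ico a x, y ∈ C := fun y hy => by
    by_contra hyC
    exact absurd (csInf_le hbdd ⟨⟨hy.1, (hy.2.le.trans hxd).trans hd.2⟩, hyC⟩) (not_le.2 hy.2)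
  have hxC : x ∈ C := by
    rcases hax.eq_or_lt with h0 | h0
    · rwa [← h0]
    · have : x ∈ closure (C ∩ Icc a b) := by
        have hsub : Ico a x ⊆ C ∩ Icc a b :=
          fun y hy => ⟨hlt y hy, hy.1, (hy.2.le.trans hxd).trans hd.2⟩
        refine closure_mono hsub ?_
        rw [closure_Ico h0.ne]
        exact right_mem_Icc.2 hax
      exact (hC.closure_subset this).1
  have hxd' : x < d := hxd.lt_of_ne fun e => hdC (e ▸ hxC)
  have hsub : Icc a x ⊆ C := fun y hy => by
    rcases hy.2.eq_or_lt with e | e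
    · exact e ▸ hxC
    · exact hlt y ⟨hy.1, e⟩
  obtain ⟨u, hu, huC⟩ := mem_nhdsGT_iff_exists_Ioo_subset.1 (h x ⟨hax, hxd'.trans_le hd.2⟩ hsub)
  have : u ≤ x := le_csInf hDne fun y hy => by
    by_contra hyu
    have hxy : x ≤ y := csInf_le hbdd hy
    rcases hxy.eq_or_lt with e | e
    · exact hy.2 (e ▸ hxC)
    · exact hy.2 (huC ⟨e, not_le.1 hyu⟩)
  exact absurd hu (not_lt.2 this)

/-- Statements on differential equations need a nondegenerate compact interval. Clipping `[t - δ/2,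
t + δ/2]` to `[0, 1]` gives one, also when `t` is an end point. -/
lemma exists_Icc_of_eventually {t : ℝ} (ht : t ∈ Icc (0 : ℝ) 1) {p : ℝ → Prop}
    (h : ∀ᶠ s in 𝓝[Icc 0 1] t, p s) :
    ∃ a b : ℝ, a < b ∧ t ∈ Icc a b ∧ Icc a b ⊆ Icc 0 1 ∧ Icc a b ∈ 𝓝[Icc 0 1] t ∧
      ∀ s ∈ Icc a b, p s := by
  obtain ⟨δ, hδ, hp⟩ := Metric.mem_nhdsWithin_iff.1 h
  refine ⟨max 0 (t - δ / 2), min 1 (t + δ / 2), ?_, ?_, ?_, ?_, ?_⟩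
  · rcases ht with ⟨h0, h1⟩
    rcases h0.eq_or_lt with e | e
    · subst e
      rw [max_eq_left (by linarith)]
      exact lt_min one_pos (by linarith)
    · exact (max_lt e (by linarith)).trans_le (le_min h1 (by linarith))
  · exact ⟨max_le ht.1 (by linarith), le_min ht.2 (by linarith)⟩
  · exact Icc_subset_Icc (le_max_left _ _) (min_le_left _ _)
  · refine Metric.mem_nhdsWithin_iff.2 ⟨δ / 2, by positivity, fun s hs => ?_⟩
    have h1 := abs_lt.1 (Real.dist_eq s t ▸ Metric.mem_ball.1 hs.1)
    exact ⟨max_le hs.2.1 (by linarith), le_min hs.2.2 (by linarith)⟩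
  · intro s hs
    refine hp ⟨?_, (le_max_left _ _).trans hs.1, hs.2.trans (min_le_left _ _)⟩
    rw [Metric.mem_ball, Real.dist_eq, abs_lt]
    have h1 := (le_max_right _ _).trans hs.1
    have h2 := hs.2.trans (min_le_right _ _)
    constructor <;> linarith

end Interval

section LocalUniqueness

variable {V : Type*} [NormedAddCommGroup V] [NormedSpace ℝ V]

/-- Local uniqueness for smooth differential equations on `[0, 1]`, end points included. -/
lemma eventually_eq_of_hasDerivWithinAt {f : ℝ × V → V} {U : Set V} (hU : IsOpen U)
    (hf : ContDiffOn ℝ ∞ f (Icc (0 : ℝ) 1 ×ˢ U)) {c₁ c₂ : ℝ → V} {t : ℝ} (ht : t ∈ Icc (0 : ℝ) 1)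
    (h₁ : ∀ᶠ s in 𝓝[Icc 0 1] t, HasDerivWithinAt c₁ (f (s, c₁ s)) (Icc 0 1) s)
    (h₂ : ∀ᶠ s in 𝓝[Icc 0 1] t, HasDerivWithinAt c₂ (f (s, c₂ s)) (Icc 0 1) s)
    (hU₁ : c₁ t ∈ U) (heq : c₁ t = c₂ t) : ∀ᶠ s in 𝓝[Icc 0 1] t, c₁ s = c₂ s := by
  obtain ⟨r, hr, hrU⟩ := Metric.isOpen_iff.1 hU _ hU₁
  have hconv : Convex ℝ (Icc (0 : ℝ) 1 ×ˢ Metric.ball (c₁ t) r) :=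
    (convex_Icc 0 1).prod (convex_ball _ _)
  have hmem : (t, c₁ t) ∈ Icc (0 : ℝ) 1 ×ˢ U := ⟨ht, hU₁⟩
  -- Convexity of the slab over a ball lets `C¹` regularity give a Lipschitz constant in `(t, x)`
  -- jointly, hence one in `x` that is uniform in time.
  obtain ⟨K, S, hS, hK⟩ := (((hf _ hmem).mono (prod_mono le_rfl hrU)).of_le
    (m := 1) ENat.LEInfty.out).exists_lipschitzOnWith hconv
  rw [nhdsWithin_prod_eq, mem_prod_iff] at hS
  obtain ⟨S₁, hS₁, S₂, hS₂, hS⟩ := hS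
  rw [Metric.isOpen_ball.nhdsWithin_eq (Metric.mem_ball_self hr)] at hS₂
  have hc₁ : ContinuousWithinAt c₁ (Icc 0 1) t := (h₁.self_of_nhdsWithin ht).continuousWithinAt
  have hc₂ : ContinuousWithinAt c₂ (Icc 0 1) t := (h₂.self_of_nhdsWithin ht).continuousWithinAt
  obtain ⟨a, b, hab, htab, hsub, hnhds, hp⟩ := exists_Icc_of_eventually ht
    (((h₁.and h₂).and hS₁).and ((hc₁.eventually_mem hS₂).and
      (hc₂.eventually_mem (heq ▸ hS₂))))
  have hv : ∀ s ∈ Icc a b, LipschitzOnWith K (fun x => f (s, x)) S₂ := fun s hs x hx y hy => by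
    have := hK (hS (mk_mem_prod (hp s hs).1.2 hx)) (hS (mk_mem_prod (hp s hs).1.2 hy))
    simpa [Prod.edist_eq] using this
  have hr : EqOn c₁ c₂ (Icc t b) := by
    have hI : Icc t b ⊆ Icc a b := Icc_subset_Icc_left htab.1
    have hIco : ∀ s ∈ Ico t b, s ∈ Icc a b := fun s hs => hI (Ico_subset_Icc_self hs)
    have hn : ∀ s ∈ Ico t b, Icc (0 : ℝ) 1 ∈ 𝓝[≥] s := fun s hs =>
      mem_of_superset (Icc_mem_nhdsGE_of_mem hs) (hI.trans hsub)
    exact ODE_solution_unique_of_mem_Icc_right (v := fun s x => f (s, x)) (s := fun _ => S₂)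
      (fun s hs => hv s (hIco s hs))
      (fun s hs => ((hp s (hI hs)).1.1.1.mono (hI.trans hsub)).continuousWithinAt)
      (fun s hs => (hp s (hIco s hs)).1.1.1.mono_of_mem_nhdsWithin (hn s hs))
      (fun s hs => (hp s (hIco s hs)).2.1)
      (fun s hs => ((hp s (hI hs)).1.1.2.mono (hI.trans hsub)).continuousWithinAt)
      (fun s hs => (hp s (hIco s hs)).1.1.2.mono_of_mem_nhdsWithin (hn s hs))
      (fun s hs => (hp s (hIco s hs)).2.2) heq
  have hl : EqOn c₁ c₂ (Icc a t) := by
    have hI : Icc a t ⊆ Icc a b := Icc_subset_Icc_right htab.2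
    have hIoc : ∀ s ∈ Ioc a t, s ∈ Icc a b := fun s hs => hI (Ioc_subset_Icc_self hs)
    have hn : ∀ s ∈ Ioc a t, Icc (0 : ℝ) 1 ∈ 𝓝[≤] s := fun s hs =>
      mem_of_superset (Icc_mem_nhdsLE_of_mem hs) (hI.trans hsub)
    exact ODE_solution_unique_of_mem_Icc_left (v := fun s x => f (s, x)) (s := fun _ => S₂)
      (fun s hs => hv s (hIoc s hs))
      (fun s hs => ((hp s (hI hs)).1.1.1.mono (hI.trans hsub)).continuousWithinAt)
      (fun s hs => (hp s (hIoc s hs)).1.1.1.mono_of_mem_nhdsWithin (hn s hs))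
      (fun s hs => (hp s (hIoc s hs)).2.1)
      (fun s hs => ((hp s (hI hs)).1.1.2.mono (hI.trans hsub)).continuousWithinAt)
      (fun s hs => (hp s (hIoc s hs)).1.1.2.mono_of_mem_nhdsWithin (hn s hs))
      (fun s hs => (hp s (hIoc s hs)).2.2) heq
  filter_upwards [hnhds] with s hs
  rcases le_total s t with h | h
  · exact hl ⟨hs.1, h⟩
  · exact hr ⟨h, hs.2⟩

end LocalUniqueness

section DualEquiv

variable {V : Type*} [NormedAddCommGroup V] [NormedSpace ℝ V] [FiniteDimensional ℝ V]

/-- Nondegeneracy is injectivity, and the dimensions agree. The inverse turns the implicit condition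
`Ω Y v = dH Y` into an explicit vector field. -/
lemma exists_dualEquiv {Ω : V →L[ℝ] V →L[ℝ] ℝ} (h : ∀ X, (∀ Y, Ω Y X = 0) → X = 0) :
    ∃ σ : V ≃L[ℝ] (V →L[ℝ] ℝ), ∀ X Y, σ X Y = Ω Y X := by
  have hinj : Function.Injective (Ω.flip : V →ₗ[ℝ] (V →L[ℝ] ℝ)) := by
    rw [← LinearMap.ker_eq_bot, LinearMap.ker_eq_bot']
    exact fun X hX => h X fun Y => DFunLike.congr_fun hX Y
  have hdim : Module.finrank ℝ V = Module.finrank ℝ (V →L[ℝ] ℝ) := by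
    rw [← (LinearMap.toContinuousLinearMap : (V →ₗ[ℝ] ℝ) ≃ₗ[ℝ] (V →L[ℝ] ℝ)).finrank_eq]
    exact (Subspace.dual_finrank_eq (K := ℝ) (V := V)).symm
  refine ⟨(LinearMap.linearEquivOfInjective _ hinj hdim).toContinuousLinearEquiv,
    fun X Y => rfl⟩

end DualEquiv

/-! ### Integral curves of the Hamiltonian vector field: change of chart, smoothness, uniqueness -/

section HamiltonCurves

variable {V : Type*} [NormedAddCommGroup V] [NormedSpace ℝ V]
  {G : Type*} [TopologicalSpace G] {J : ModelWithCorners ℝ V G}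
  {N : Type*} [TopologicalSpace N] [ChartedSpace G N]

/-- The two-form `β` on `N` is symplectic, and all preferred charts are Darboux charts in which it
has the constant coefficients `Ω`. -/
structure IsDarboux (J : ModelWithCorners ℝ V G)
    (β : ∀ z : N, TangentSpace J z → TangentSpace J z → ℝ) (Ω : V →L[ℝ] V →L[ℝ] ℝ) : Prop where
  swap : ∀ X Y, Ω X Y = -Ω Y X
  nondegenerate : ∀ X, (∀ Y, Ω Y X = 0) → X = 0
  chart : ∀ z₀ z : N, z ∈ (extChartAt J z₀).source → ∀ X Y : TangentSpace J z,
    β z X Y = Ω (mfderiv J 𝓘(ℝ, V) (extChartAt J z₀) z X) (mfderiv J 𝓘(ℝ, V) (extChartAt J z₀) z Y)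

/-- The curve `χ` is an integral curve on `[0, 1]` of the Hamiltonian vector field of `H`. At each
time `t`, its velocity `v` is computed in the preferred chart at `χ t`. -/
def IsHamiltonCurve (J : ModelWithCorners ℝ V G) (Ω : V →L[ℝ] V →L[ℝ] ℝ) (H : N × ℝ → ℝ)
    (χ : ℝ → N) : Prop :=
  ∀ t ∈ Icc (0 : ℝ) 1, ContinuousWithinAt χ (Icc 0 1) t ∧
    ∃ v : V, HasDerivWithinAt (fun s => extChartAt J (χ t) (χ s)) v (Icc 0 1) t ∧
      ∀ Y : V, Ω Y v = spaceDifferential J H t (χ t) Y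

/-- The Hamiltonian vector field in the preferred chart at `z₀`. Here `σ` is the isomorphism from
vectors to covectors given by the symplectic form. -/
def hamiltonVectorField (J : ModelWithCorners ℝ V G) (σ : V ≃L[ℝ] (V →L[ℝ] ℝ)) (H : N × ℝ → ℝ)
    (z₀ : N) (q : ℝ × V) : V :=
  σ.symm (spaceDeriv (hamiltonianInChart J H z₀) (Icc 0 1) (extChartAt J z₀).target q)

variable {β : ∀ z : N, TangentSpace J z → TangentSpace J z → ℝ} {Ω : V →L[ℝ] V →L[ℝ] ℝ}
  {σ : V ≃L[ℝ] (V →L[ℝ] ℝ)} {H : N × ℝ → ℝ} {χ : ℝ → N}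

lemma IsHamiltonCurve.continuousOn (h : IsHamiltonCurve J Ω H χ) : ContinuousOn χ (Icc 0 1) :=
  fun t ht => (h t ht).1

variable [J.Boundaryless] [IsManifold J ∞ N]

lemma contDiffOn_hamiltonVectorField
    (hH : ContMDiffOn (J.prod 𝓘(ℝ, ℝ)) 𝓘(ℝ, ℝ) ∞ H (univ ×ˢ Icc (0 : ℝ) 1)) (z₀ : N) :
    ContDiffOn ℝ ∞ (hamiltonVectorField J σ H z₀) (Icc (0 : ℝ) 1 ×ˢ (extChartAt J z₀).target) :=
  σ.symm.contDiff.comp_contDiffOn (contDiffOn_spaceDeriv (uniqueDiffOn_Icc zero_lt_one)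
    (isOpen_extChartAt_target z₀) (contDiffOn_hamiltonianInChart hH z₀))

/-- Hamilton's equations for the Hamiltonian vector field in a chart. -/
lemma hamiltonVectorField_spec (hσ : ∀ X Y, σ X Y = Ω Y X)
    (hH : ContMDiffOn (J.prod 𝓘(ℝ, ℝ)) 𝓘(ℝ, ℝ) ∞ H (univ ×ˢ Icc (0 : ℝ) 1)) {z₀ : N} {t : ℝ}
    (ht : t ∈ Icc (0 : ℝ) 1) {y : V} (hy : y ∈ (extChartAt J z₀).target) (Y : V) :
    Ω Y (hamiltonVectorField J σ H z₀ (t, y)) =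
      fderiv ℝ (fun x => hamiltonianInChart J H z₀ (t, x)) y Y := by
  rw [← hσ, hamiltonVectorField, σ.apply_symm_apply,
    (hasFDerivAt_spaceDeriv (isOpen_extChartAt_target z₀) (contDiffOn_hamiltonianInChart hH z₀)
      ht hy).fderiv]

/-- In every preferred chart a Hamiltonian curve is an integral curve of the Hamiltonian vector
field. -/
theorem IsHamiltonCurve.hasDerivWithinAt (hβ : IsDarboux J β Ω) (hσ : ∀ X Y, σ X Y = Ω Y X)
    (hH : ContMDiffOn (J.prod 𝓘(ℝ, ℝ)) 𝓘(ℝ, ℝ) ∞ H (univ ×ˢ Icc (0 : ℝ) 1))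
    (h : IsHamiltonCurve J Ω H χ) {z₀ : N} {t : ℝ} (ht : t ∈ Icc (0 : ℝ) 1)
    (hz : χ t ∈ (extChartAt J z₀).source) :
    HasDerivWithinAt (fun s => extChartAt J z₀ (χ s))
      (hamiltonVectorField J σ H z₀ (t, extChartAt J z₀ (χ t))) (Icc 0 1) t := by
  obtain ⟨hc, v, hv, hvY⟩ := h t ht
  set κ := extChartAt J z₀
  set κt := extChartAt J (χ t)
  have hy : κt (χ t) ∈ κt.target := mem_extChartAt_target _
  have hinv : κt.symm (κt (χ t)) = χ t := extChartAt_to_inv _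
  have hy' : κt.symm (κt (χ t)) ∈ κ.source := by rwa [hinv]
  have hyκ : κ (χ t) ∈ κ.target := κ.map_source hz
  have hD : ∀ X : V, fderiv ℝ (transition J (χ t) z₀) (κt (χ t)) X =
      mfderiv J 𝓘(ℝ, V) κ (χ t) X := by
    intro X
    rw [fderiv_transition hy hy', mfderiv_symm_extChartAt_self, hinv]
    rfl
  -- Naming the image as an element of `V` leaves the tangent space for the model space, where the
  -- derivative and the pairing `Ω` live.
  obtain ⟨v', hv'⟩ : ∃ v' : V, v' = mfderiv J 𝓘(ℝ, V) κ (χ t) v := ⟨_, rfl⟩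
  have h1 : HasDerivWithinAt (fun s => κ (χ s)) v' (Icc 0 1) t := by
    have hT := ((contDiffAt_transition hy hy').differentiableAt (by simp)).hasFDerivAt
    have := hT.comp_hasDerivWithinAt t hv
    rw [hD, ← hv'] at this
    refine this.congr_of_eventuallyEq ?_ ?_
    · filter_upwards [hc.eventually_mem (extChartAt_source_mem_nhds (I := J) (χ t))] with s hs
      exact congrArg κ (κt.left_inv hs).symm
    · exact congrArg κ hinv.symm
  -- Both vectors have the same `Ω`-pairing with every `Y`: the form `β` has the coefficients `Ω` in
  -- the chart at `χ t`, where the equation is given, and in the chart at `z₀`.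
  have h2 : v' = hamiltonVectorField J σ H z₀ (t, κ (χ t)) := by
    rw [← sub_eq_zero]
    refine hβ.nondegenerate _ fun Y => ?_
    rw [map_sub, sub_eq_zero, hamiltonVectorField_spec hσ hH ht hyκ,
      fderiv_hamiltonianInChart hH ht hyκ]
    have hκ : κ.symm (κ (χ t)) = χ t := κ.left_inv hz
    obtain ⟨Y', hY'⟩ : ∃ Y' : V, Y' = mfderiv 𝓘(ℝ, V) J κ.symm (κ (χ t)) Y := ⟨_, rfl⟩
    have hY : mfderiv J 𝓘(ℝ, V) κ (χ t) Y' = Y := by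
      have := mfderiv_extChartAt_mfderiv_symm hyκ Y
      rw [← hY', hκ] at this
      exact this
    have e1 := hβ.chart z₀ (χ t) hz Y' v
    have e2 := hβ.chart (χ t) (χ t) (mem_extChartAt_source _) Y' v
    rw [mfderiv_extChartAt_self] at e2
    rw [← hY', hκ]
    refine Eq.trans ?_ (hvY Y')
    rw [hv', ← hY]
    exact e1.symm.trans e2
  rw [← h2]
  exact h1

/-- Hamiltonian curves are smooth. -/
theorem IsHamiltonCurve.contMDiffOn [FiniteDimensional ℝ V] (hβ : IsDarboux J β Ω) (hσ : ∀ X Y, σ X Y = Ω Y X)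
    (hH : ContMDiffOn (J.prod 𝓘(ℝ, ℝ)) 𝓘(ℝ, ℝ) ∞ H (univ ×ˢ Icc (0 : ℝ) 1))
    (h : IsHamiltonCurve J Ω H χ) : ContMDiffOn 𝓘(ℝ, ℝ) J ∞ χ (Icc 0 1) := by
  intro t ht
  have := FiniteDimensional.complete ℝ V
  obtain ⟨a, b, hab, htab, hsub, hnhds, hp⟩ := exists_Icc_of_eventually ht
    ((h t ht).1.eventually_mem (extChartAt_source_mem_nhds (I := J) (χ t)))
  set κ := extChartAt J (χ t)
  have hsm : ContDiffOn ℝ ∞ (fun s => κ (χ s)) (Icc a b) :=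
    ODE.contDiffOn_enat_Icc_of_hasDerivWithinAt (n := ⊤)
      (f := fun s y => hamiltonVectorField J σ H (χ t) (s, y)) (u := κ.target)
      ((contDiffOn_hamiltonVectorField (σ := σ) hH (χ t)).mono (prod_mono hsub le_rfl))
      (fun s hs => (h.hasDerivWithinAt hβ hσ hH (hsub hs) (hp s hs)).mono hsub)
      (fun s hs => κ.map_source (hp s hs))
  have h2 : ContMDiffOn 𝓘(ℝ, ℝ) J ∞ (fun s => κ.symm (κ (χ s))) (Icc a b) :=
    (contMDiffOn_extChartAt_symm (χ t)).comp (contMDiffOn_iff_contDiffOn.2 hsm)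
      fun s hs => κ.map_source (hp s hs)
  have h3 : ContMDiffOn 𝓘(ℝ, ℝ) J ∞ χ (Icc a b) :=
    h2.congr fun s hs => (κ.left_inv (hp s hs)).symm
  exact (h3 t htab).mono_of_mem_nhdsWithin hnhds

/-- Hamiltonian curves in a Hausdorff manifold which agree at one time agree at all times. -/
theorem IsHamiltonCurve.eqOn [T2Space N] (hβ : IsDarboux J β Ω) (hσ : ∀ X Y, σ X Y = Ω Y X)
    (hH : ContMDiffOn (J.prod 𝓘(ℝ, ℝ)) 𝓘(ℝ, ℝ) ∞ H (univ ×ˢ Icc (0 : ℝ) 1))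
    (h : IsHamiltonCurve J Ω H χ) {χ' : ℝ → N} (h' : IsHamiltonCurve J Ω H χ') {t₀ : ℝ}
    (ht₀ : t₀ ∈ Icc (0 : ℝ) 1) (heq : χ t₀ = χ' t₀) : EqOn χ χ' (Icc 0 1) := by
  -- The set of agreement is closed because `N` is Hausdorff and open by local uniqueness in a
  -- chart; `[0, 1]` is connected.
  have hclopen : IsClopen {t : Icc (0 : ℝ) 1 | χ t = χ' t} := by
    refine ⟨isClosed_eq h.continuousOn.domRestrict h'.continuousOn.domRestrict, ?_⟩
    rw [isOpen_iff_mem_nhds]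
    rintro ⟨t, ht⟩ (hte : χ t = χ' t)
    have hs := (h t ht).1.eventually_mem (extChartAt_source_mem_nhds (I := J) (χ t))
    have hs' : ∀ᶠ s in 𝓝[Icc 0 1] t, χ' s ∈ (extChartAt J (χ t)).source := by
      refine (h' t ht).1.eventually_mem ?_
      rw [← hte]
      exact extChartAt_source_mem_nhds (χ t)
    have hev := eventually_eq_of_hasDerivWithinAt (isOpen_extChartAt_target (χ t))
      (contDiffOn_hamiltonVectorField (σ := σ) hH (χ t)) ht
      (c₁ := fun s => extChartAt J (χ t) (χ s)) (c₂ := fun s => extChartAt J (χ t) (χ' s))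
      (by filter_upwards [hs, self_mem_nhdsWithin] with s h1 h2
          exact h.hasDerivWithinAt hβ hσ hH h2 h1)
      (by filter_upwards [hs', self_mem_nhdsWithin] with s h1 h2
          exact h'.hasDerivWithinAt hβ hσ hH h2 h1)
      (mem_extChartAt_target _) (congrArg _ hte)
    refine mem_nhds_subtype_iff_nhdsWithin.2 ?_
    filter_upwards [hs, hs', hev, self_mem_nhdsWithin] with s h1 h2 h3 h4
    exact ⟨⟨s, h4⟩, (extChartAt J (χ t)).injOn h1 h2 h3, rfl⟩
  have huniv := hclopen.eq_univ ⟨⟨t₀, ht₀⟩, heq⟩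
  intro t ht
  have : (⟨t, ht⟩ : Icc (0 : ℝ) 1) ∈ {t : Icc (0 : ℝ) 1 | χ t = χ' t} := huniv ▸ mem_univ _
  exact this

end HamiltonCurves

/-! ### Smoothness and symplecticity of Hamiltonian flows -/

section LinearSymplectic

variable {V : Type*} [NormedAddCommGroup V] [NormedSpace ℝ V]

/-- The linearization of a Hamiltonian vector field is infinitesimally symplectic. -/
lemma infinitesimally_symplectic {Ω : V →L[ℝ] V →L[ℝ] ℝ} (hΩ : ∀ X Y, Ω X Y = -Ω Y X) {g : V → ℝ}
    {f : V → V} {y : V} {D : V →L[ℝ] V} (hg : ContDiffAt ℝ 2 g y) (hf : HasFDerivAt f D y)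
    (h : ∀ᶠ x in 𝓝 y, ∀ Y, Ω Y (f x) = fderiv ℝ g x Y) (X Y : V) :
    Ω (D X) Y + Ω X (D Y) = 0 := by
  have hsymm : fderiv ℝ (fderiv ℝ g) y X Y = fderiv ℝ (fderiv ℝ g) y Y X :=
    (hg.isSymmSndFDerivAt (by simp)) X Y
  have h2 : HasFDerivAt (fderiv ℝ g) (fderiv ℝ (fderiv ℝ g) y) y :=
    ((hg.fderiv_right (m := 1) (by norm_num)).differentiableAt (by norm_num)).hasFDerivAt
  -- Differentiating Hamilton's equations in the point: the linearized field is the Hessian of `g`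
  -- converted by `Ω`, and the Hessian is symmetric.
  have key : ∀ Y Z, Ω Y (D Z) = fderiv ℝ (fderiv ℝ g) y Z Y := by
    intro Y Z
    have h3 : HasFDerivAt (fun x => Ω Y (f x)) ((Ω Y).comp D) y := (Ω Y).hasFDerivAt.comp y hf
    have h4 : HasFDerivAt (fun x => fderiv ℝ g x Y)
        ((ContinuousLinearMap.apply ℝ ℝ Y).comp (fderiv ℝ (fderiv ℝ g) y)) y :=
      (ContinuousLinearMap.apply ℝ ℝ Y).hasFDerivAt.comp y h2
    exact DFunLike.congr_fun
      (h3.unique (h4.congr_of_eventuallyEq (h.mono fun x hx => hx Y))) Z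
  rw [hΩ (D X) Y, key, key, hsymm]
  ring

end LinearSymplectic

section ChartFlow

variable {V : Type u} [NormedAddCommGroup V] [NormedSpace ℝ V] [FiniteDimensional ℝ V]

/-- Families of solutions of Hamilton's equations in a chart preserve the symplectic form. -/
lemma symplectic_of_hasDerivWithinAt {Ω : V →L[ℝ] V →L[ℝ] ℝ} (hΩ : ∀ X Y, Ω X Y = -Ω Y X)
    {a b : ℝ} (hab : a < b) {U : Set V} (hU : IsOpen U) {f : ℝ × V → V}
    (hf : ContDiffOn ℝ ∞ f (Icc a b ×ˢ U)) {g : ℝ → V → ℝ}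
    (hg : ∀ t ∈ Icc a b, ContDiffOn ℝ ∞ (g t) U)
    (hfg : ∀ t ∈ Icc a b, ∀ x ∈ U, ∀ Y, Ω Y (f (t, x)) = fderiv ℝ (g t) x Y)
    {c : ℝ → V → V} {W : Set V} (hW : IsOpen W) (hcU : ∀ z ∈ W, ∀ t ∈ Icc a b, c t z ∈ U)
    (hc : ∀ z ∈ W, ∀ t ∈ Icc a b,
      HasDerivWithinAt (fun τ => c τ z) (f (t, c t z)) (Icc a b) t)
    (hca : DifferentiableOn ℝ (c a) W) {z : V} (hz : z ∈ W) (X Y : V) :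
    Ω (fderiv ℝ (c b) z X) (fderiv ℝ (c b) z Y) = Ω (fderiv ℝ (c a) z X) (fderiv ℝ (c a) z Y) := by
  -- By the variational equation the time derivative of the pulled-back form is `Ω (D X) Y + Ω X (D
  -- Y)` at the transported vectors, which vanishes.
  have hder : ∀ t ∈ Icc a b, HasDerivWithinAt
      (fun τ => Ω (fderiv ℝ (c τ) z X) (fderiv ℝ (c τ) z Y)) 0 (Icc a b) t := by
    intro t ht
    have hA := (hasDerivWithinAt_fderiv hab hU hf hW hcU hc hca hz ht).2
    have hx := hcU z hz t ht
    have h0 := infinitesimally_symplectic hΩ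
      (((hg t ht).contDiffAt (hU.mem_nhds hx)).of_le ENat.LEInfty.out)
      (hasFDerivAt_spaceDeriv hU hf ht hx)
      ((hU.eventually_mem hx).mono fun x hx' => hfg t ht x hx')
      (fderiv ℝ (c t) z X) (fderiv ℝ (c t) z Y)
    have hX := hA.clm_apply (hasDerivWithinAt_const t (Icc a b) X)
    have hY := hA.clm_apply (hasDerivWithinAt_const t (Icc a b) Y)
    have h1 := (Ω.hasFDerivAt.comp_hasDerivWithinAt t hX).clm_apply hY
    refine h1.congr_deriv ?_
    simpa using h0
  have := (convex_Icc a b).norm_image_sub_le_of_norm_hasDerivWithin_le (C := 0) hder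
    (fun t _ => by simp) (left_mem_Icc.2 hab.le) (right_mem_Icc.2 hab.le)
  rw [zero_mul] at this
  exact sub_eq_zero.1 (norm_le_zero_iff.1 this)

end ChartFlow

section ManifoldFlow

variable {V : Type u} [NormedAddCommGroup V] [NormedSpace ℝ V] [FiniteDimensional ℝ V]
  {G : Type*} [TopologicalSpace G] {J : ModelWithCorners ℝ V G} [J.Boundaryless]
  {N : Type*} [TopologicalSpace N] [ChartedSpace G N] [IsManifold J ∞ N] [T2Space N]
  {β : ∀ z : N, TangentSpace J z → TangentSpace J z → ℝ} {Ω : V →L[ℝ] V →L[ℝ] ℝ}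
  {σ : V ≃L[ℝ] (V →L[ℝ] ℝ)} {H : N × ℝ → ℝ}

/-- A Hamiltonian curve starting close to the centre of a chart stays in the chart for some time. -/
lemma IsHamiltonCurve.mem_source_of_close (hβ : IsDarboux J β Ω) (hσ : ∀ X Y, σ X Y = Ω Y X)
    (hH : ContMDiffOn (J.prod 𝓘(ℝ, ℝ)) 𝓘(ℝ, ℝ) ∞ H (univ ×ˢ Icc (0 : ℝ) 1)) {z₀ : N} {x₀ : V}
    {R L : ℝ} (hball : Metric.closedBall x₀ (2 * R) ⊆ (extChartAt J z₀).target)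
    (hL : ∀ s ∈ Icc (0 : ℝ) 1, ∀ y ∈ Metric.closedBall x₀ (2 * R),
      ‖hamiltonVectorField J σ H z₀ (s, y)‖ ≤ L)
    {χ : ℝ → N} (h : IsHamiltonCurve J Ω H χ) {s t : ℝ} (hs : s ∈ Icc (0 : ℝ) 1)
    (ht : t ∈ Icc (0 : ℝ) 1) (hsrc : χ s ∈ (extChartAt J z₀).source)
    (hclose : ‖extChartAt J z₀ (χ s) - x₀‖ ≤ R) (hsmall : L * (t - s) < R) :
    ∀ τ ∈ Icc s t, χ τ ∈ (extChartAt J z₀).source := by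
  intro τ hτ
  set κ := extChartAt J z₀
  have hst : s ≤ t := hτ.1.trans hτ.2
  have hR : 0 ≤ R := (norm_nonneg _).trans hclose
  have hI : Icc s t ⊆ Icc 0 1 := Icc_subset_Icc hs.1 ht.2
  have hL0 : 0 ≤ L := (norm_nonneg _).trans
    (hL s hs x₀ (Metric.mem_closedBall_self (by positivity)))
  -- The compact coordinate ball is closed in the Hausdorff manifold `N`, so a curve cannot leave
  -- the chart without its coordinates first leaving the ball.
  have hK : IsClosed (κ.symm '' Metric.closedBall x₀ (2 * R)) :=
    ((isCompact_closedBall x₀ (2 * R)).image_of_continuousOn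
      ((continuousOn_extChartAt_symm z₀).mono hball)).isClosed
  have hKmem : ∀ z ∈ κ.symm '' Metric.closedBall x₀ (2 * R),
      z ∈ κ.source ∧ κ z ∈ Metric.closedBall x₀ (2 * R) := by
    rintro _ ⟨y, hy, rfl⟩
    exact ⟨κ.map_target (hball hy), by rwa [κ.right_inv (hball hy)]⟩
  have hKmem' : ∀ z ∈ κ.source, κ z ∈ Metric.closedBall x₀ (2 * R) →
      z ∈ κ.symm '' Metric.closedBall x₀ (2 * R) := fun z hz hz' => ⟨κ z, hz', κ.left_inv hz⟩
  have hsub : Icc s t ⊆ χ ⁻¹' (κ.symm '' Metric.closedBall x₀ (2 * R)) := by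
    refine Icc_subset_of_continuation ?_ ?_ ?_
    · rw [inter_comm]
      exact (h.continuousOn.mono hI).preimage_isClosed_of_isClosed isClosed_Icc hK
    · refine hKmem' _ hsrc ?_
      rw [Metric.mem_closedBall, dist_eq_norm]
      linarith
    · intro x hx hxs
      have hxI : x ∈ Icc (0 : ℝ) 1 := hI (Ico_subset_Icc_self hx)
      have hxI' : Icc s x ⊆ Icc 0 1 := (Icc_subset_Icc_right hx.2.le).trans hI
      -- While in the ball the curve has speed at most `L`. It starts within `R` of the centre and
      -- travels less than `R`, so it stays strictly inside radius `2 * R` and can be continued.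
      have hv := (convex_Icc s x).norm_image_sub_le_of_norm_hasDerivWithin_le
        (f := fun r => κ (χ r)) (C := L)
        (fun r hr => (h.hasDerivWithinAt hβ hσ hH (hxI' hr) (hKmem _ (hxs hr)).1).mono hxI')
        (fun r hr => hL r (hxI' hr) _ (hKmem _ (hxs hr)).2)
        (left_mem_Icc.2 hx.1) (right_mem_Icc.2 hx.1)
      have hx1 : χ x ∈ κ.source := (hKmem _ (hxs (right_mem_Icc.2 hx.1))).1
      have hx2 : κ (χ x) ∈ Metric.ball x₀ (2 * R) := by
        rw [Metric.mem_ball, dist_eq_norm]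
        rw [Real.norm_of_nonneg (sub_nonneg.2 hx.1)] at hv
        have h1 : L * (x - s) ≤ L * (t - s) :=
          mul_le_mul_of_nonneg_left (by linarith [hx.2]) hL0
        have e : κ (χ x) - x₀ = (κ (χ x) - κ (χ s)) + (κ (χ s) - x₀) := by abel
        rw [e]
        refine (norm_add_le _ _).trans_lt ?_
        linarith
      have hev : ∀ᶠ r in 𝓝[Icc 0 1] x, χ r ∈ κ.symm '' Metric.closedBall x₀ (2 * R) := by
        have hopen : IsOpen (κ.source ∩ κ ⁻¹' Metric.ball x₀ (2 * R)) :=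
          (continuousOn_extChartAt z₀).isOpen_inter_preimage (isOpen_extChartAt_source z₀)
            Metric.isOpen_ball
        filter_upwards [(h x hxI).1.eventually_mem (hopen.mem_nhds ⟨hx1, hx2⟩)] with r hr
        exact hKmem' _ hr.1 (Metric.ball_subset_closedBall hr.2)
      have hle : 𝓝[>] x ≤ 𝓝[Icc 0 1] x := by
        rw [← nhdsWithin_Ioo_eq_nhdsGT (hx.2.trans_le ht.2)]
        exact nhdsWithin_mono x (Ioo_subset_Icc_self.trans (Icc_subset_Icc_left hxI.1))
      exact hle hev
  exact (hKmem _ (hsub hτ)).1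

/-- The map `f` is smooth and preserves the form `β` near `z`. -/
def IsSymplecticNear (J : ModelWithCorners ℝ V G)
    (β : ∀ z : N, TangentSpace J z → TangentSpace J z → ℝ) (f : N → N) (z₀ : N) : Prop :=
  ∃ W : Set N, IsOpen W ∧ z₀ ∈ W ∧ ContMDiffOn J J ∞ f W ∧ ∀ z ∈ W, ∀ X Y : TangentSpace J z,
    β (f z) (mfderiv J J f z X) (mfderiv J J f z Y) = β z X Y

omit [FiniteDimensional ℝ V] [T2Space N] in
/-- The form at the image point, expressed by a coordinate representation of the map. -/
lemma IsDarboux.apply_mfderiv (hβ : IsDarboux J β Ω) {f : N → N} {z₀ z₁ z : N}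
    (hz : z ∈ (extChartAt J z₀).source) (hfz : f z ∈ (extChartAt J z₁).source)
    (hf : MDifferentiableAt J J f z) (X Y : TangentSpace J z) :
    β (f z) (mfderiv J J f z X) (mfderiv J J f z Y) =
      Ω (fderiv ℝ (fun y => extChartAt J z₁ (f ((extChartAt J z₀).symm y))) (extChartAt J z₀ z)
          (mfderiv J 𝓘(ℝ, V) (extChartAt J z₀) z X))
        (fderiv ℝ (fun y => extChartAt J z₁ (f ((extChartAt J z₀).symm y))) (extChartAt J z₀ z)
          (mfderiv J 𝓘(ℝ, V) (extChartAt J z₀) z Y)) := by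
  rw [hβ.chart z₁ (f z) hfz]
  set κ₀ := extChartAt J z₀
  set κ₁ := extChartAt J z₁
  have hinv : κ₀.symm (κ₀ z) = z := κ₀.left_inv hz
  have h1 : MDifferentiableAt J 𝓘(ℝ, V) (κ₁ ∘ f) (κ₀.symm (κ₀ z)) := by
    rw [hinv]
    exact (mdifferentiableAt_extChartAt_of_mem hfz).comp z hf
  have h2 := mfderiv_comp (κ₀ z) h1 (mdifferentiableAt_symm_extChartAt (κ₀.map_source hz))
  rw [mfderiv_eq_fderiv, hinv,
    mfderiv_comp z (mdifferentiableAt_extChartAt_of_mem hfz) hf] at h2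
  have key : ∀ X : TangentSpace J z, mfderiv J 𝓘(ℝ, V) κ₁ (f z) (mfderiv J J f z X) =
      fderiv ℝ (fun y => κ₁ (f (κ₀.symm y))) (κ₀ z) (mfderiv J 𝓘(ℝ, V) κ₀ z X) := by
    intro X
    have h3 := DFunLike.congr_fun h2 (mfderiv J 𝓘(ℝ, V) κ₀ z X)
    have h4 := mfderiv_symm_mfderiv_extChartAt hz X
    refine Eq.trans ?_ h3.symm
    exact congrArg (fun X => mfderiv J 𝓘(ℝ, V) κ₁ (f z) (mfderiv J J f z X)) h4.symm
  rw [key, key]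

variable {φ : ℝ → N → N}

/-- Locally in time, the flow stays smooth and symplectic. -/
lemma exists_forall_isSymplecticNear (hβ : IsDarboux J β Ω) (hσ : ∀ X Y, σ X Y = Ω Y X)
    (hH : ContMDiffOn (J.prod 𝓘(ℝ, ℝ)) 𝓘(ℝ, ℝ) ∞ H (univ ×ˢ Icc (0 : ℝ) 1))
    (hφ : ∀ z, IsHamiltonCurve J Ω H (fun t => φ t z)) (z₀ : N) {t₀ : ℝ}
    (ht₀ : t₀ ∈ Icc (0 : ℝ) 1) :
    ∃ δ > 0, ∀ s ∈ Icc (0 : ℝ) 1, ∀ t ∈ Icc (0 : ℝ) 1, s ≤ t → |s - t₀| < δ → |t - t₀| < δ →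
      IsSymplecticNear J β (φ s) z₀ → IsSymplecticNear J β (φ t) z₀ := by
  set κ := extChartAt J (φ t₀ z₀) with hκ
  set κ₀ := extChartAt J z₀ with hκ₀
  set x₀ := κ (φ t₀ z₀)
  have hU : IsOpen κ.target := isOpen_extChartAt_target _
  have hX := contDiffOn_hamiltonVectorField (σ := σ) hH (φ t₀ z₀)
  obtain ⟨R₁, hR₁, hR₁U⟩ := Metric.nhds_basis_closedBall.mem_iff.1
    (hU.mem_nhds (mem_extChartAt_target (I := J) (φ t₀ z₀)))
  set R := R₁ / 2
  have hR : 0 < R := by positivity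
  have hRU : Metric.closedBall x₀ (2 * R) ⊆ κ.target := by
    rwa [show 2 * R = R₁ by ring]
  obtain ⟨L, hL⟩ := (isCompact_Icc.prod (isCompact_closedBall x₀ (2 * R))).exists_bound_of_continuousOn
    (hX.continuousOn.mono (prod_mono le_rfl hRU))
  have hL0 : 0 ≤ L := (norm_nonneg _).trans
    (hL (t₀, x₀) ⟨ht₀, Metric.mem_closedBall_self (by positivity)⟩)
  have hOopen : IsOpen (κ.source ∩ κ ⁻¹' Metric.ball x₀ R) :=
    (continuousOn_extChartAt _).isOpen_inter_preimage (isOpen_extChartAt_source _)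
      Metric.isOpen_ball
  set O := κ.source ∩ κ ⁻¹' Metric.ball x₀ R
  have hO₀ : φ t₀ z₀ ∈ O := ⟨mem_extChartAt_source _, Metric.mem_ball_self hR⟩
  obtain ⟨δ₁, hδ₁, hδO⟩ := Metric.mem_nhdsWithin_iff.1
    ((hφ z₀ t₀ ht₀).1.eventually_mem (hOopen.mem_nhds hO₀))
  -- The first bound places the point at time `s` in the half-size ball; the second gives `L * (t -
  -- s) < R`, with `L + 1` in the denominator to allow `L = 0`.
  refine ⟨min δ₁ (R / (2 * (L + 1))), by positivity, ?_⟩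
  rintro s hs t ht hst hsδ htδ ⟨W, hW, hzW, hsm, hsymp⟩
  rcases hst.eq_or_lt with rfl | hlt
  · exact ⟨W, hW, hzW, hsm, hsymp⟩
  have hI : Icc s t ⊆ Icc 0 1 := Icc_subset_Icc hs.1 ht.2
  have hsmall : L * (t - s) < R := by
    have h1 := abs_lt.1 (hsδ.trans_le (min_le_right _ _))
    have h2 := abs_lt.1 (htδ.trans_le (min_le_right _ _))
    have h3 : t - s < 2 * (R / (2 * (L + 1))) := by linarith
    have h4 : 2 * (R / (2 * (L + 1))) = R / (L + 1) := by field_simp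
    rw [h4, lt_div_iff₀ (by positivity)] at h3
    nlinarith
  have hsO : φ s z₀ ∈ O :=
    hδO ⟨by rw [Metric.mem_ball, Real.dist_eq]; exact hsδ.trans_le (min_le_left _ _), hs⟩
  -- a neighbourhood of `z₀` whose points stay in the chart `κ`
  set W' : Set N := κ₀.source ∩ (W ∩ φ s ⁻¹' O)
  have hW' : IsOpen W' := (isOpen_extChartAt_source z₀).inter
    (hsm.continuousOn.isOpen_inter_preimage hW hOopen)
  have hzW' : z₀ ∈ W' := ⟨mem_extChartAt_source z₀, hzW, hsO⟩
  have hstay : ∀ z ∈ W', ∀ τ ∈ Icc s t, φ τ z ∈ κ.source := fun z hz =>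
    (hφ z).mem_source_of_close hβ hσ hH hRU (fun r hr y hy => hL (r, y) ⟨hr, hy⟩) hs ht hz.2.2.1
      (dist_eq_norm (κ (φ s z)) x₀ ▸ (Metric.mem_ball.1 hz.2.2.2).le) hsmall
  set Ŵ : Set V := κ₀.target ∩ κ₀.symm ⁻¹' W'
  have hŴ : IsOpen Ŵ := (continuousOn_extChartAt_symm z₀).isOpen_inter_preimage
    (isOpen_extChartAt_target z₀) hW'
  have hmemŴ : ∀ z ∈ W', κ₀ z ∈ Ŵ := fun z hz =>
    ⟨κ₀.map_source hz.1, by rw [mem_preimage, κ₀.left_inv hz.1]; exact hz⟩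
  set c : ℝ → V → V := fun τ y => κ (φ τ (κ₀.symm y))
  have hcU : ∀ y ∈ Ŵ, ∀ τ ∈ Icc s t, c τ y ∈ κ.target := fun y hy τ hτ =>
    κ.map_source (hstay _ hy.2 τ hτ)
  have hc : ∀ y ∈ Ŵ, ∀ τ ∈ Icc s t, HasDerivWithinAt (fun r => c r y)
      (hamiltonVectorField J σ H (φ t₀ z₀) (τ, c τ y)) (Icc s t) τ := fun y hy τ hτ =>
    ((hφ (κ₀.symm y)).hasDerivWithinAt hβ hσ hH (hI hτ) (hstay _ hy.2 τ hτ)).mono hI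
  -- The family starts at time `s` from `φ s` in coordinates, not from the identity; smoothness
  -- there is the hypothesis on `φ s`.
  have hcs : ContDiffOn ℝ ∞ (c s) Ŵ := by
    rw [← contMDiffOn_iff_contDiffOn]
    have h1 : ContMDiffOn 𝓘(ℝ, V) J ∞ (fun y => φ s (κ₀.symm y)) Ŵ :=
      hsm.comp ((contMDiffOn_extChartAt_symm z₀).mono inter_subset_left) fun y hy => hy.2.2.1
    exact (contMDiffOn_extChartAt (x := φ t₀ z₀)).comp h1 fun y hy => by
      have := hstay _ hy.2 s (left_mem_Icc.2 hst)
      rwa [hκ, extChartAt_source] at this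
  have hXI := hX.mono (prod_mono hI (le_refl κ.target))
  have hct : ContDiffOn ℝ ∞ (c t) Ŵ :=
    contDiffOn_of_hasDerivWithinAt hlt hU hXI hŴ hcU hc hcs (right_mem_Icc.2 hst)
  have hφt : ContMDiffOn J J ∞ (φ t) W' := by
    have h1 : ContMDiffOn J 𝓘(ℝ, V) ∞ (fun z => c t (κ₀ z)) W' :=
      (contMDiffOn_iff_contDiffOn.2 hct).comp
        ((contMDiffOn_extChartAt (x := z₀)).mono fun z hz => by
          have := hz.1
          rwa [hκ₀, extChartAt_source] at this) hmemŴ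
    have h2 : ContMDiffOn J J ∞ (fun z => κ.symm (c t (κ₀ z))) W' :=
      (contMDiffOn_extChartAt_symm (φ t₀ z₀)).comp h1 fun z hz =>
        hcU _ (hmemŴ z hz) t (right_mem_Icc.2 hst)
    refine h2.congr fun z hz => ?_
    simp only [c, κ₀.left_inv hz.1]
    exact (κ.left_inv (hstay z hz t (right_mem_Icc.2 hst))).symm
  refine ⟨W', hW', hzW', hφt, fun z hz X Y => ?_⟩
  have hdt : MDifferentiableAt J J (φ t) z :=
    (hφt.contMDiffAt (hW'.mem_nhds hz)).mdifferentiableAt (by simp)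
  have hds : MDifferentiableAt J J (φ s) z :=
    (hsm.contMDiffAt (hW.mem_nhds hz.2.1)).mdifferentiableAt (by simp)
  -- With the same pair of charts at times `s` and `t`, the claim becomes constancy of the
  -- pulled-back constant form between the two times.
  rw [← hsymp z hz.2.1 X Y,
    hβ.apply_mfderiv (z₁ := φ t₀ z₀) hz.1 (hstay z hz t (right_mem_Icc.2 hst)) hdt,
    hβ.apply_mfderiv (z₁ := φ t₀ z₀) hz.1 (hstay z hz s (left_mem_Icc.2 hst)) hds]
  refine symplectic_of_hasDerivWithinAt hβ.swap hlt hU hXI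
    (g := fun τ x => hamiltonianInChart J H (φ t₀ z₀) (τ, x)) (fun τ hτ => ?_)
    (fun τ hτ x hx Y => hamiltonVectorField_spec hσ hH (hI hτ) hx Y) hŴ hcU hc
    (hcs.differentiableOn (by simp)) (hmemŴ z hz) _ _
  exact (contDiffOn_hamiltonianInChart hH (φ t₀ z₀)).comp
    (contDiff_prodMk_right τ).contDiffOn fun x hx => ⟨hI hτ, hx⟩

/-- The time-one map of a Hamiltonian flow is smooth and symplectic. -/
theorem isSymplecticNear_flow (hβ : IsDarboux J β Ω)
    (hH : ContMDiffOn (J.prod 𝓘(ℝ, ℝ)) 𝓘(ℝ, ℝ) ∞ H (univ ×ˢ Icc (0 : ℝ) 1))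
    (hφ₀ : ∀ z, φ 0 z = z) (hφ : ∀ z, IsHamiltonCurve J Ω H (fun t => φ t z)) (z₀ : N) :
    IsSymplecticNear J β (φ 1) z₀ := by
  obtain ⟨σ, hσ⟩ := exists_dualEquiv hβ.nondegenerate
  choose! δ hδ hstep using fun (t₀ : ℝ) (ht₀ : t₀ ∈ Icc (0 : ℝ) 1) =>
    exists_forall_isSymplecticNear hβ hσ hH hφ z₀ ht₀
  -- A partition of `[0, 1]` subordinate to the local time intervals. The neighbourhood of `z₀` may
  -- shrink at each step, but `t m = 1` is reached after finitely many.
  obtain ⟨t, ht0, hmono, ⟨m, hm⟩, hcover⟩ := exists_monotone_Icc_subset_open_cover_Icc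
    (zero_le_one (α := ℝ)) (c := fun i : Icc (0 : ℝ) 1 => {s : Icc (0 : ℝ) 1 | |(s : ℝ) - i| < δ i})
    (fun i => isOpen_lt (by fun_prop) (by fun_prop))
    fun s _ => mem_iUnion.2 ⟨s, by simpa using hδ s s.2⟩
  have key : ∀ n, IsSymplecticNear J β (φ (t n)) z₀ := by
    intro n
    induction n with
    | zero =>
      rw [ht0]
      have : φ 0 = id := funext hφ₀
      rw [this]
      refine ⟨univ, isOpen_univ, mem_univ _, contMDiff_id.contMDiffOn, fun z _ X Y => ?_⟩
      rw [mfderiv_id]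
      rfl
    | succ n ih =>
      obtain ⟨i, hi⟩ := hcover n
      exact hstep i i.2 (t n) (t n).2 (t (n + 1)) (t (n + 1)).2 (hmono n.le_succ)
        (hi (left_mem_Icc.2 (hmono n.le_succ))) (hi (right_mem_Icc.2 (hmono n.le_succ))) ih
  have := key m
  rwa [hm m le_rfl] at this

end ManifoldFlow

/-! ### The Euler-Lagrange form of a Hamiltonian system -/

section EulerLagrange

variable {V : Type*} [NormedAddCommGroup V] [NormedSpace ℝ V]
  {G : Type*} [TopologicalSpace G] {J : ModelWithCorners ℝ V G} [J.Boundaryless]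
  {N : Type*} [TopologicalSpace N] [ChartedSpace G N] [IsManifold J ∞ N]
  {β : ∀ z : N, TangentSpace J z → TangentSpace J z → ℝ} {Ω : V →L[ℝ] V →L[ℝ] ℝ}
  {H : N × ℝ → ℝ} {χ : ℝ → N}

/-- The velocity at time `t` of a curve on `[0, 1]`. -/
def velocity (J : ModelWithCorners ℝ V G) (χ : ℝ → N) (t : ℝ) : TangentSpace J (χ t) :=
  mfderivWithin 𝓘(ℝ, ℝ) J χ (Icc 0 1) t (1 : ℝ)

/-- The integrand `β(U, χ') - dH(U)` of the Euler-Lagrange form. -/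
def eulerLagrangeDensity (β : ∀ z : N, TangentSpace J z → TangentSpace J z → ℝ) (H : N × ℝ → ℝ)
    (χ : ℝ → N) (U : ∀ t : ℝ, TangentSpace J (χ t)) (t : ℝ) : ℝ :=
  β (χ t) (U t) (velocity J χ t) - spaceDifferential J H t (χ t) (U t)

omit [J.Boundaryless] in
lemma hasDerivWithinAt_extChartAt_comp (hχ : ContMDiffOn 𝓘(ℝ, ℝ) J ∞ χ (Icc 0 1)) {z₀ : N} {t : ℝ}
    (ht : t ∈ Icc (0 : ℝ) 1) (hz : χ t ∈ (extChartAt J z₀).source) :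
    HasDerivWithinAt (fun s => extChartAt J z₀ (χ s))
      (mfderiv J 𝓘(ℝ, V) (extChartAt J z₀) (χ t) (velocity J χ t) : V) (Icc 0 1) t := by
  have h1 : HasMFDerivWithinAt 𝓘(ℝ, ℝ) J χ (Icc 0 1) t
      (mfderivWithin 𝓘(ℝ, ℝ) J χ (Icc 0 1) t) :=
    ((hχ t ht).mdifferentiableWithinAt (by simp)).hasMFDerivWithinAt
  have h2 : MDifferentiableAt J 𝓘(ℝ, V) (extChartAt J z₀) (χ t) :=
    mdifferentiableAt_extChartAt (by rwa [extChartAt_source] at hz)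
  obtain ⟨L, hL⟩ : ∃ L : ℝ →L[ℝ] V, L = (mfderiv J 𝓘(ℝ, V) (extChartAt J z₀) (χ t)).comp
    (mfderivWithin 𝓘(ℝ, ℝ) J χ (Icc 0 1) t) := ⟨_, rfl⟩
  have h3 : HasFDerivWithinAt (fun s => extChartAt J z₀ (χ s)) L (Icc 0 1) t := by
    rw [hL]
    exact hasMFDerivWithinAt_iff_hasFDerivWithinAt.1
      (h2.hasMFDerivAt.comp_hasMFDerivWithinAt t h1)
  exact h3.hasDerivWithinAt.congr_deriv (congrArg (fun A : ℝ →L[ℝ] V => A 1) hL)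

omit [J.Boundaryless] in
lemma hasDerivWithinAt_velocity (hχ : ContMDiffOn 𝓘(ℝ, ℝ) J ∞ χ (Icc 0 1)) {t : ℝ}
    (ht : t ∈ Icc (0 : ℝ) 1) :
    HasDerivWithinAt (fun s => extChartAt J (χ t) (χ s)) (velocity J χ t : V) (Icc 0 1) t := by
  have := hasDerivWithinAt_extChartAt_comp hχ ht (mem_extChartAt_source (I := J) (χ t))
  rwa [mfderiv_extChartAt_self] at this

omit [J.Boundaryless] in
lemma IsDarboux.apply_self (hβ : IsDarboux J β Ω) (z : N) (X Y : V) : β z X Y = Ω X Y := by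
  have := hβ.chart z z (mem_extChartAt_source z) X Y
  rw [mfderiv_extChartAt_self] at this
  exact this

omit [J.Boundaryless] in
/-- Along a Hamiltonian curve the integrand of the Euler-Lagrange form vanishes. -/
lemma IsHamiltonCurve.eulerLagrangeDensity_eq_zero (hβ : IsDarboux J β Ω)
    (hχ : ContMDiffOn 𝓘(ℝ, ℝ) J ∞ χ (Icc 0 1)) (h : IsHamiltonCurve J Ω H χ)
    (U : ∀ t : ℝ, TangentSpace J (χ t)) {t : ℝ} (ht : t ∈ Icc (0 : ℝ) 1) :
    eulerLagrangeDensity β H χ U t = 0 := by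
  obtain ⟨_, v, hv, hvY⟩ := h t ht
  obtain ⟨w, hw⟩ : ∃ w : V, w = velocity J χ t := ⟨_, rfl⟩
  have hv' : w = v := by
    have h1 := hasDerivWithinAt_velocity hχ ht
    rw [← hw] at h1
    exact (uniqueDiffOn_Icc zero_lt_one t ht).eq_deriv _ h1 hv
  refine sub_eq_zero.2 ((hβ.apply_self (χ t) (U t) (velocity J χ t)).trans ?_)
  refine Eq.trans ?_ (hvY (U t))
  rw [← hv', hw]

/-- The density in a chart, for the variation which is constant in the chart. -/
lemma eulerLagrangeDensity_const_in_chart (hβ : IsDarboux J β Ω)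
    (hH : ContMDiffOn (J.prod 𝓘(ℝ, ℝ)) 𝓘(ℝ, ℝ) ∞ H (univ ×ˢ Icc (0 : ℝ) 1))
    {z₀ : N} {t : ℝ} (ht : t ∈ Icc (0 : ℝ) 1) (hz : χ t ∈ (extChartAt J z₀).source)
    {U : ∀ t : ℝ, TangentSpace J (χ t)} {Y : V} {r : ℝ}
    (hU : U t = r • (mfderiv 𝓘(ℝ, V) J (extChartAt J z₀).symm (extChartAt J z₀ (χ t)) Y : V)) :
    eulerLagrangeDensity β H χ U t = r *
      (Ω Y (mfderiv J 𝓘(ℝ, V) (extChartAt J z₀) (χ t) (velocity J χ t)) -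
        spaceDeriv (hamiltonianInChart J H z₀) (Icc 0 1) (extChartAt J z₀).target
          (t, extChartAt J z₀ (χ t)) Y) := by
  set κ := extChartAt J z₀
  have hκ : κ.symm (κ (χ t)) = χ t := κ.left_inv hz
  have hκt : κ (χ t) ∈ κ.target := κ.map_source hz
  obtain ⟨Y', hY'⟩ : ∃ Y' : V, Y' = mfderiv 𝓘(ℝ, V) J κ.symm (κ (χ t)) Y := ⟨_, rfl⟩
  have hY : mfderiv J 𝓘(ℝ, V) κ (χ t) Y' = Y := by
    have := mfderiv_extChartAt_mfderiv_symm hκt Y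
    rw [← hY', hκ] at this
    exact this
  rw [(hasFDerivAt_spaceDeriv (isOpen_extChartAt_target z₀) (contDiffOn_hamiltonianInChart hH z₀)
    ht hκt).fderiv.symm, fderiv_hamiltonianInChart hH ht hκt, ← hY', hκ]
  rw [← hY'] at hU
  have e1 : β (χ t) (U t) (velocity J χ t) =
      r * Ω Y (mfderiv J 𝓘(ℝ, V) κ (χ t) (velocity J χ t)) := by
    rw [hβ.chart z₀ (χ t) hz, hU]
    have : mfderiv J 𝓘(ℝ, V) κ (χ t) (r • Y') = r • Y :=
      ((mfderiv J 𝓘(ℝ, V) κ (χ t)).map_smul r Y').trans (congrArg _ hY)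
    refine (congrArg (fun Z : V => Ω Z _) this).trans ?_
    rw [map_smul]
    rfl
  have e2 : spaceDifferential J H t (χ t) (U t) = r * spaceDifferential J H t (χ t) Y' := by
    rw [hU]
    exact (spaceDifferential J H t (χ t)).map_smul r Y'
  rw [eulerLagrangeDensity, e1, e2, mul_sub]

/-- Zeros of the Euler-Lagrange form are Hamiltonian curves. -/
theorem isHamiltonCurve_of_eulerLagrange (hβ : IsDarboux J β Ω)
    (hH : ContMDiffOn (J.prod 𝓘(ℝ, ℝ)) 𝓘(ℝ, ℝ) ∞ H (univ ×ˢ Icc (0 : ℝ) 1))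
    (hχ : ContMDiffOn 𝓘(ℝ, ℝ) J ∞ χ (Icc 0 1))
    (hEL : ∀ U : ∀ t : ℝ, TangentSpace J (χ t),
      ContMDiffOn 𝓘(ℝ, ℝ) J.tangent ∞ (fun t => (⟨χ t, U t⟩ : TangentBundle J N)) (Icc 0 1) →
      ∫ t in (0 : ℝ)..1, eulerLagrangeDensity β H χ U t = 0) :
    IsHamiltonCurve J Ω H χ := by
  intro t₀ ht₀
  refine ⟨(hχ t₀ ht₀).continuousWithinAt, velocity J χ t₀, hasDerivWithinAt_velocity hχ ht₀, ?_⟩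
  -- Fundamental lemma of the calculus of variations: a failure at `t₀` in some direction gives a
  -- variation supported near `t₀` whose density is nonnegative and positive at `t₀`.
  by_contra! hne
  obtain ⟨Y₀, hY₀⟩ : ∃ Y₀ : V,
      0 < Ω Y₀ (velocity J χ t₀) - spaceDifferential J H t₀ (χ t₀) Y₀ := by
    obtain ⟨Y, hY⟩ := hne
    rcases lt_or_gt_of_ne (sub_ne_zero.2 hY) with h | h
    · refine ⟨-Y, ?_⟩
      have e1 : Ω (-Y) (velocity J χ t₀) = -Ω Y (velocity J χ t₀) := by rw [map_neg]; rfl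
      have e2 : spaceDifferential J H t₀ (χ t₀) (-Y) = -spaceDifferential J H t₀ (χ t₀) Y :=
        (spaceDifferential J H t₀ (χ t₀)).map_neg Y
      refine lt_of_lt_of_eq (neg_pos.2 h) ?_
      rw [e1]
      refine Eq.trans ?_ (congrArg (fun a : ℝ => -Ω Y (velocity J χ t₀) - a) e2.symm)
      ring
    · exact ⟨Y, h⟩
  set κ := extChartAt J (χ t₀) with hκ
  obtain ⟨a, b, hab, htab, hsub, hnhds, hsrc⟩ := exists_Icc_of_eventually ht₀
    ((hχ t₀ ht₀).continuousWithinAt.eventually_mem (extChartAt_source_mem_nhds (I := J) (χ t₀)))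
  -- the density in the chart of the variation `Y₀`
  set g : ℝ → ℝ := fun s => Ω Y₀ (derivWithin (fun s => κ (χ s)) (Icc a b) s) -
    spaceDeriv (hamiltonianInChart J H (χ t₀)) (Icc 0 1) κ.target (s, κ (χ s)) Y₀ with hg
  have hder : ∀ s ∈ Icc a b, derivWithin (fun s => κ (χ s)) (Icc a b) s =
      mfderiv J 𝓘(ℝ, V) κ (χ s) (velocity J χ s) := fun s hs =>
    ((hasDerivWithinAt_extChartAt_comp hχ (hsub hs) (hsrc s hs)).mono hsub).derivWithin
      (uniqueDiffOn_Icc hab s hs)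
  have hκχ : ContDiffOn ℝ ∞ (fun s => κ (χ s)) (Icc a b) := by
    rw [← contMDiffOn_iff_contDiffOn]
    exact (contMDiffOn_extChartAt (x := χ t₀)).comp (hχ.mono hsub) fun s hs => by
      have := hsrc s hs
      rw [extChartAt_source] at this
      exact this
  have hgc : ContinuousOn g (Icc a b) := by
    refine ((Ω Y₀).continuous.comp_continuousOn
      (hκχ.continuousOn_derivWithin (uniqueDiffOn_Icc hab) (by simp))).sub ?_
    refine ContinuousOn.clm_apply ?_ continuousOn_const
    exact (contDiffOn_spaceDeriv (uniqueDiffOn_Icc zero_lt_one) (isOpen_extChartAt_target (χ t₀))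
      (contDiffOn_hamiltonianInChart hH (χ t₀))).continuousOn.comp
      (continuousOn_id.prodMk hκχ.continuousOn) fun s hs => ⟨hsub hs, κ.map_source (hsrc s hs)⟩
  have hg0 : 0 < g t₀ := by
    have e2 : spaceDeriv (hamiltonianInChart J H (χ t₀)) (Icc 0 1) κ.target (t₀, κ (χ t₀)) Y₀ =
        spaceDifferential J H t₀ (χ t₀) Y₀ := by
      rw [(hasFDerivAt_spaceDeriv (isOpen_extChartAt_target (χ t₀))
        (contDiffOn_hamiltonianInChart hH (χ t₀)) ht₀ (mem_extChartAt_target _)).fderiv.symm]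
      exact fderiv_hamiltonianInChart_self hH ht₀ Y₀
    have e1 : derivWithin (fun s => κ (χ s)) (Icc a b) t₀ = velocity J χ t₀ :=
      ((hasDerivWithinAt_velocity hχ ht₀).mono hsub).derivWithin (uniqueDiffOn_Icc hab t₀ htab)
    rw [hg]
    simp only
    rw [e1, e2]
    exact hY₀
  have hmono : ∀ s, Icc a b ∈ 𝓝[Icc 0 1] s → 𝓝[Icc 0 1] s ≤ 𝓝[Icc a b] s := fun s hs =>
    nhdsWithin_le_iff.2 hs
  have hpos : ∀ᶠ s in 𝓝[Icc 0 1] t₀, s ∈ Icc a b ∧ 0 < g s :=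
    (show ∀ᶠ s in 𝓝[Icc 0 1] t₀, s ∈ Icc a b from hnhds).and (hmono t₀ hnhds ((hgc t₀ htab).eventually_const_lt hg0))
  obtain ⟨r, hr, hball⟩ := Metric.mem_nhdsWithin_iff.1 hpos
  have hIccnhds : ∀ s ∈ Metric.ball t₀ r ∩ Icc 0 1, Icc a b ∈ 𝓝[Icc 0 1] s := fun s hs =>
    mem_of_superset (inter_mem (mem_nhdsWithin_of_mem_nhds (Metric.isOpen_ball.mem_nhds hs.1))
      self_mem_nhdsWithin) fun x hx => (hball hx).1
  -- The bump lives where the curve is in the chart and `g > 0`. It need not vanish at 0 or 1, as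
  -- variations are free there, so an end point `t₀` needs no separate treatment.
  let ρ : ContDiffBump t₀ := ⟨r / 4, r / 2, by positivity, by linarith⟩
  have hρ0 : ∀ s ∉ Metric.closedBall t₀ (r / 2), ρ s = 0 ∧ ∀ᶠ x in 𝓝 s, ρ x = 0 := by
    intro s hs
    have : ∀ᶠ x in 𝓝 s, ρ x = 0 := by
      filter_upwards [Metric.isClosed_closedBall.isOpen_compl.mem_nhds hs] with x hx
      refine ρ.zero_of_le_dist ?_
      exact (not_le.1 fun h => hx (Metric.mem_closedBall.2 h)).le
    exact ⟨this.self_of_nhds, this⟩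
  have hcb : Metric.closedBall t₀ (r / 2) ⊆ Metric.ball t₀ r :=
    Metric.closedBall_subset_ball (by linarith)
  let e := trivializationAt V (TangentSpace J : N → Type _) (χ t₀)
  have hbase : ∀ s ∈ Icc a b, χ s ∈ e.baseSet := fun s hs => by
    have := hsrc s hs
    rw [extChartAt_source] at this
    exact this
  -- Constant `Y₀` in the chart, cut off by `ρ`. On `[0, 1]` the values of `e.symmL` outside the
  -- chart are immaterial, since `ρ` vanishes there.
  let U : ∀ t : ℝ, TangentSpace J (χ t) := fun t => ρ t • e.symmL ℝ (χ t) Y₀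
  have hU : ∀ s ∈ Icc a b,
      U s = ρ s • (mfderiv 𝓘(ℝ, V) J κ.symm (κ (χ s)) Y₀ : V) := fun s hs => by
    have h1 := TangentBundle.symmL_trivializationAt (I := J) (x₀ := χ t₀) (x := χ s)
      (by have := hsrc s hs
          rwa [extChartAt_source] at this)
    rw [J.range_eq_univ, mfderivWithin_univ] at h1
    exact congrArg (fun L : V →L[ℝ] V => ρ s • L Y₀) h1
  have hUvar : ContMDiffOn 𝓘(ℝ, ℝ) J.tangent ∞ (fun t => (⟨χ t, U t⟩ : TangentBundle J N))
      (Icc 0 1) := by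
    intro s hs
    by_cases hsb : s ∈ Metric.closedBall t₀ (r / 2)
    · have hsab : s ∈ Icc a b := (hball ⟨hcb hsb, hs⟩).1
      have h1 : ContMDiffWithinAt 𝓘(ℝ, ℝ) J.tangent ∞
          (fun s => e.toOpenPartialHomeomorph.symm (χ s, ρ s • Y₀)) (Icc a b) s := by
        refine (e.contMDiffOn_symm (IB := J) (n := ∞)).comp (t := e.target)
          (s := Icc a b) ((hχ.mono hsub).prodMk (ContDiffOn.contMDiffOn ?_)) (fun x hx => ?_) s hsab
        · exact (ρ.contDiff.smul contDiff_const).contDiffOn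
        · exact e.mem_target.2 (hbase x hx)
      have h2 : ∀ x ∈ Icc a b, (⟨χ x, U x⟩ : TangentBundle J N) =
          e.toOpenPartialHomeomorph.symm (χ x, ρ x • Y₀) := fun x hx => by
        rw [← e.mk_symm (hbase x hx)]
        refine congrArg (TotalSpace.mk (χ x)) ?_
        exact ((e.symmL ℝ (χ x)).map_smul (ρ x) Y₀).symm.trans (e.symmL_apply (hbase x hx) _)
      exact (h1.congr h2 (h2 s hsab)).mono_of_mem_nhdsWithin (hIccnhds s ⟨hcb hsb, hs⟩)
    · have h0 := (contMDiff_zeroSection ℝ (TangentSpace J : N → Type _) (IB := J) (n := ∞)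
        (F := V)).comp_contMDiffOn hχ s hs
      have hz : ∀ x, ρ x = 0 → (⟨χ x, U x⟩ : TangentBundle J N) =
          zeroSection V (TangentSpace J : N → Type _) (χ x) := fun x hx => by
        refine congrArg (TotalSpace.mk (χ x)) ?_
        change ρ x • e.symmL ℝ (χ x) Y₀ = 0
        rw [hx, zero_smul]
      refine h0.congr_of_eventuallyEq ?_ (hz s (hρ0 s hsb).1)
      filter_upwards [mem_nhdsWithin_of_mem_nhds (hρ0 s hsb).2] with x hx
      exact hz x hx
  have hdens : ∀ s ∈ Icc (0 : ℝ) 1, eulerLagrangeDensity β H χ U s = ρ s * g s := by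
    intro s hs
    by_cases hsb : s ∈ Metric.closedBall t₀ (r / 2)
    · have hsab : s ∈ Icc a b := (hball ⟨hcb hsb, hs⟩).1
      rw [eulerLagrangeDensity_const_in_chart hβ hH hs (hsrc s hsab) (hU s hsab), hg]
      simp only
      rw [hder s hsab]
    · have hU0 : U s = 0 := by
        change ρ s • e.symmL ℝ (χ s) Y₀ = 0
        rw [(hρ0 s hsb).1, zero_smul]
      rw [(hρ0 s hsb).1, zero_mul, eulerLagrangeDensity, hU0, map_zero, sub_zero]
      refine (hβ.apply_self (χ s) 0 _).trans ?_
      rw [map_zero]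
      rfl
  have hpos' := intervalIntegral.integral_pos (f := fun s => ρ s * g s) zero_lt_one ?_ ?_ ?_
  · refine hpos'.ne' ((intervalIntegral.integral_congr fun s hs => (hdens s ?_).symm).trans
      (hEL U hUvar))
    rwa [uIcc_of_le zero_le_one] at hs
  · intro s hs
    by_cases hsb : s ∈ Metric.closedBall t₀ (r / 2)
    · have hsab : s ∈ Icc a b := (hball ⟨hcb hsb, hs⟩).1
      exact ρ.continuous.continuousWithinAt.mul
        ((hgc s hsab).mono_of_mem_nhdsWithin (hIccnhds s ⟨hcb hsb, hs⟩))
    · refine (continuousWithinAt_const (b := (0 : ℝ))).congr_of_eventuallyEq ?_ ?_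
      · filter_upwards [mem_nhdsWithin_of_mem_nhds (hρ0 s hsb).2] with x hx
        rw [hx, zero_mul]
      · rw [(hρ0 s hsb).1, zero_mul]
  · intro s hs
    by_cases hsb : s ∈ Metric.closedBall t₀ (r / 2)
    · exact mul_nonneg ρ.nonneg (hball ⟨hcb hsb, Ioc_subset_Icc_self hs⟩).2.le
    · rw [(hρ0 s hsb).1, zero_mul]
  · refine ⟨t₀, ht₀, ?_⟩
    rw [ρ.one_of_mem_closedBall (Metric.mem_closedBall_self ρ.rIn_pos.le), one_mul]
    exact hg0

end EulerLagrange

/-! ### The inverse function theorem on manifolds -/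

/-- By definition the manifold derivative is the derivative of the expression in the preferred
charts at `z` and `f z`. -/
lemma hasFDerivAt_in_charts {V : Type*} [NormedAddCommGroup V] [NormedSpace ℝ V]
    {G : Type*} [TopologicalSpace G] {J : ModelWithCorners ℝ V G} [J.Boundaryless]
    {N : Type*} [TopologicalSpace N] [ChartedSpace G N] {f : N → N} {z : N}
    (hf : MDifferentiableAt J J f z) {A : V →L[ℝ] V} (hA : A = mfderiv J J f z) :
    HasFDerivAt (fun y => extChartAt J (f z) (f ((extChartAt J z).symm y))) A
      (extChartAt J z z) := by
  have h : HasFDerivWithinAt (fun y => extChartAt J (f z) (f ((extChartAt J z).symm y))) A (range J)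
      (extChartAt J z z) := by
    rw [hA]
    exact hf.hasMFDerivAt.2
  rwa [J.range_eq_univ, hasFDerivWithinAt_univ] at h

section InverseFunction

variable {V : Type*} [NormedAddCommGroup V] [NormedSpace ℝ V] [FiniteDimensional ℝ V]
  {G : Type*} [TopologicalSpace G] {J : ModelWithCorners ℝ V G} [J.Boundaryless]
  {N : Type*} [TopologicalSpace N] [ChartedSpace G N] [IsManifold J ∞ N]

/-- A smooth map with injective differential at `z` has a smooth local right inverse. -/
lemma exists_smooth_local_rightInverse {f : N → N} {z : N} (hf : ContMDiffAt J J ∞ f z)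
    (hinj : ∀ X : TangentSpace J z, mfderiv J J f z X = 0 → X = 0) :
    ∃ g : N → N, ContMDiffAt J J ∞ g (f z) ∧ g (f z) = z ∧ ∀ᶠ w in 𝓝 (f z), f (g w) = w := by
  have : CompleteSpace V := FiniteDimensional.complete ℝ V
  obtain ⟨A, hA⟩ : ∃ A : V →L[ℝ] V, A = mfderiv J J f z := ⟨_, rfl⟩
  have hAinj : Function.Injective (A : V →ₗ[ℝ] V) := by
    rw [← LinearMap.ker_eq_bot, LinearMap.ker_eq_bot']
    intro X hX
    refine hinj X (Eq.trans ?_ hX)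
    rw [hA]
    rfl
  let B : V ≃L[ℝ] V := (LinearEquiv.ofInjectiveEndo (A : V →ₗ[ℝ] V) hAinj).toContinuousLinearEquiv
  have hB : (B : V →L[ℝ] V) = A := by ext; rfl
  set κ := extChartAt J z
  set κ' := extChartAt J (f z)
  have hfc : ContDiffAt ℝ ∞ (fun y => κ' (f (κ.symm y))) (κ z) := by
    refine contMDiffAt_iff_contDiffAt.1 (ContMDiffAt.comp (κ z) (I' := J) (g := κ')
      (f := fun y => f (κ.symm y)) ?_ (ContMDiffAt.comp (κ z) (I' := J) ?_
        (contMDiffAt_symm_extChartAt (mem_extChartAt_target z))))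
    · rw [extChartAt_to_inv]
      exact contMDiffAt_extChartAt
    · rw [extChartAt_to_inv]
      exact hf
  have hfd : HasFDerivAt (fun y => κ' (f (κ.symm y))) (B : V →L[ℝ] V) (κ z) := by
    rw [hB]
    exact hasFDerivAt_in_charts (hf.mdifferentiableAt (by simp)) hA
  have hn : (∞ : WithTop ℕ∞) ≠ 0 := by simp
  let e := hfc.toOpenPartialHomeomorph _ hfd hn
  have he : κ' (f (κ.symm (κ z))) = κ' (f z) := by rw [extChartAt_to_inv]
  have hz : κ z ∈ e.source := hfc.mem_toOpenPartialHomeomorph_source hfd hn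
  have hez : e (κ z) = κ' (f z) := he
  have hz' : κ' (f z) ∈ e.target := hez ▸ e.map_source hz
  have hsz : e.symm (κ' (f z)) = κ z := by rw [← hez, e.left_inv hz]
  have hes : ContDiffAt ℝ ∞ e.symm (κ' (f z)) := by
    refine e.contDiffAt_symm hz' (f₀' := B) ?_ ?_
    · rw [hsz]; exact hfd
    · rw [hsz]; exact hfc
  have hg0 : κ.symm (e.symm (κ' (f z))) = z := by rw [hsz, extChartAt_to_inv]
  have hg : ContMDiffAt J J ∞ (fun w => κ.symm (e.symm (κ' w))) (f z) := by
    refine ContMDiffAt.comp (f z) (I' := 𝓘(ℝ, V)) (g := κ.symm) ?_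
      (ContMDiffAt.comp (f z) (I' := 𝓘(ℝ, V)) hes.contMDiffAt contMDiffAt_extChartAt)
    rw [hsz]
    exact contMDiffAt_symm_extChartAt (mem_extChartAt_target z)
  refine ⟨_, hg, hg0, ?_⟩
  have h1 : ∀ᶠ w in 𝓝 (f z), w ∈ κ'.source := extChartAt_source_mem_nhds (f z)
  have h2 : ∀ᶠ w in 𝓝 (f z), κ' w ∈ e.target :=
    (continuousAt_extChartAt (I := J) (f z)).eventually_mem (e.open_target.mem_nhds hz')
  -- The Euclidean theorem only equates coordinates; injectivity of `κ'` gives equality of points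
  -- once both are known to lie in its domain.
  have h3 : ∀ᶠ w in 𝓝 (f z), f (κ.symm (e.symm (κ' w))) ∈ κ'.source := by
    have : ContinuousAt (fun w => f (κ.symm (e.symm (κ' w)))) (f z) :=
      ContinuousAt.comp (g := f) (hg0.symm ▸ hf.continuousAt) hg.continuousAt
    refine this.eventually_mem ?_
    rw [hg0]
    exact extChartAt_source_mem_nhds (f z)
  filter_upwards [h1, h2, h3] with w hw1 hw2 hw3
  exact κ'.injOn hw3 hw1 (e.right_inv hw2)

/-- An injective immersion between manifolds of the same dimension is a diffeomorphism onto an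
open set. -/
theorem isOpen_range_and_exists_inverse {f : N → N} (hf : ContMDiff J J ∞ f)
    (hfinj : Function.Injective f)
    (hinj : ∀ z, ∀ X : TangentSpace J z, mfderiv J J f z X = 0 → X = 0) :
    IsOpen (range f) ∧
      ∃ g : N → N, ContMDiffOn J J ∞ g (range f) ∧ InvOn g f univ (range f) := by
  constructor
  · rw [isOpen_iff_mem_nhds]
    rintro _ ⟨z, rfl⟩
    obtain ⟨g, -, -, hg⟩ := exists_smooth_local_rightInverse (hf z) (hinj z)
    filter_upwards [hg] with w hw using ⟨g w, hw⟩
  · rcases isEmpty_or_nonempty N with hN | hN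
    · exact ⟨id, fun w => isEmptyElim w, fun w => isEmptyElim w, fun w => isEmptyElim w⟩
    · have hl : ∀ z, Function.invFun f (f z) = z := Function.leftInverse_invFun hfinj
      refine ⟨Function.invFun f, ?_, fun z _ => hl z, ?_⟩
      · rintro _ ⟨z, rfl⟩
        obtain ⟨g, hgs, -, hg⟩ := exists_smooth_local_rightInverse (hf z) (hinj z)
        -- Injectivity of `f` forces the global inverse to agree with the smooth local right inverse
        -- near `f z`.
        refine (hgs.congr_of_eventuallyEq ?_).contMDiffWithinAt
        filter_upwards [hg] with w hw
        conv_lhs => rw [← hw, hl]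
      · rintro _ ⟨z, rfl⟩
        rw [hl]

end InverseFunction

/-! ### Graphs of symplectic maps -/

section GraphChart

variable {V : Type*} [NormedAddCommGroup V] [NormedSpace ℝ V]
  {G : Type*} [TopologicalSpace G] (J : ModelWithCorners ℝ V G) [J.Boundaryless]
  {N : Type*} [TopologicalSpace N] [ChartedSpace G N] [IsManifold J ∞ N]

/-- A local homeomorphism of the model vector space, as one of the model space. -/
def modelConj (s : OpenPartialHomeomorph V V) : OpenPartialHomeomorph G G :=
  (J.toHomeomorph.toOpenPartialHomeomorph.trans s).trans
    J.toHomeomorph.symm.toOpenPartialHomeomorph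

lemma modelConj_source (s : OpenPartialHomeomorph V V) :
    (modelConj J s).source = J ⁻¹' s.source := by
  simp [modelConj]
  rfl

lemma modelConj_target (s : OpenPartialHomeomorph V V) :
    (modelConj J s).target = J ⁻¹' s.target := by
  simp [modelConj]
  rfl

lemma modelConj_apply (s : OpenPartialHomeomorph V V) (x : G) :
    J (modelConj J s x) = s (J x) :=
  J.right_inv (by rw [J.range_eq_univ]; exact mem_univ _)

lemma modelConj_mem_contDiffGroupoid {s : OpenPartialHomeomorph V V}
    (hs : ContDiffOn ℝ ∞ s s.source) (hs' : ContDiffOn ℝ ∞ s.symm s.target) :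
    modelConj J s ∈ contDiffGroupoid ∞ J := by
  have hr : ∀ v, J (J.symm v) = v := fun v =>
    J.right_inv (by rw [J.range_eq_univ]; exact mem_univ _)
  rw [contDiffGroupoid, mem_groupoid_of_pregroupoid]
  constructor
  · refine (hs.mono fun v hv => ?_).congr fun v _ => ?_
    · have := hv.1
      rwa [mem_preimage, modelConj_source, mem_preimage, hr] at this
    · change J (modelConj J s (J.symm v)) = s v
      rw [modelConj_apply, hr]
  · refine (hs'.mono fun v hv => ?_).congr fun v _ => ?_
    · have := hv.1
      rwa [mem_preimage, modelConj_target, mem_preimage, hr] at this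
    · change J (modelConj J s.symm (J.symm v)) = s.symm v
      rw [modelConj_apply, hr]

-- A chart followed by a local diffeomorphism of the model space is again compatible with the smooth
-- structure; thus the shear yields admissible slice charts.
omit [IsManifold J ∞ N] in
lemma trans_modelConj_mem_maximalAtlas {s : OpenPartialHomeomorph V V}
    (hs : ContDiffOn ℝ ∞ s s.source) (hs' : ContDiffOn ℝ ∞ s.symm s.target)
    {e : OpenPartialHomeomorph N G} (he : e ∈ IsManifold.maximalAtlas J ∞ N) :
    e.trans (modelConj J s) ∈ IsManifold.maximalAtlas J ∞ N := by
  have hS := modelConj_mem_contDiffGroupoid J hs hs'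
  rw [IsManifold.mem_maximalAtlas_iff] at he ⊢
  intro e' he'
  obtain ⟨h1, h2⟩ := he e' he'
  constructor
  · rw [OpenPartialHomeomorph.trans_symm_eq_symm_trans_symm, OpenPartialHomeomorph.trans_assoc]
    exact (contDiffGroupoid ∞ J).trans ((contDiffGroupoid ∞ J).symm hS) h1
  · rw [← OpenPartialHomeomorph.trans_assoc]
    exact (contDiffGroupoid ∞ J).trans h2 hS

omit [NormedSpace ℝ V] in
/-- The shear `(y, v) ↦ (y, v - h y)` over an open set. -/
def shear (h : V → V) {D : Set V} (hD : IsOpen D) (hh : ContinuousOn h D) :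
    OpenPartialHomeomorph (V × V) (V × V) where
  toFun p := (p.1, p.2 - h p.1)
  invFun p := (p.1, p.2 + h p.1)
  source := D ×ˢ univ
  target := D ×ˢ univ
  map_source' _ hp := ⟨hp.1, mem_univ _⟩
  map_target' _ hp := ⟨hp.1, mem_univ _⟩
  left_inv' _ _ := by simp
  right_inv' _ _ := by simp
  open_source := hD.prod isOpen_univ
  open_target := hD.prod isOpen_univ
  continuousOn_toFun := continuousOn_fst.prodMk
    (continuousOn_snd.sub (hh.comp continuousOn_fst fun _ hp => hp.1))
  continuousOn_invFun := continuousOn_fst.prodMk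
    (continuousOn_snd.add (hh.comp continuousOn_fst fun _ hp => hp.1))

end GraphChart

section Graph

variable {V : Type*} [NormedAddCommGroup V] [NormedSpace ℝ V] [FiniteDimensional ℝ V]
  {G : Type*} [TopologicalSpace G] {J : ModelWithCorners ℝ V G} [J.Boundaryless]
  {N : Type*} [TopologicalSpace N] [ChartedSpace G N] [IsManifold J ∞ N]
  {β : ∀ z : N, TangentSpace J z → TangentSpace J z → ℝ} {Ω : V →L[ℝ] V →L[ℝ] ℝ}

omit [FiniteDimensional ℝ V] in
/-- The graph of a smooth map is an embedded submanifold, and its tangent spaces are the graphs of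
the differentials. -/
lemma exists_isSliceChart_graph {f : N → N} (hf : ContMDiff J J ∞ f) (z : N) :
    ∃ (e : OpenPartialHomeomorph (N × N) (ModelProd G G)) (F : Submodule ℝ (V × V)),
      IsSliceChart (J.prod J) {x : N × N | x.2 = f x.1} (z, f z) e F ∧
      ∀ X : V × V, X ∈ sliceTangentSpace (J.prod J) ((z, f z) : N × N) e F ↔
        X.2 = mfderiv J J f z X.1 := by
  set κ := extChartAt J z with hκ
  set κ' := extChartAt J (f z) with hκ'
  have hx : (extChartAt (J.prod J) ((z, f z) : N × N) : N × N → V × V) =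
      fun y => (κ y.1, κ' y.2) := by
    rw [extChartAt_prod]; rfl
  set D : Set V := κ.target ∩ κ.symm ⁻¹' (f ⁻¹' κ'.source) with hDdef
  have hD : IsOpen D :=
    (continuousOn_extChartAt_symm (I := J) z).isOpen_inter_preimage (isOpen_extChartAt_target z)
      ((isOpen_extChartAt_source (f z)).preimage hf.continuous)
  set h : V → V := fun y => κ' (f (κ.symm y)) with hh
  have hhs : ContDiffOn ℝ ∞ h D := fun y hy =>
    (contMDiffAt_iff_contDiffAt.1 ((contMDiffAt_extChartAt_of_mem hy.2).comp y
      ((hf _).comp y (contMDiffAt_symm_extChartAt hy.1)))).contDiffWithinAt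
  have hzD : κ z ∈ D := ⟨mem_extChartAt_target z, by
    rw [mem_preimage, extChartAt_to_inv]; exact mem_extChartAt_source (f z)⟩
  -- In the product chart the graph is `v = h y`, and the shear moves it to the slice `V × 0`. The
  -- set `D` keeps `f` inside the target chart, where `h` is smooth.
  set s := shear h hD hhs.continuousOn with hs
  have hss : ContDiffOn ℝ ∞ s s.source := contDiffOn_fst.prodMk
    (contDiffOn_snd.sub (hhs.comp contDiffOn_fst fun _ hp => hp.1))
  have hst : ContDiffOn ℝ ∞ s.symm s.target := contDiffOn_fst.prodMk
    (contDiffOn_snd.add (hhs.comp contDiffOn_fst fun _ hp => hp.1))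
  set e₀ := chartAt (ModelProd G G) ((z, f z) : N × N) with he₀
  set e := e₀.trans (modelConj (J.prod J) s) with he
  have hext : ∀ y, e.extend (J.prod J) y = (κ y.1, κ' y.2 - h (κ y.1)) := fun y => by
    change J.prod J (modelConj (J.prod J) s (e₀ y)) = _
    rw [modelConj_apply]
    have : (J.prod J) (e₀ y) = (κ y.1, κ' y.2) := congrFun hx y
    rw [this]
    rfl
  have hsource : ∀ y, y ∈ e.source ↔
      (y.1 ∈ κ.source ∧ y.2 ∈ κ'.source) ∧ κ y.1 ∈ D := fun y => by
    have : (J.prod J) (e₀ y) = (κ y.1, κ' y.2) := congrFun hx y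
    rw [he, OpenPartialHomeomorph.trans_source, mem_inter_iff, modelConj_source, mem_preimage,
      mem_preimage, this, hκ, hκ', extChartAt_source, extChartAt_source, ← hκ, ← hκ']
    refine and_congr ?_ ⟨fun hy => hy.1, fun hy => ⟨hy, mem_univ _⟩⟩
    rfl
  have hself : h (κ z) = κ' (f z) := by rw [hh]; simp only; rw [extChartAt_to_inv]
  refine ⟨e, LinearMap.ker (LinearMap.snd ℝ V V), ⟨?_, ?_, ?_⟩, ?_⟩
  · exact trans_modelConj_mem_maximalAtlas _ hss hst (IsManifold.chart_mem_maximalAtlas _)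
  · exact (hsource _).2 ⟨⟨mem_extChartAt_source z, mem_extChartAt_source (f z)⟩, hzD⟩
  · intro y hy
    obtain ⟨⟨hy1, hy2⟩, hyD⟩ := (hsource y).1 hy
    have hyf : f y.1 ∈ κ'.source := by
      have := hyD.2
      rwa [mem_preimage, κ.left_inv hy1] at this
    have e1 : h (κ y.1) = κ' (f y.1) := by rw [hh]; simp only; rw [κ.left_inv hy1]
    rw [hext, hext, LinearMap.mem_ker, LinearMap.snd_apply, e1, hself]
    simp only [Prod.snd_sub, sub_self, sub_zero, sub_eq_zero, mem_ofPred_eq]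
    exact ⟨fun e => congrArg _ e, fun e => κ'.injOn hy2 hyf e⟩
  · intro X
    obtain ⟨A, hA⟩ : ∃ A : V →L[ℝ] V, A = mfderiv J J f z := ⟨_, rfl⟩
    have hder' : HasFDerivAt h A (κ z) :=
      hasFDerivAt_in_charts ((hf z).mdifferentiableAt (by simp)) hA
    have hsd : HasFDerivAt (fun p : V × V => (p.1, p.2 - h p.1))
        ((ContinuousLinearMap.fst ℝ V V).prod
          (ContinuousLinearMap.snd ℝ V V - A.comp (ContinuousLinearMap.fst ℝ V V)))
        (κ z, κ' (f z)) :=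
      hasFDerivAt_fst.prodMk (hasFDerivAt_snd.sub
        (HasFDerivAt.comp (g := h) (κ z, κ' (f z)) hder' hasFDerivAt_fst))
    -- The product chart has the identity as differential at its centre, so only the shear
    -- contributes: `(X₁, X₂) ↦ (X₁, X₂ - A X₁)`.
    have hmd : HasMFDerivAt (J.prod J) 𝓘(ℝ, V × V) (e.extend (J.prod J)) ((z, f z) : N × N)
        ((ContinuousLinearMap.fst ℝ V V).prod
          (ContinuousLinearMap.snd ℝ V V - A.comp (ContinuousLinearMap.fst ℝ V V))) := by
      have h1 : HasMFDerivAt (J.prod J) 𝓘(ℝ, V × V)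
          (extChartAt (J.prod J) ((z, f z) : N × N)) ((z, f z) : N × N)
          (ContinuousLinearMap.id ℝ (V × V)) := by
        have := (mdifferentiableAt_extChartAt (I := J.prod J)
          (mem_chart_source (ModelProd G G) ((z, f z) : N × N))).hasMFDerivAt
        rwa [mfderiv_extChartAt_self] at this
      have h2 := HasMFDerivAt.comp ((z, f z) : N × N) (g := fun p : V × V => (p.1, p.2 - h p.1))
        (by rw [hx]; exact hsd.hasMFDerivAt) h1
      refine (h2.congr_of_eventuallyEq (Eventually.of_forall fun y => ?_))
      rw [hext, hx]
      rfl
    have key : X ∈ sliceTangentSpace (J.prod J) ((z, f z) : N × N) e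
        (LinearMap.ker (LinearMap.snd ℝ V V)) ↔ X.2 - A X.1 = 0 := by
      rw [sliceTangentSpace, hmd.mfderiv]
      rfl
    rw [key, sub_eq_zero, hA]
    rfl

/-- The graph of a symplectic map is a Lagrangian submanifold. -/
theorem isLagrangianSubmanifold_graph (hβ : IsDarboux J β Ω) {f : N → N}
    (hf : ContMDiff J J ∞ f) (hfβ : ∀ z, ∀ X Y : TangentSpace J z,
      β (f z) (mfderiv J J f z X) (mfderiv J J f z Y) = β z X Y)
    (hinj : ∀ z, ∀ X : TangentSpace J z, mfderiv J J f z X = 0 → X = 0)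
    {Ξ : ∀ x : N × N, TangentSpace (J.prod J) x → TangentSpace (J.prod J) x → ℝ}
    (hΞ : ∀ (x : N × N) (X Y : V × V), Ξ x X Y = β x.2 X.2 Y.2 - β x.1 X.1 Y.1) :
    IsLagrangianSubmanifold (J.prod J) Ξ {x : N × N | x.2 = f x.1} := by
  rintro ⟨z, w⟩ hw
  obtain rfl : w = f z := hw
  obtain ⟨e, F, hs, hT⟩ := exists_isSliceChart_graph hf z
  refine ⟨e, F, hs, fun X => ?_⟩
  obtain ⟨A, hA⟩ : ∃ A : V →L[ℝ] V, A = mfderiv J J f z := ⟨_, rfl⟩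
  have hT' : ∀ X : V × V, X ∈ sliceTangentSpace (J.prod J) ((z, f z) : N × N) e F ↔
      X.2 = A X.1 := fun X => (hT X).trans (by rw [hA]; rfl)
  have hAβ : ∀ X Y : V, Ω (A X) (A Y) = Ω X Y := fun X Y => by
    refine (hβ.apply_self (f z) (A X) (A Y)).symm.trans (Eq.trans ?_ (hβ.apply_self z X Y))
    rw [hA]
    exact hfβ z X Y
  have hAsurj : Function.Surjective A := by
    refine (LinearMap.injective_iff_surjective (f := (A : V →ₗ[ℝ] V))).1 ?_
    rw [← LinearMap.ker_eq_bot, LinearMap.ker_eq_bot']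
    intro X hX
    refine hinj z X (Eq.trans ?_ hX)
    rw [hA]
    rfl
  have hΞ' : ∀ X Y : V × V, Ξ (z, f z) X Y = Ω X.2 Y.2 - Ω X.1 Y.1 := fun X Y =>
    (hΞ _ X Y).trans (congrArg₂ (· - ·) (hβ.apply_self (f z) X.2 Y.2) (hβ.apply_self z X.1 Y.1))
  obtain ⟨X, rfl⟩ : ∃ X' : V × V, X = X' := ⟨X, rfl⟩
  constructor
  · intro hX Y hY
    obtain ⟨Y, rfl⟩ : ∃ Y' : V × V, Y = Y' := ⟨Y, rfl⟩
    refine (hΞ' X Y).trans ?_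
    rw [(hT' X).1 hX, (hT' Y).1 hY, hAβ, sub_self]
  · intro hX
    -- Orthogonality to `(Y, A Y)` reads `Ω (X₂) (A Y) = Ω (X₁) Y = Ω (A X₁) (A Y)`. As `A` is onto,
    -- `X₂ - A X₁` is orthogonal to everything.
    refine (hT' X).2 (sub_eq_zero.1 (hβ.nondegenerate _ fun Z => ?_))
    obtain ⟨Y, rfl⟩ := hAsurj Z
    have := (hΞ' X (Y, A Y)).symm.trans (hX (Y, A Y) ((hT' _).2 rfl))
    rw [hβ.swap, map_sub, sub_apply, hAβ, this, neg_zero]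

end Graph

/-! ### Hamiltonian flows -/

section Integrand

variable {V : Type*} [NormedAddCommGroup V] [NormedSpace ℝ V]
  {G : Type*} [TopologicalSpace G] {J : ModelWithCorners ℝ V G} [J.Boundaryless]
  {N : Type*} [TopologicalSpace N] [ChartedSpace G N] [IsManifold J ∞ N]
  {η : ∀ x : N, TangentSpace J x →L[ℝ] ℝ} {θ : V →L[ℝ] V →L[ℝ] ℝ} {H : N × ℝ → ℝ} {χ : ℝ → N}

/-- The pull-back of `i_U d(η - H dt)` by a curve. -/
lemma extDerivOneForm_extendedForm_curve (h : IsLinearInCharts J η θ)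
    (hH : ContMDiffOn (J.prod 𝓘(ℝ, ℝ)) 𝓘(ℝ, ℝ) ∞ H (univ ×ˢ Icc (0 : ℝ) 1))
    (hχ : ContMDiffOn 𝓘(ℝ, ℝ) J ∞ χ (Icc 0 1)) (U : ∀ t : ℝ, TangentSpace J (χ t)) {t : ℝ}
    (ht : t ∈ Icc (0 : ℝ) 1) :
    extDerivOneForm (J.prod 𝓘(ℝ, ℝ)) (extendedForm η H) (univ ×ˢ Icc (0 : ℝ) 1) (χ t, t)
      (mfderiv J (J.prod 𝓘(ℝ, ℝ)) (fun z => (z, t)) (χ t) (U t))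
      (mfderivWithin 𝓘(ℝ, ℝ) (J.prod 𝓘(ℝ, ℝ)) (fun s => (χ s, s)) (Icc 0 1) t (1 : ℝ)) =
    eulerLagrangeDensity (extDerivOneForm J η univ) H χ U t := by
  have e1 : mfderiv J (J.prod 𝓘(ℝ, ℝ)) (fun z => (z, t)) (χ t) (U t) = ((U t, 0) : V × ℝ) := by
    rw [mfderiv_prod_left]
    rfl
  have hu : UniqueMDiffWithinAt 𝓘(ℝ, ℝ) (Icc (0 : ℝ) 1) t :=
    (uniqueDiffOn_Icc zero_lt_one t ht).uniqueMDiffWithinAt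
  have e2 : mfderivWithin 𝓘(ℝ, ℝ) (J.prod 𝓘(ℝ, ℝ)) (fun s => (χ s, s)) (Icc 0 1) t (1 : ℝ) =
      ((velocity J χ t, 1) : V × ℝ) :=
    DFunLike.congr_fun ((((hχ t ht).mdifferentiableWithinAt (by simp)).hasMFDerivWithinAt.prodMk
      (hasMFDerivWithinAt_id (Icc (0 : ℝ) 1) t)).mfderivWithin hu) (1 : ℝ)
  rw [e1, e2]
  refine (extDerivOneForm_extendedForm h hH (χ t) ht _ _).trans ?_
  rw [eulerLagrangeDensity]
  exact congrArg (fun a : ℝ => a - spaceDifferential J H t (χ t) (U t))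
    (extDerivOneForm_of_isLinearInCharts h (χ t) _ _).symm

end Integrand

section Flow

variable {V : Type u} [NormedAddCommGroup V] [NormedSpace ℝ V] [FiniteDimensional ℝ V]
  {G : Type*} [TopologicalSpace G] {J : ModelWithCorners ℝ V G} [J.Boundaryless]
  {N : Type*} [TopologicalSpace N] [ChartedSpace G N] [IsManifold J ∞ N] [T2Space N]
  {β : ∀ z : N, TangentSpace J z → TangentSpace J z → ℝ} {Ω : V →L[ℝ] V →L[ℝ] ℝ}
  {H : N × ℝ → ℝ} {φ : ℝ → N → N}

-- A vector killed by the differential pairs to zero with every `Y`, because the pairing can be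
-- computed after applying the differential.
omit [FiniteDimensional ℝ V] [J.Boundaryless] [T2Space N] in
lemma IsDarboux.eq_zero_of_mfderiv_eq_zero (hβ : IsDarboux J β Ω) {f : N → N} {z : N}
    (hf : ∀ X Y : TangentSpace J z, β (f z) (mfderiv J J f z X) (mfderiv J J f z Y) = β z X Y)
    (X : TangentSpace J z) (hX : mfderiv J J f z X = 0) : X = 0 := by
  refine hβ.nondegenerate X fun Y => ?_
  refine (hβ.apply_self z Y X).symm.trans ((hf Y X).symm.trans ?_)
  rw [hX]
  refine (hβ.apply_self (f z) _ 0).trans ?_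
  rw [map_zero]

lemma contMDiff_flow (hβ : IsDarboux J β Ω)
    (hH : ContMDiffOn (J.prod 𝓘(ℝ, ℝ)) 𝓘(ℝ, ℝ) ∞ H (univ ×ˢ Icc (0 : ℝ) 1))
    (hφ₀ : ∀ z, φ 0 z = z) (hφ : ∀ z, IsHamiltonCurve J Ω H (fun t => φ t z)) :
    ContMDiff J J ∞ (φ 1) := fun z => by
  obtain ⟨W, hW, hz, hs, -⟩ := isSymplecticNear_flow hβ hH hφ₀ hφ z
  exact (hs z hz).contMDiffAt (hW.mem_nhds hz)

lemma symplectic_flow (hβ : IsDarboux J β Ω)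
    (hH : ContMDiffOn (J.prod 𝓘(ℝ, ℝ)) 𝓘(ℝ, ℝ) ∞ H (univ ×ˢ Icc (0 : ℝ) 1))
    (hφ₀ : ∀ z, φ 0 z = z) (hφ : ∀ z, IsHamiltonCurve J Ω H (fun t => φ t z)) (z : N)
    (X Y : TangentSpace J z) :
    β (φ 1 z) (mfderiv J J (φ 1) z X) (mfderiv J J (φ 1) z Y) = β z X Y := by
  obtain ⟨W, -, hz, -, h⟩ := isSymplecticNear_flow hβ hH hφ₀ hφ z
  exact h z hz X Y

lemma eqOn_flow (hβ : IsDarboux J β Ω)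
    (hH : ContMDiffOn (J.prod 𝓘(ℝ, ℝ)) 𝓘(ℝ, ℝ) ∞ H (univ ×ˢ Icc (0 : ℝ) 1))
    (hφ₀ : ∀ z, φ 0 z = z) (hφ : ∀ z, IsHamiltonCurve J Ω H (fun t => φ t z)) {χ : ℝ → N}
    (hχ : IsHamiltonCurve J Ω H χ) : EqOn χ (fun t => φ t (χ 0)) (Icc 0 1) := by
  obtain ⟨σ, hσ⟩ := exists_dualEquiv hβ.nondegenerate
  exact hχ.eqOn hβ hσ hH (hφ _) (left_mem_Icc.2 zero_le_one) (hφ₀ _).symm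

/-- Uniqueness used backwards: flow lines that meet at time 1 already agree at time 0. -/
lemma injective_flow (hβ : IsDarboux J β Ω)
    (hH : ContMDiffOn (J.prod 𝓘(ℝ, ℝ)) 𝓘(ℝ, ℝ) ∞ H (univ ×ˢ Icc (0 : ℝ) 1))
    (hφ₀ : ∀ z, φ 0 z = z) (hφ : ∀ z, IsHamiltonCurve J Ω H (fun t => φ t z)) :
    Function.Injective (φ 1) := fun z w hzw => by
  obtain ⟨σ, hσ⟩ := exists_dualEquiv hβ.nondegenerate
  have := (hφ z).eqOn hβ hσ hH (hφ w) (right_mem_Icc.2 zero_le_one) hzw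
    (left_mem_Icc.2 zero_le_one)
  simpa only [hφ₀] using this

end Flow

/-! ### The cotangent bundle -/

section Product

variable {A B : Type*} [NormedAddCommGroup A] [NormedSpace ℝ A] [NormedAddCommGroup B]
  [NormedSpace ℝ B] {F : A × B → ℝ} {a : A} {b : B}

lemma fderiv_comp_prodMk_left (hF : DifferentiableAt ℝ F (a, b)) (w : A) :
    fderiv ℝ (fun x => F (x, b)) a w = fderiv ℝ F (a, b) (w, 0) := by
  have := (HasFDerivAt.comp (f := fun x => (x, b)) a hF.hasFDerivAt (hasFDerivAt_prodMk_left a b)).fderiv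
  exact (DFunLike.congr_fun this w).trans (by simp)

lemma fderiv_comp_prodMk_right (hF : DifferentiableAt ℝ F (a, b)) (w : B) :
    fderiv ℝ (fun y => F (a, y)) b w = fderiv ℝ F (a, b) (0, w) := by
  have := (HasFDerivAt.comp (f := fun y => (a, y)) b hF.hasFDerivAt (hasFDerivAt_prodMk_right a b)).fderiv
  exact (DFunLike.congr_fun this w).trans (by simp)

lemma hasDerivWithinAt_prod_iff {c : ℝ → A × B} {c' : A × B} {s : Set ℝ} {t : ℝ} :
    HasDerivWithinAt c c' s t ↔ HasDerivWithinAt (fun x => (c x).1) c'.1 s t ∧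
      HasDerivWithinAt (fun x => (c x).2) c'.2 s t :=
  ⟨fun h => ⟨(ContinuousLinearMap.fst ℝ A B).hasFDerivAt.comp_hasDerivWithinAt t h,
    (ContinuousLinearMap.snd ℝ A B).hasFDerivAt.comp_hasDerivWithinAt t h⟩,
    fun h => h.1.prodMk h.2⟩

end Product

section Cotangent

variable {E : Type*} [NormedAddCommGroup E] [NormedSpace ℝ E]
  {Q : Type*} [TopologicalSpace Q] [ChartedSpace E Q] [IsManifold 𝓘(ℝ, E) ∞ Q]

lemma isLinearInCharts_liouville :
    IsLinearInCharts (cotModel E) (liouville (E := E) (Q := Q)) (canonicalOneForm E) :=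
  fun _ _ hy => oneFormInChart_liouville hy

lemma isDarboux_symplecticForm :
    IsDarboux (cotModel E) (symplecticForm (E := E) (Q := Q)) (canonicalForm E) where
  swap := canonicalForm_swap
  nondegenerate _ := eq_zero_of_canonicalForm
  chart _ _ hz X Y := isLinearInCharts_liouville.extDerivOneForm_eq_mfderiv hz X Y

variable {H : Cotangent E Q × ℝ → ℝ} {χ : ℝ → Cotangent E Q}

lemma differentiableAt_hamiltonianInChart {V : Type*} [NormedAddCommGroup V] [NormedSpace ℝ V]
    {G : Type*} [TopologicalSpace G] {J : ModelWithCorners ℝ V G} [J.Boundaryless]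
    {N : Type*} [TopologicalSpace N] [ChartedSpace G N] [IsManifold J ∞ N] {H : N × ℝ → ℝ}
    (hH : ContMDiffOn (J.prod 𝓘(ℝ, ℝ)) 𝓘(ℝ, ℝ) ∞ H (univ ×ˢ Icc (0 : ℝ) 1)) {z : N} {t : ℝ}
    (ht : t ∈ Icc (0 : ℝ) 1) {y : V} (hy : y ∈ (extChartAt J z).target) :
    DifferentiableAt ℝ (fun x => hamiltonianInChart J H z (t, x)) y :=
  mdifferentiableAt_iff_differentiableAt.1
    (((contMDiff_hamiltonian hH ht).mdifferentiableAt (by simp)).comp y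
      (mdifferentiableAt_symm_extChartAt hy))

/-- Hamilton's equations in canonical coordinates. -/
lemma satisfiesHamilton_iff
    (hH : ContMDiffOn ((cotModel E).prod 𝓘(ℝ, ℝ)) 𝓘(ℝ, ℝ) ∞ H (phaseDomain E Q)) :
    SatisfiesHamilton H χ ↔ IsHamiltonCurve (cotModel E) (canonicalForm E) H χ := by
  refine forall₂_congr fun t ht => and_congr_right fun _ => ?_
  set κ : PartialEquiv (Cotangent E Q) (E × (E →L[ℝ] ℝ)) := extChartAt (cotModel E) (χ t)
  obtain ⟨D, hD⟩ : ∃ D : E × (E →L[ℝ] ℝ) → ℝ,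
    D = fun Y => spaceDifferential (cotModel E) H t (χ t) Y := ⟨_, rfl⟩
  -- The pairing of `(w, b)` with the velocity is `b u' - p' w`. Testing with `(0, b)` and `(w, 0)`
  -- separates the two Hamilton equations, and additivity recombines them.
  have hadd : ∀ w b, D (w, b) = D (w, 0) + D (0, b) := fun w b => by
    rw [hD]
    refine Eq.trans ?_ ((spaceDifferential (cotModel E) H t (χ t)).map_add (w, 0) (0, b))
    refine congrArg (spaceDifferential (cotModel E) H t (χ t)) ?_
    exact Prod.ext (add_zero w).symm (zero_add b).symm
  have hdiff : DifferentiableAt ℝ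
      (fun x => hamiltonianInChart (cotModel E) H (χ t) (t, x)) ((κ (χ t)).1, (κ (χ t)).2) :=
    differentiableAt_hamiltonianInChart hH ht (mem_extChartAt_target _)
  have h1 : ∀ w : E, fderiv ℝ (fun a => H (κ.symm (a, (κ (χ t)).2), t)) (κ (χ t)).1 w =
      D (w, 0) := fun w => by
    rw [hD]
    exact (fderiv_comp_prodMk_left hdiff w).trans (fderiv_hamiltonianInChart_self hH ht _)
  have h2 : ∀ b : E →L[ℝ] ℝ, fderiv ℝ (fun b => H (κ.symm ((κ (χ t)).1, b), t)) (κ (χ t)).2 b =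
      D (0, b) := fun b => by
    rw [hD]
    exact (fderiv_comp_prodMk_right hdiff b).trans (fderiv_hamiltonianInChart_self hH ht _)
  constructor
  · rintro ⟨u', p', hu, hp, hb, hw⟩
    refine ⟨(u', p'), hasDerivWithinAt_prod_iff.2 ⟨hu, hp⟩, ?_⟩
    rintro ⟨w, b⟩
    rw [canonicalForm_apply]
    have e1 := (hb b).trans (h2 b)
    have e2 := (hw w).trans (congrArg Neg.neg (h1 w))
    have e3 : spaceDifferential (cotModel E) H t (χ t) (w, b) = D (w, b) := by rw [hD]
    refine Eq.trans ?_ e3.symm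
    rw [hadd, ← e1]
    simp only
    rw [e2]
    ring
  · rintro ⟨⟨u', p'⟩, hv, hY⟩
    have hY' : ∀ w b, b u' - p' w = D (w, b) := fun w b => by
      rw [hD]
      exact hY (w, b)
    have hD0 : D (0, 0) = 0 := by
      rw [← hY']; simp
    obtain ⟨hu, hp⟩ := hasDerivWithinAt_prod_iff.1 hv
    refine ⟨u', p', hu, hp, fun b => ?_, fun w => ?_⟩
    · refine Eq.trans ?_ (h2 b).symm
      rw [← hY', map_zero, sub_zero]
    · refine Eq.trans ?_ (congrArg Neg.neg (h1 w).symm)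
      rw [← hY']
      simp

/-- The Euler-Lagrange equations are Hamilton's equations. -/
theorem mem_eulerLagrangeSolutions_iff [FiniteDimensional ℝ E]
    (hH : ContMDiffOn ((cotModel E).prod 𝓘(ℝ, ℝ)) 𝓘(ℝ, ℝ) ∞ H (phaseDomain E Q)) :
    χ ∈ eulerLagrangeSolutions H ↔
      IsHamiltonCurve (cotModel E) (canonicalForm E) H χ := by
  have hβ := isDarboux_symplecticForm (E := E) (Q := Q)
  have key : ContMDiffOn 𝓘(ℝ, ℝ) (cotModel E) ∞ χ (Icc 0 1) →
      ∀ U : ∀ t : ℝ, TangentSpace (cotModel E) (χ t),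
      eulerLagrangeForm H χ U =
        ∫ t in (0 : ℝ)..1, eulerLagrangeDensity (symplecticForm (E := E) (Q := Q)) H χ U t :=
    fun hχ U => intervalIntegral.integral_congr fun t ht =>
      extDerivOneForm_extendedForm_curve isLinearInCharts_liouville hH hχ U
        (by rwa [uIcc_of_le zero_le_one] at ht)
  constructor
  · rintro ⟨hχ, hEL⟩
    exact isHamiltonCurve_of_eulerLagrange hβ hH hχ fun U hU => (key hχ U).symm.trans (hEL U hU)
  · intro h
    obtain ⟨σ, hσ⟩ := exists_dualEquiv hβ.nondegenerate
    -- Hamilton's equations presuppose only differentiability, whereas fields are smooth; smoothness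
    -- comes from the equation itself.
    have hχ := h.contMDiffOn hβ hσ hH
    refine ⟨hχ, fun U _ => (key hχ U).trans
      ((intervalIntegral.integral_congr (g := fun _ => (0 : ℝ)) fun t ht => ?_).trans
        intervalIntegral.integral_zero)⟩
    exact h.eulerLagrangeDensity_eq_zero hβ hχ U (by rwa [uIcc_of_le zero_le_one] at ht)

lemma diffSymplecticForm_apply (x : Cotangent E Q × Cotangent E Q)
    (X Y : (E × (E →L[ℝ] ℝ)) × (E × (E →L[ℝ] ℝ))) :
    diffSymplecticForm x X Y = symplecticForm x.2 X.2 Y.2 - symplecticForm x.1 X.1 Y.1 := by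
  have e1 : ∀ Z : (E × (E →L[ℝ] ℝ)) × (E × (E →L[ℝ] ℝ)),
      mfderiv ((cotModel E).prod (cotModel E)) (cotModel E) Prod.fst x Z = Z.1 := fun Z => by
    rw [mfderiv_fst]
    rfl
  have e2 : ∀ Z : (E × (E →L[ℝ] ℝ)) × (E × (E →L[ℝ] ℝ)),
      mfderiv ((cotModel E).prod (cotModel E)) (cotModel E) Prod.snd x Z = Z.2 := fun Z => by
    rw [mfderiv_snd]
    rfl
  exact congrArg₂ (fun a b : ℝ => a - b)
    (congrArg₂ (fun a b : E × (E →L[ℝ] ℝ) => symplecticForm x.2 a b) (e2 X) (e2 Y))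
    (congrArg₂ (fun a b : E × (E →L[ℝ] ℝ) => symplecticForm x.1 a b) (e1 X) (e1 Y))

end Cotangent

end HamiltonianField

/-! ### The theorem -/

open HamiltonianField in
theorem theorem3p1 {E : Type*} [NormedAddCommGroup E] [NormedSpace ℝ E] [FiniteDimensional ℝ E]
    {Q : Type*} [TopologicalSpace Q] [T2Space Q] [ChartedSpace E Q] [IsManifold 𝓘(ℝ, E) ∞ Q]
    (H : HamiltonianField.Cotangent E Q × ℝ → ℝ)
    (hH : ContMDiffOn ((HamiltonianField.cotModel E).prod 𝓘(ℝ, ℝ)) 𝓘(ℝ, ℝ) ∞ H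
      (HamiltonianField.phaseDomain E Q))
    (φ : ℝ → HamiltonianField.Cotangent E Q → HamiltonianField.Cotangent E Q)
    (hφ : HamiltonianField.IsHamiltonianFlow H φ) :
    HamiltonianField.boundaryMap '' HamiltonianField.eulerLagrangeSolutions H =
        {x | x.2 = φ 1 x.1} ∧
      HamiltonianField.IsSymplectomorphismOnto (φ 1) (Set.range (φ 1)) ∧
      ((∀ w, ∃ χ, HamiltonianField.SatisfiesHamilton H χ ∧ χ 1 = w) →
        HamiltonianField.IsSymplectomorphismOnto (φ 1) Set.univ) ∧
      HamiltonianField.IsLagrangianSubmanifold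
        ((HamiltonianField.cotModel E).prod (HamiltonianField.cotModel E))
        HamiltonianField.diffSymplecticForm
        (HamiltonianField.boundaryMap '' HamiltonianField.eulerLagrangeSolutions H) := by
  have hβ := isDarboux_symplecticForm (E := E) (Q := Q)
  have hφ₀ := hφ.initial
  have hφ₁ : ∀ z, IsHamiltonCurve (cotModel E) (canonicalForm E) H (fun t => φ t z) := fun z =>
    (satisfiesHamilton_iff hH).1 (hφ.hamilton z)
  have hend : ∀ χ, IsHamiltonCurve (cotModel E) (canonicalForm E) H χ → χ 1 = φ 1 (χ 0) :=
    fun χ hχ => eqOn_flow hβ hH hφ₀ hφ₁ hχ (Set.right_mem_Icc.2 zero_le_one)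
  have hsmooth := contMDiff_flow hβ hH hφ₀ hφ₁
  have hsympl := symplectic_flow hβ hH hφ₀ hφ₁
  have hinj := injective_flow hβ hH hφ₀ hφ₁
  have himm : ∀ z, ∀ X : TangentSpace (cotModel E) z,
      mfderiv (cotModel E) (cotModel E) (φ 1) z X = 0 → X = 0 := fun z =>
    hβ.eq_zero_of_mfderiv_eq_zero (hsympl z)
  have hgraph : boundaryMap '' eulerLagrangeSolutions H = {x | x.2 = φ 1 x.1} := by
    ext ⟨z, w⟩
    constructor
    · rintro ⟨χ, hχ, hzw⟩
      obtain ⟨rfl, rfl⟩ := Prod.mk.inj hzw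
      exact hend χ ((mem_eulerLagrangeSolutions_iff hH).1 hχ)
    · rintro (rfl : w = φ 1 z)
      exact ⟨fun t => φ t z, (mem_eulerLagrangeSolutions_iff hH).2 (hφ₁ z),
        Prod.ext (hφ₀ z) rfl⟩
  obtain ⟨hopen, hinv⟩ := isOpen_range_and_exists_inverse hsmooth hinj himm
  have hrange : IsSymplectomorphismOnto (φ 1) (Set.range (φ 1)) :=
    ⟨hopen, Set.image_univ (f := φ 1) ▸ hinj.injOn.bijOn_image, hsmooth, hinv, hsympl⟩
  refine ⟨hgraph, hrange, fun h => ?_, ?_⟩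
  -- A solution ending at `w` is a flow line, so `w` is the image of its initial point.
  · have : Set.range (φ 1) = Set.univ := Set.range_eq_univ.2 fun w => by
      obtain ⟨χ, hχ, rfl⟩ := h w
      exact ⟨χ 0, (hend χ ((satisfiesHamilton_iff hH).1 hχ)).symm⟩
    exact this ▸ hrange
  · rw [hgraph]
    exact isLagrangianSubmanifold_graph hβ hsmooth hsympl himm diffSymplecticForm_apply

end
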